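/- Let $\mathbb K$ be an algebraically closed field of characteristic zero, let $n\ge 2$ be even and put $m=n/2$. For $n\times n$ matrices $A_1,\dots,A_m$ over $\mathbb K$ let $$Q_n(A_1,\dots,A_m)=\sum_{\sigma\in S_n}\operatorname{sgn}(\sigma)\prod_{j=1}^{m}\bigl((A_j)_{\sigma(2j-1),\sigma(2j)}-(A_j)_{\sigma(2j),\sigma(2j-1)}\bigr).$$ Let $\operatorname{Pf}$ denote the Pfaffian of skew-symmetric $n\times n$ matrices. (1) $Q_n$ is multilinear and symmetric in $A_1,\dots,A_m$, and $Q_n(X,\dots,X)=2^{m}\,m!\,\operatorname{Pf}(X-X^T)$ for every $X\in M(n,\mathbb K)$. (2) $Q_n$ is the only function $M(n,\mathbb K)^m\to\mathbb K$ with the properties in (1). It is the full polarization of $2^{m}m!\operatorname{Pf}(X-X^T)$: for all $A_1,\dots,A_m$, $m!\,Q_n(A_1,\dots,A_m)$ is the coefficient of $\alpha_1\cdots\alpha_m$ in the polynomial $2^{m}m!\operatorname{Pf}(Y-Y^T)$, where $Y=\sum_j\alpha_jA_j$. (3) Let $SO(n,\mathbb K)=\{A\in M(n,\mathbb K): AA^T=I,\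 \det A=1\}$ and let $i\in\mathbb K$ satisfy $i^2=-1$. Consider the maximal torus of $SO(n,\mathbb K)$ of the block diagonal matrices with diagonal blocks $$\frac12\begin{pmatrix}x_j+x_j^{-1}& i(x_j-x_j^{-1})\\ -i(x_j-x_j^{-1})& x_j+x_j^{-1}\end{pmatrix},\qquad x_j\in\mathbb K^*,\ j=1,\dots,m,$$ let $L_j$ be the character $x_j$ of it, written additively, and take $L_j\pm L_k$ ($j<k$) as the positive roots. The half-spin representations have the highest weights $\frac12(L_1+\dots+L_{m-1}\pm L_m)$. There exist finite dimensional irreducible rational representations $D_+$ and $D_-$ of $SO(n,\mathbb K)$ whose highest weights are twice these, that is $L_1+\dots+L_{m-1}\pm L_m$, and for all such $D_+$ and $D_-$ and all $X\in SO(n,\mathbb K)$, $$\operatorname{Pf}(X-X^T)=i^{m}\bigl(\tau_{D_+}(X)-\tau_{D_-}(X)\bigr),$$ where $\tau_{D_\pm}(X)$ is the trace of $D_\pm(X)$. -/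

import Mathlib

open scoped Nat

namespace SOEven

/-- The bijection `(j, a) ↦ 2 j + a` from `Fin m × Fin 2` onto `Fin (2 * m)`. Counting from zero,
the `j`-th pair of consecutive indices is `pairIdx (j, 0) = 2 j`, `pairIdx (j, 1) = 2 j + 1`. -/
def pairIdx {m : ℕ} : Fin m × Fin 2 ≃ Fin (2 * m) :=
  finProdFinEquiv.trans (finCongr (Nat.mul_comm m 2))

theorem pairIdx_val {m : ℕ} (j : Fin m) (a : Fin 2) :
    ((pairIdx (j, a) : Fin (2 * m)) : ℕ) = 2 * (j : ℕ) + (a : ℕ) := by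
  simp [pairIdx, finProdFinEquiv, Nat.add_comm]

/-- The function `Q_n`, with `n = 2 m`, of `m` matrices of size `n × n`. -/
def Q {R : Type*} [CommRing R] {m : ℕ}
    (A : Fin m → Matrix (Fin (2 * m)) (Fin (2 * m)) R) : R :=
  ∑ σ : Equiv.Perm (Fin (2 * m)), ((Equiv.Perm.sign σ : ℤ) : R) *
    ∏ j : Fin m, (A j (σ (pairIdx (j, 0))) (σ (pairIdx (j, 1)))
      - A j (σ (pairIdx (j, 1))) (σ (pairIdx (j, 0))))

/-- The perfect matchings `{a₁,b₁}, …, {a_m,b_m}` of `Fin (2 * m)`, each listed once, as the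
permutation `a₁, b₁, …, a_m, b_m` with `a_j < b_j` and `a₁ < ⋯ < a_m`. -/
def matchings (m : ℕ) : Finset (Equiv.Perm (Fin (2 * m))) :=
  Finset.univ.filter fun σ =>
    (∀ j : Fin m, σ (pairIdx (j, 0)) < σ (pairIdx (j, 1))) ∧
      ∀ j k : Fin m, j < k → σ (pairIdx (j, 0)) < σ (pairIdx (k, 0))

/-- The Pfaffian of a (skew-symmetric) matrix of size `2 m`: the signed sum over the perfect
matchings of the index set. -/
def Pf {R : Type*} [CommRing R] {m : ℕ} (B : Matrix (Fin (2 * m)) (Fin (2 * m)) R) : R :=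
  ∑ σ ∈ matchings m, ((Equiv.Perm.sign σ : ℤ) : R) *
    ∏ j : Fin m, B (σ (pairIdx (j, 0))) (σ (pairIdx (j, 1)))

/-- `F` is multilinear, symmetric, and restricts on the diagonal to
`X ↦ 2 ^ (n / 2) * (n / 2)! * Pf (X - Xᵀ)`, where `n = 2 m`. -/
structure IsPfPolarization {K : Type*} [Field K] {m : ℕ}
    (F : (Fin m → Matrix (Fin (2 * m)) (Fin (2 * m)) K) → K) : Prop where
  multilinear : ∃ M : MultilinearMap K (fun _ : Fin m => Matrix (Fin (2 * m)) (Fin (2 * m)) K) K,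
    ∀ A, M A = F A
  symmetric : ∀ (π : Equiv.Perm (Fin m)) (A : Fin m → Matrix (Fin (2 * m)) (Fin (2 * m)) K),
    F (fun j => A (π j)) = F A
  diagonal : ∀ X : Matrix (Fin (2 * m)) (Fin (2 * m)) K,
    F (fun _ => X) = 2 ^ m * (m ! : K) * Pf (X - X.transpose)

/-- The generic combination `∑ j, α_j A_j` in indeterminates `α_j`. -/
noncomputable def genericSum {K : Type*} [Field K] {m : ℕ}
    (A : Fin m → Matrix (Fin (2 * m)) (Fin (2 * m)) K) :
    Matrix (Fin (2 * m)) (Fin (2 * m)) (MvPolynomial (Fin m) K) :=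
  ∑ j : Fin m, (MvPolynomial.X j : MvPolynomial (Fin m) K) • (A j).map MvPolynomial.C

/-- The special orthogonal group of size `2 m` over `K`. -/
abbrev SO (m : ℕ) (K : Type*) [Field K] : Submonoid (Matrix (Fin (2 * m)) (Fin (2 * m)) K) :=
  Matrix.specialOrthogonalGroup (Fin (2 * m)) K

/-- The `2 × 2` block with eigenvalues `x` and `x⁻¹` (here `i` is a square root of `-1`). -/
def torusBlock {K : Type*} [Field K] (i : K) (x : Kˣ) : Matrix (Fin 2) (Fin 2) K :=
  !![((x : K) + (x : K)⁻¹) / 2, i * ((x : K) - (x : K)⁻¹) / 2;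
     -(i * ((x : K) - (x : K)⁻¹) / 2), ((x : K) + (x : K)⁻¹) / 2]

/-- The block diagonal matrix with diagonal blocks `torusBlock i (x j)`. -/
def torusMatrix {K : Type*} [Field K] {m : ℕ} (i : K) (x : Fin m → Kˣ) :
    Matrix (Fin (2 * m)) (Fin (2 * m)) K :=
  Matrix.reindex ((Equiv.prodComm (Fin 2) (Fin m)).trans pairIdx)
    ((Equiv.prodComm (Fin 2) (Fin m)).trans pairIdx)
    (Matrix.blockDiagonal fun j => torusBlock i (x j))

theorem torusBlock_mul_transpose {K : Type*} [Field K] [CharZero K] {i : K} (hi : i ^ 2 = -1)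
    (x : Kˣ) : torusBlock i x * (torusBlock i x).transpose = 1 := by
  have hx : (x : K) ≠ 0 := x.ne_zero
  ext a b
  fin_cases a <;> fin_cases b <;> simp [torusBlock, Matrix.mul_apply, Fin.sum_univ_two] <;>
    field_simp <;> ring_nf <;> simp only [hi] <;> ring

theorem torusBlock_det {K : Type*} [Field K] [CharZero K] {i : K} (hi : i ^ 2 = -1) (x : Kˣ) :
    (torusBlock i x).det = 1 := by
  have hx : (x : K) ≠ 0 := x.ne_zero
  simp [torusBlock, Matrix.det_fin_two]
  field_simp
  ring_nf
  simp only [hi]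
  ring

theorem torusMatrix_mem {K : Type*} [Field K] [CharZero K] {m : ℕ} {i : K} (hi : i ^ 2 = -1)
    (x : Fin m → Kˣ) : torusMatrix i x ∈ SO m K := by
  rw [Matrix.mem_specialOrthogonalGroup_iff, Matrix.mem_orthogonalGroup_iff]
  constructor
  · simp only [torusMatrix, Matrix.reindex_apply, Matrix.transpose_submatrix,
      Matrix.submatrix_mul_equiv, Matrix.blockDiagonal_transpose, ← Matrix.blockDiagonal_mul,
      torusBlock_mul_transpose hi]
    rw [show (fun _ : Fin m => (1 : Matrix (Fin 2) (Fin 2) K)) = 1 from rfl,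
      Matrix.blockDiagonal_one, Matrix.submatrix_one_equiv]
  · rw [torusMatrix, Matrix.det_reindex_self, Matrix.det_blockDiagonal]
    simp [torusBlock_det hi]

/-- The element of the standard maximal torus of `SO m K` with coordinates `x`. -/
def torusElement {K : Type*} [Field K] [CharZero K] {m : ℕ} (i : K) (hi : i ^ 2 = -1)
    (x : Fin m → Kˣ) : SO m K :=
  ⟨torusMatrix i x, torusMatrix_mem hi x⟩

section Representations

variable {K : Type*} [Field K] {m : ℕ} {V : Type*} [AddCommGroup V] [Module K V]

/-- A representation of the algebraic group `SO m K` is rational if its matrix coefficients are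
regular functions, i.e. polynomials in the matrix entries. -/
def IsRational (ρ : Representation K (SO m K) V) : Prop :=
  ∀ (f : Module.Dual K V) (v : V), ∃ p : MvPolynomial (Fin (2 * m) × Fin (2 * m)) K,
    ∀ g : SO m K, f (ρ g v) =
      MvPolynomial.eval (fun kl => (g : Matrix (Fin (2 * m)) (Fin (2 * m)) K) kl.1 kl.2) p

/-- `μ = ∑ j, μ_j L_j` is a weight of `ρ`: some nonzero vector is multiplied by `∏ j, x_j ^ μ_j`
under the torus element with coordinates `x`, for all `x`. -/
def IsWeight [CharZero K] (i : K) (hi : i ^ 2 = -1) (ρ : Representation K (SO m K) V)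
    (μ : Fin m → ℤ) : Prop :=
  ∃ v : V, v ≠ 0 ∧ ∀ x : Fin m → Kˣ,
    ρ (torusElement i hi x) v = ((∏ j : Fin m, x j ^ μ j : Kˣ) : K) • v

/-- The standard positive roots `L_j - L_k`, `L_j + L_k` (`j < k`) of `SO (2 m)`. -/
def positiveRoots (m : ℕ) : Set (Fin m → ℤ) :=
  {α | ∃ j k : Fin m, j < k ∧ (α = Pi.single j 1 - Pi.single k 1 ∨
    α = Pi.single j 1 + Pi.single k 1)}

/-- `μ` is the highest weight of `ρ`: it is a weight, and every weight is obtained from it by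
subtracting a sum of positive roots. -/
def IsHighestWeight [CharZero K] (i : K) (hi : i ^ 2 = -1) (ρ : Representation K (SO m K) V)
    (μ : Fin m → ℤ) : Prop :=
  IsWeight i hi ρ μ ∧
    ∀ ν : Fin m → ℤ, IsWeight i hi ρ ν → μ - ν ∈ AddSubmonoid.closure (positiveRoots m)

/-- The highest weight `(L_1 + ⋯ + L_{m-1} + ε L_m) / 2` of the half-spin representation with
sign `ε = ±1`. -/
def halfSpinWeight (m : ℕ) (ε : ℤˣ) : Fin m → ℚ :=
  fun j => if (j : ℕ) + 1 = m then ((ε : ℤ) : ℚ) / 2 else 1 / 2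

/-- `ρ` is a representation `D_ε` of `SO m K`: finite dimensional, rational, irreducible, with
highest weight twice that of the half-spin representation with sign `ε`. -/
structure IsD [CharZero K] (i : K) (hi : i ^ 2 = -1) (ε : ℤˣ)
    (ρ : Representation K (SO m K) V) : Prop where
  finite : FiniteDimensional K V
  rational : IsRational ρ
  irreducible : ρ.IsIrreducible
  highest : ∃ μ : Fin m → ℤ, (∀ j, (μ j : ℚ) = 2 * halfSpinWeight m ε j) ∧
    IsHighestWeight i hi ρ μ

end Representations

end SOEven

namespace SOEven

set_option linter.unusedSectionVars false

/-! A permutation of the `2 m` indices factors uniquely as a perfect matching, swaps within the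
pairs and a permutation of the pairs. For skew `B` the signed product of entries depends only on the
matching: moving pairs around is even, and the sign of a swap is cancelled by skewness. Hence
`sum_perm_skew` and the diagonal values of `Q`. A symmetric multilinear form `L` is recovered from
its diagonal, because the coefficient of `α_1 ⋯ α_m` in `L (∑ α_k A_k, …)` is `m!` times its value
at `A`; this gives both uniqueness and the polarization formula.

For the characters, let the group act on tensors of degree `m` over `K ^ (2 m)`, and let the Hodge
star be extended by zero to the non-alternating tensors. The star commutes with the special
orthogonal group, and its cube is `(-1) ^ m` times itself, so on `m`-vectors its eigenvalues are
`±(-i) ^ m`. The trace of `X ^ ⊗m` times the star is a signed sum over permutations, equal to `(-1)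
^ m * Pf (X - Xᵀ)` (`trace_tensorMatrix_mul_starMatrix`). The difference of the two eigenprojections
is a multiple of the star, so the Pfaffian is `i ^ m` times the difference of the characters of the
two eigenspaces (`trace_halfRep_sub`).

These eigenspaces are models of `D_+` and `D_-`. They are irreducible already under signed
permutation matrices (`halfSpace_le_of_stable`), and the star of a wedge of isotropic torus
eigenvectors, one from each hyperbolic plane, is a highest weight vector.

An arbitrary `D_±` has the same character as the model, without Lie algebras or a classification.
For a highest weight vector `v` and a linear form `ψ` of the same weight invariant under the
negative root groups, `ψ (ρ g v)` is prescribed on the products of a negative unipotent, a torus and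
a positive unipotent element. Those products are Zariski dense (`zariskiClosed_eq_univ`, proved by
moving vectors with Siegel transformations), so the matrix coefficient depends only on the weight.
An irreducible representation is recovered from one nonzero matrix coefficient
(`trace_eq_of_matrixCoeff_eq`). -/

theorem sum_perm_eq_sum_fun {ι M : Type*} [Fintype ι] [DecidableEq ι] [AddCommMonoid M]
    (F : (ι → ι) → M) (hF : ∀ f, ¬ Function.Injective f → F f = 0) :
    ∑ π : Equiv.Perm ι, F π = ∑ f : ι → ι, F f := by
  refine Finset.sum_of_injOn (fun π : Equiv.Perm ι => (π : ι → ι)) ?_ ?_ ?_ ?_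
  · intro a _ b _ h
    exact DFunLike.coe_injective h
  · intro a _
    simp
  · intro f _ hf
    refine hF f fun hinj => hf ?_
    exact ⟨Equiv.ofBijective f (Finite.injective_iff_bijective.mp hinj), by simp, rfl⟩
  · intro a _
    rfl

/-! ### Pairs of indices, perfect matchings and the Pfaffian as a sum over permutations. -/

theorem prod_pairIdx {M : Type*} [CommMonoid M] {m : ℕ} (F : Fin (2 * m) → M) :
    ∏ p, F p = ∏ j : Fin m, F (pairIdx (j, 0)) * F (pairIdx (j, 1)) := by
  rw [← (pairIdx (m := m)).prod_comp, Fintype.prod_prod_type]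
  simp [Fin.prod_univ_two]

theorem sum_pairIdx {M : Type*} [AddCommMonoid M] {m : ℕ} (F : Fin (2 * m) → M) :
    ∑ p, F p = ∑ j : Fin m, (F (pairIdx (j, 0)) + F (pairIdx (j, 1))) := by
  rw [← (pairIdx (m := m)).sum_comp, Fintype.sum_prod_type]
  simp [Fin.sum_univ_two]

/-- The permutation of `Fin (2 * m)` which permutes the pairs by `π`. -/
def pairPerm {m : ℕ} (π : Equiv.Perm (Fin m)) : Equiv.Perm (Fin (2 * m)) :=
  pairIdx.permCongr (Equiv.prodCongrLeft fun _ => π)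

/-- The permutation of `Fin (2 * m)` which permutes the `j`-th pair by `η j`. -/
def withinPerm {m : ℕ} (η : Fin m → Equiv.Perm (Fin 2)) : Equiv.Perm (Fin (2 * m)) :=
  pairIdx.permCongr (Equiv.prodCongrRight η)

@[simp] theorem pairPerm_apply {m : ℕ} (π : Equiv.Perm (Fin m)) (j : Fin m) (a : Fin 2) :
    pairPerm π (pairIdx (j, a)) = pairIdx (π j, a) := by
  simp [pairPerm, Equiv.permCongr_apply]

@[simp] theorem withinPerm_apply {m : ℕ} (η : Fin m → Equiv.Perm (Fin 2)) (j : Fin m) (a : Fin 2) :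
    withinPerm η (pairIdx (j, a)) = pairIdx (j, η j a) := by
  simp [withinPerm, Equiv.permCongr_apply]

@[simp] theorem sign_pairPerm {m : ℕ} (π : Equiv.Perm (Fin m)) :
    Equiv.Perm.sign (pairPerm π) = 1 := by
  rw [pairPerm, Equiv.Perm.sign_permCongr, Equiv.Perm.sign_prodCongrLeft]
  simp

@[simp] theorem sign_withinPerm {m : ℕ} (η : Fin m → Equiv.Perm (Fin 2)) :
    Equiv.Perm.sign (withinPerm η) = ∏ j, Equiv.Perm.sign (η j) := by
  rw [withinPerm, Equiv.Perm.sign_permCongr, Equiv.Perm.sign_prodCongrRight]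

theorem pairIdx_ext {m : ℕ} {β : Sort*} {f g : Fin (2 * m) → β}
    (h : ∀ j a, f (pairIdx (j, a)) = g (pairIdx (j, a))) : f = g := by
  funext p
  obtain ⟨⟨j, a⟩, rfl⟩ := pairIdx.surjective p
  exact h j a

theorem perm_fin_two (η : Equiv.Perm (Fin 2)) : η = 1 ∨ η = Equiv.swap 0 1 := by
  revert η; decide

theorem skew_apply_perm {R : Type*} [CommRing R] {m : ℕ}
    {B : Matrix (Fin (2 * m)) (Fin (2 * m)) R} (hB : ∀ k l, B k l = -B l k)
    (f : Fin 2 → Fin (2 * m)) (η : Equiv.Perm (Fin 2)) :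
    B (f (η 0)) (f (η 1)) = ((Equiv.Perm.sign η : ℤ) : R) * B (f 0) (f 1) := by
  rcases perm_fin_two η with rfl | rfl
  · simp
  · simp
    rw [hB]

theorem min_pair {α : Type*} [LinearOrder α] (f : Fin 2 → α) (hf : f 0 < f 1)
    (η : Equiv.Perm (Fin 2)) : min (f (η 0)) (f (η 1)) = f 0 := by
  rcases perm_fin_two η with rfl | rfl
  · simpa using hf.le
  · simpa using hf.le

theorem max_pair {α : Type*} [LinearOrder α] (f : Fin 2 → α) (hf : f 0 < f 1)
    (η : Equiv.Perm (Fin 2)) : max (f (η 0)) (f (η 1)) = f 1 := by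
  rcases perm_fin_two η with rfl | rfl
  · simpa using hf.le
  · simpa using hf.le

/-- The minimum and maximum of each pair do not see the swaps `η`, so they determine the matching up
to the order of the pairs; the increasing order of the minima then fixes `π`. -/
theorem matching_decomposition_unique {m : ℕ} {μ μ' : Equiv.Perm (Fin (2 * m))}
    (hμ : μ ∈ matchings m) (hμ' : μ' ∈ matchings m) {π π' : Equiv.Perm (Fin m)}
    {η η' : Fin m → Equiv.Perm (Fin 2)}
    (h : μ * withinPerm η * pairPerm π = μ' * withinPerm η' * pairPerm π') :
    μ = μ' ∧ π = π' ∧ η = η' := by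
  simp only [matchings, Finset.mem_filter, Finset.mem_univ, true_and] at hμ hμ'
  set f : Fin m → Fin (2 * m) := fun j => μ (pairIdx (π j, 0)) with hf
  have hval : ∀ j a, μ (pairIdx (π j, η (π j) a)) = μ' (pairIdx (π' j, η' (π' j) a)) := by
    intro j a
    simpa using congrArg (fun e => e (pairIdx (j, a))) h
  have hmin : ∀ j, μ (pairIdx (π j, 0)) = μ' (pairIdx (π' j, 0)) := by
    intro j
    rw [← min_pair (fun a => μ (pairIdx (π j, a))) (hμ.1 _) (η (π j)),
      ← min_pair (fun a => μ' (pairIdx (π' j, a))) (hμ'.1 _) (η' (π' j))]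
    simp only [hval]
  have hmax : ∀ j, μ (pairIdx (π j, 1)) = μ' (pairIdx (π' j, 1)) := by
    intro j
    rw [← max_pair (fun a => μ (pairIdx (π j, a))) (hμ.1 _) (η (π j)),
      ← max_pair (fun a => μ' (pairIdx (π' j, a))) (hμ'.1 _) (η' (π' j))]
    simp only [hval]
  -- Both sides arrange the same family of minima in increasing order, and a tuple has only one
  -- monotone rearrangement.
  have h1 : f ∘ (π⁻¹ : Equiv.Perm (Fin m)) = f ∘ (π'⁻¹ : Equiv.Perm (Fin m)) := by
    refine Tuple.unique_monotone ?_ ?_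
    · refine StrictMono.monotone fun j k hjk => ?_
      simpa [hf] using hμ.2 j k hjk
    · refine StrictMono.monotone fun j k hjk => ?_
      simpa [hf, hmin] using hμ'.2 j k hjk
  have hfinj : Function.Injective f := by
    intro j k hjk
    have := pairIdx.injective (μ.injective hjk)
    simpa using this
  have hπ : π = π' := by
    rw [← inv_inj]
    ext j
    exact congrArg Fin.val (hfinj (congrFun h1 j))
  subst hπ
  have hμμ : μ = μ' := by
    apply DFunLike.coe_injective
    refine pairIdx_ext fun j a => ?_
    fin_cases a
    · simpa using hmin (π⁻¹ j)
    · simpa using hmax (π⁻¹ j)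
  subst hμμ
  refine ⟨rfl, rfl, ?_⟩
  funext j
  ext a
  have := pairIdx.injective (μ.injective (hval (π⁻¹ j) a))
  rw [show π (π⁻¹ j) = j by simp] at this
  exact congrArg (fun x => (x.2 : ℕ)) this

/-- Sort the pairs by their minima, then sort within each pair. -/
theorem exists_matching_decomposition {m : ℕ} (σ : Equiv.Perm (Fin (2 * m))) :
    ∃ μ ∈ matchings m, ∃ (π : Equiv.Perm (Fin m)) (η : Fin m → Equiv.Perm (Fin 2)),
      μ * withinPerm η * pairPerm π = σ := by
  classical
  set f : Fin m → Fin (2 * m) := fun j => min (σ (pairIdx (j, 0))) (σ (pairIdx (j, 1))) with hf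
  have hne : ∀ j k a b, σ (pairIdx (j, a)) = σ (pairIdx (k, b)) → j = k ∧ a = b := by
    intro j k a b h
    simpa using pairIdx.injective (σ.injective h)
  have hfinj : Function.Injective f := by
    intro j k hjk
    simp only [hf] at hjk
    rcases min_choice (σ (pairIdx (j, 0))) (σ (pairIdx (j, 1))) with h1 | h1 <;>
    rcases min_choice (σ (pairIdx (k, 0))) (σ (pairIdx (k, 1))) with h2 | h2 <;>
    · rw [h1, h2] at hjk
      exact (hne _ _ _ _ hjk).1
  set s := Tuple.sort f
  have hs : StrictMono (f ∘ s) :=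
    (Tuple.monotone_sort f).strictMono_of_injective (hfinj.comp s.injective)
  set η : Fin m → Equiv.Perm (Fin 2) := fun k =>
    if σ (pairIdx (s k, 0)) < σ (pairIdx (s k, 1)) then 1 else Equiv.swap 0 1 with hη
  have h0 : ∀ k, σ (pairIdx (s k, η k 0)) = f (s k) := by
    intro k
    by_cases h : σ (pairIdx (s k, 0)) < σ (pairIdx (s k, 1))
    · simp [hη, h, hf, h.le]
    · simp [hη, h, hf, not_lt.mp h]
  have h1 : ∀ k, σ (pairIdx (s k, η k 0)) < σ (pairIdx (s k, η k 1)) := by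
    intro k
    by_cases h : σ (pairIdx (s k, 0)) < σ (pairIdx (s k, 1))
    · simp [hη, h]
    · simp only [hη, h, if_false, Equiv.swap_apply_left, Equiv.swap_apply_right]
      refine lt_of_le_of_ne (not_lt.mp h) fun h' => ?_
      exact absurd (hne _ _ _ _ h').2 (by decide)
  -- Each `η k` is an involution, so the same `η` sorts the pairs and undoes the sorting.
  refine ⟨σ * pairPerm s * withinPerm η, ?_, s⁻¹, η, ?_⟩
  · simp only [matchings, Finset.mem_filter, Finset.mem_univ, true_and, Equiv.Perm.mul_apply,
      withinPerm_apply, pairPerm_apply]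
    refine ⟨h1, fun j k hjk => ?_⟩
    rw [h0, h0]
    exact hs hjk
  · apply DFunLike.coe_injective
    refine pairIdx_ext fun j a => ?_
    have hinv : ∀ k b, η k (η k b) = b := by
      intro k b
      simp only [hη]
      split_ifs <;> simp
    simp [hinv]

/-- The sum over all permutations counts every perfect matching `2 ^ m * m!` times. -/
theorem sum_perm_skew {R : Type*} [CommRing R] {m : ℕ}
    {B : Matrix (Fin (2 * m)) (Fin (2 * m)) R} (hB : ∀ k l, B k l = -B l k) :
    ∑ σ : Equiv.Perm (Fin (2 * m)), ((Equiv.Perm.sign σ : ℤ) : R) *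
      ∏ j : Fin m, B (σ (pairIdx (j, 0))) (σ (pairIdx (j, 1))) = 2 ^ m * (m ! : R) * Pf B := by
  classical
  set T : Equiv.Perm (Fin (2 * m)) → R := fun σ => ((Equiv.Perm.sign σ : ℤ) : R) *
      ∏ j : Fin m, B (σ (pairIdx (j, 0))) (σ (pairIdx (j, 1))) with hT
  have hinv : ∀ (μ : Equiv.Perm (Fin (2 * m))) (π : Equiv.Perm (Fin m))
      (η : Fin m → Equiv.Perm (Fin 2)), T (μ * withinPerm η * pairPerm π) = T μ := by
    intro μ π η
    simp only [hT, Equiv.Perm.sign_mul, sign_pairPerm, sign_withinPerm, Equiv.Perm.mul_apply,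
      pairPerm_apply, withinPerm_apply, mul_one]
    rw [Equiv.prod_comp π fun j => B (μ (pairIdx (j, η j 0))) (μ (pairIdx (j, η j 1)))]
    simp only [fun j => skew_apply_perm hB (fun a => μ (pairIdx (j, a))) (η j)]
    rw [Finset.prod_mul_distrib]
    push_cast
    -- The signs of the `η j` occur twice: in the sign of the permutation and through skew-symmetry.
    have : (∏ j, ((Equiv.Perm.sign (η j) : ℤ) : R)) * ∏ j, ((Equiv.Perm.sign (η j) : ℤ) : R)
        = 1 := by
      rw [← Finset.prod_mul_distrib]
      refine Finset.prod_eq_one fun j _ => ?_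
      exact_mod_cast congrArg (fun u : ℤˣ => ((u : ℤ) : R)) (Int.units_mul_self _)
    linear_combination (((Equiv.Perm.sign μ : ℤ) : R) *
      ∏ j : Fin m, B (μ (pairIdx (j, 0))) (μ (pairIdx (j, 1)))) * this
  have hsum : ∑ x ∈ matchings m ×ˢ (Finset.univ :
      Finset (Equiv.Perm (Fin m) × (Fin m → Equiv.Perm (Fin 2)))), T x.1 = ∑ σ, T σ := by
    refine Finset.sum_bij (fun x _ => x.1 * withinPerm x.2.2 * pairPerm x.2.1) ?_ ?_ ?_ ?_
    · simp
    · rintro ⟨μ, π, η⟩ h ⟨μ', π', η'⟩ h' heq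
      simp only [Finset.mem_product, Finset.mem_univ, and_true] at h h'
      obtain ⟨rfl, rfl, rfl⟩ := matching_decomposition_unique h h' heq
      rfl
    · intro σ _
      obtain ⟨μ, hμ, π, η, h⟩ := exists_matching_decomposition σ
      exact ⟨(μ, π, η), by simpa using hμ, h⟩
    · rintro ⟨μ, π, η⟩ _
      exact (hinv μ π η).symm
  rw [← hsum, Finset.sum_product]
  simp only [Finset.sum_const, Finset.card_univ, Fintype.card_prod, Fintype.card_perm,
    Fintype.card_fun, Fintype.card_fin, nsmul_eq_mul, Pf, ← Finset.mul_sum]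
  push_cast
  simp [Nat.factorial, hT]
  ring

theorem Q_diagonal {R : Type*} [CommRing R] {m : ℕ} (X : Matrix (Fin (2 * m)) (Fin (2 * m)) R) :
    Q (fun _ : Fin m => X) = 2 ^ m * (m ! : R) * Pf (X - X.transpose) := by
  rw [← sum_perm_skew (B := X - X.transpose) (by intro k l; simp)]
  rfl

theorem Q_symmetric {R : Type*} [CommRing R] {m : ℕ} (π : Equiv.Perm (Fin m))
    (A : Fin m → Matrix (Fin (2 * m)) (Fin (2 * m)) R) : Q (fun j => A (π j)) = Q A := by
  rw [Q, Q, ← Equiv.sum_comp (Equiv.mulRight (pairPerm π))]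
  refine Finset.sum_congr rfl fun σ _ => ?_
  simp only [Equiv.coe_mulRight, Equiv.Perm.sign_mul, sign_pairPerm, mul_one,
    Equiv.Perm.mul_apply, pairPerm_apply]
  rw [Equiv.prod_comp π fun j => A j (σ (pairIdx (j, 0))) (σ (pairIdx (j, 1)))
    - A j (σ (pairIdx (j, 1))) (σ (pairIdx (j, 0)))]

/-- Each factor is a signed sum over the two orders of its pair. Each of the `2 ^ m` choices of
orders is absorbed by right translation of `σ`, whose sign compensates. -/
theorem sum_perm_sub_transpose {R : Type*} [CommRing R] {m : ℕ}
    (X : Matrix (Fin (2 * m)) (Fin (2 * m)) R) :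
    ∑ σ : Equiv.Perm (Fin (2 * m)), ((Equiv.Perm.sign σ : ℤ) : R) *
      ∏ j : Fin m, (X - X.transpose) (σ (pairIdx (j, 0))) (σ (pairIdx (j, 1))) =
    2 ^ m * ∑ σ : Equiv.Perm (Fin (2 * m)), ((Equiv.Perm.sign σ : ℤ) : R) *
      ∏ j : Fin m, X (σ (pairIdx (j, 0))) (σ (pairIdx (j, 1))) := by
  classical
  have h1 : ∀ f : Fin 2 → Fin (2 * m), (X - X.transpose) (f 0) (f 1) =
      ∑ η : Equiv.Perm (Fin 2), ((Equiv.Perm.sign η : ℤ) : R) * X (f (η 0)) (f (η 1)) := by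
    intro f
    have : (Finset.univ : Finset (Equiv.Perm (Fin 2))) = {1, Equiv.swap 0 1} := by decide
    rw [this, Finset.sum_pair (by decide)]
    simp [sub_eq_add_neg]
  simp only [fun (σ : Equiv.Perm (Fin (2 * m))) (j : Fin m) =>
    h1 (fun a => σ (pairIdx (j, a))), Finset.prod_univ_sum, Finset.mul_sum]
  rw [Finset.sum_comm]
  have h2 : ∀ η ∈ Fintype.piFinset (fun _ : Fin m => (Finset.univ : Finset (Equiv.Perm (Fin 2)))),
      ∑ σ : Equiv.Perm (Fin (2 * m)), ((Equiv.Perm.sign σ : ℤ) : R) *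
        ∏ j : Fin m, (((Equiv.Perm.sign (η j) : ℤ) : R) *
          X (σ (pairIdx (j, η j 0))) (σ (pairIdx (j, η j 1)))) =
      ∑ σ : Equiv.Perm (Fin (2 * m)), ((Equiv.Perm.sign σ : ℤ) : R) *
        ∏ j : Fin m, X (σ (pairIdx (j, 0))) (σ (pairIdx (j, 1))) := by
    intro η _
    rw [← Equiv.sum_comp (Equiv.mulRight (withinPerm η))
      (fun σ : Equiv.Perm (Fin (2 * m)) => ((Equiv.Perm.sign σ : ℤ) : R) *
        ∏ j : Fin m, X (σ (pairIdx (j, 0))) (σ (pairIdx (j, 1))))]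
    refine Finset.sum_congr rfl fun σ _ => ?_
    simp only [Equiv.coe_mulRight, Equiv.Perm.sign_mul, sign_withinPerm, Equiv.Perm.mul_apply,
      withinPerm_apply, Finset.prod_mul_distrib]
    push_cast
    ring
  rw [Finset.sum_congr rfl h2, Finset.sum_const, ← Finset.mul_sum]
  simp [Fintype.card_perm]

/-- The Pfaffian of `X - Xᵀ` as a signed sum over all permutations. -/
theorem factorial_mul_Pf {K : Type*} [Field K] [CharZero K] {m : ℕ}
    (X : Matrix (Fin (2 * m)) (Fin (2 * m)) K) :
    (m ! : K) * Pf (X - X.transpose) =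
      ∑ σ : Equiv.Perm (Fin (2 * m)), ((Equiv.Perm.sign σ : ℤ) : K) *
        ∏ j : Fin m, X (σ (pairIdx (j, 0))) (σ (pairIdx (j, 1))) := by
  have h := sum_perm_sub_transpose X
  rw [sum_perm_skew (B := X - X.transpose) (by intro k l; simp), mul_assoc] at h
  exact mul_left_cancel₀ (pow_ne_zero m two_ne_zero) h

/-! ### Polarization. -/

/-- `Q` as a multilinear map. -/
def multilinearQ (R : Type*) [CommRing R] (m : ℕ) :
    MultilinearMap R (fun _ : Fin m => Matrix (Fin (2 * m)) (Fin (2 * m)) R) R :=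
  ∑ σ : Equiv.Perm (Fin (2 * m)), ((Equiv.Perm.sign σ : ℤ) : R) •
    (MultilinearMap.mkPiAlgebra R (Fin m) R).compLinearMap fun j =>
      Matrix.entryLinearMap R R (σ (pairIdx (j, 0))) (σ (pairIdx (j, 1)))
        - Matrix.entryLinearMap R R (σ (pairIdx (j, 1))) (σ (pairIdx (j, 0)))

@[simp] theorem multilinearQ_apply {R : Type*} [CommRing R] {m : ℕ}
    (A : Fin m → Matrix (Fin (2 * m)) (Fin (2 * m)) R) : multilinearQ R m A = Q A := by
  simp [multilinearQ, Q]

theorem isPfPolarization_Q {K : Type*} [Field K] {m : ℕ} :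
    IsPfPolarization (Q : (Fin m → Matrix (Fin (2 * m)) (Fin (2 * m)) K) → K) where
  multilinear := ⟨multilinearQ K m, multilinearQ_apply⟩
  symmetric := Q_symmetric
  diagonal := Q_diagonal

/-- The monomial of `f` is `α_1 ⋯ α_m` exactly when `f` is bijective, so `m!` terms survive. -/
theorem coeff_polarization {R : Type*} [CommRing R] {m : ℕ} (F : (Fin m → Fin m) → R) (c : R)
    (hF : ∀ π : Equiv.Perm (Fin m), F π = c) :
    MvPolynomial.coeff (Finsupp.equivFunOnFinite.symm fun _ : Fin m => 1)
      (∑ f : Fin m → Fin m, (∏ j, MvPolynomial.X (f j)) * MvPolynomial.C (F f)) = (m ! : R) * c := by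
  classical
  have key : ∀ f : Fin m → Fin m,
      MvPolynomial.coeff (Finsupp.equivFunOnFinite.symm fun _ : Fin m => 1)
        ((∏ j, MvPolynomial.X (f j)) * MvPolynomial.C (F f)) =
      if Function.Injective f then F f else 0 := by
    intro f
    have hprod : (∏ j, MvPolynomial.X (f j) : MvPolynomial (Fin m) R) =
        MvPolynomial.monomial (∑ j, Finsupp.single (f j) 1) 1 := by
      rw [MvPolynomial.monomial_sum_one]
      rfl
    rw [hprod, mul_comm, MvPolynomial.C_mul_monomial, MvPolynomial.coeff_monomial, mul_one]
    congr 1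
    rw [eq_iff_iff, Finsupp.ext_iff]
    have hcount : ∀ k, (∑ j, Finsupp.single (f j) (1 : ℕ)) k =
        (Finset.univ.filter fun j => f j = k).card := by
      intro k
      rw [Finsupp.finsetSum_apply]
      simp [Finsupp.single_apply]
    simp only [hcount, Finsupp.coe_equivFunOnFinite_symm]
    constructor
    · intro h j k hjk
      exact Finset.card_le_one.mp (h (f k)).le j (by simp [hjk]) k (by simp)
    · intro h k
      obtain ⟨j, hj⟩ := (Finite.injective_iff_surjective.mp h) k
      rw [Finset.card_eq_one]
      refine ⟨j, ?_⟩
      ext l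
      simp only [Finset.mem_filter, Finset.mem_univ, true_and, Finset.mem_singleton]
      exact ⟨fun hl => h (hl.trans hj.symm), fun hl => hl ▸ hj⟩
  rw [MvPolynomial.coeff_sum, Finset.sum_congr rfl fun f _ => key f,
    ← sum_perm_eq_sum_fun _ fun f hf => if_neg hf]
  simp [hF, Equiv.injective, Fintype.card_perm]

/-- Both forms agree at `∑ α_k A_k` for all `α`. Since `K` is infinite, the expansions agree as
polynomials, and their coefficients at `α_1 ⋯ α_m` are `m! * M A` and `m! * N A`. -/
theorem symmetric_multilinear_ext {K E : Type*} [Field K] [CharZero K] [AddCommGroup E] [Module K E]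
    {m : ℕ} (M N : MultilinearMap K (fun _ : Fin m => E) K)
    (hM : ∀ (π : Equiv.Perm (Fin m)) A, M (fun j => A (π j)) = M A)
    (hN : ∀ (π : Equiv.Perm (Fin m)) A, N (fun j => A (π j)) = N A)
    (h : ∀ X, M (fun _ => X) = N (fun _ => X)) (A : Fin m → E) : M A = N A := by
  have hpoly : (∑ f : Fin m → Fin m, (∏ j, MvPolynomial.X (f j)) *
        MvPolynomial.C (M fun j => A (f j))) =
      (∑ f : Fin m → Fin m, (∏ j, MvPolynomial.X (f j)) *
        MvPolynomial.C (N fun j => A (f j)) : MvPolynomial (Fin m) K) := by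
    refine MvPolynomial.funext fun α => ?_
    have hexp : ∀ L : MultilinearMap K (fun _ : Fin m => E) K,
        L (fun _ => ∑ k, α k • A k) = ∑ f : Fin m → Fin m, (∏ j, α (f j)) *
          L (fun j => A (f j)) := by
      intro L
      rw [MultilinearMap.map_sum]
      refine Finset.sum_congr rfl fun f _ => ?_
      rw [L.map_smul_univ (fun j => α (f j)) fun j => A (f j), smul_eq_mul]
    simp only [map_sum, map_mul, map_prod, MvPolynomial.eval_X, MvPolynomial.eval_C, ← hexp, h]
  have := congrArg (MvPolynomial.coeff (Finsupp.equivFunOnFinite.symm fun _ : Fin m => 1)) hpoly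
  rw [coeff_polarization _ (M A) fun π => hM π A, coeff_polarization _ (N A) fun π => hN π A] at this
  exact mul_left_cancel₀ (Nat.cast_ne_zero.mpr m.factorial_ne_zero) this

theorem isPfPolarization_unique {K : Type*} [Field K] [CharZero K] {m : ℕ}
    {F : (Fin m → Matrix (Fin (2 * m)) (Fin (2 * m)) K) → K} (hF : IsPfPolarization F) :
    F = Q := by
  obtain ⟨M, hM⟩ := hF.multilinear
  funext A
  rw [← hM, ← multilinearQ_apply]
  refine symmetric_multilinear_ext M _ (fun π A => ?_) (fun π A => ?_) (fun X => ?_) A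
  · rw [hM, hM, hF.symmetric]
  · rw [multilinearQ_apply, multilinearQ_apply, Q_symmetric]
  · rw [hM, multilinearQ_apply, hF.diagonal, Q_diagonal]

theorem map_Q {R S : Type*} [CommRing R] [CommRing S] (f : R →+* S) {m : ℕ}
    (A : Fin m → Matrix (Fin (2 * m)) (Fin (2 * m)) R) :
    Q (fun j => (A j).map f) = f (Q A) := by
  simp [Q, map_sum, map_prod]

/-- `Q_diagonal` holds over the polynomial ring, where it turns the Pfaffian of the generic
combination into a diagonal value of `Q`; multilinear expansion does the rest. -/
theorem factorial_mul_Q_eq_coeff {K : Type*} [Field K] {m : ℕ}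
    (A : Fin m → Matrix (Fin (2 * m)) (Fin (2 * m)) K) :
    (m.factorial : K) * Q A =
      MvPolynomial.coeff (Finsupp.equivFunOnFinite.symm fun _ : Fin m => 1)
        (2 ^ m * (m.factorial : MvPolynomial (Fin m) K) *
          Pf (genericSum A - (genericSum A).transpose)) := by
  rw [← Q_diagonal, ← multilinearQ_apply (R := MvPolynomial (Fin m) K), genericSum,
    MultilinearMap.map_sum, ← coeff_polarization (fun f => Q fun j => A (f j)) (Q A) fun π => Q_symmetric π A]
  congr 1
  refine Finset.sum_congr rfl fun f _ => ?_
  rw [MultilinearMap.map_smul_univ _ (fun j => MvPolynomial.X (f j))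
    fun j => (A (f j)).map MvPolynomial.C, multilinearQ_apply, smul_eq_mul]
  rw [map_Q MvPolynomial.C fun j => A (f j)]

/-! ### Characters of the torus. -/

section Characters

variable {K : Type*} [Field K] {m : ℕ}

/-- The character `∑ j, ν j L_j` of the torus, with values in `K`. -/
def torusChar (K : Type*) [Field K] {m : ℕ} (ν : Fin m → ℤ) : (Fin m → Kˣ) →* K where
  toFun x := ((∏ j, x j ^ ν j : Kˣ) : K)
  map_one' := by simp
  map_mul' x y := by simp [mul_zpow, Finset.prod_mul_distrib]

theorem torusChar_apply (ν : Fin m → ℤ) (x : Fin m → Kˣ) :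
    torusChar K ν x = ((∏ j, x j ^ ν j : Kˣ) : K) := rfl

theorem torusChar_add (ν μ : Fin m → ℤ) (x : Fin m → Kˣ) :
    torusChar K (ν + μ) x = torusChar K ν x * torusChar K μ x := by
  simp only [torusChar_apply, Pi.add_apply, zpow_add, Finset.prod_mul_distrib, Units.val_mul]

theorem torusChar_nsmul (k : ℕ) (ν : Fin m → ℤ) (x : Fin m → Kˣ) :
    torusChar K (k • ν) x = torusChar K ν x ^ k := by
  induction k with
  | zero => simp [torusChar_apply]
  | succ k ih => rw [succ_nsmul, torusChar_add, ih, pow_succ]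

theorem torusChar_zero (x : Fin m → Kˣ) : torusChar K (0 : Fin m → ℤ) x = 1 := by
  simp [torusChar_apply]

theorem torusChar_single (j : Fin m) (a : ℤ) (x : Fin m → Kˣ) :
    torusChar K (Pi.single j a) x = (x j : K) ^ a := by
  rw [torusChar_apply, Finset.prod_eq_single j]
  · simp
  · intro k _ hk
    simp [hk]
  · simp

/-- The torus point with `j`-th coordinate `2` and all others `1` gives `2 ^ ν j`, and in
characteristic zero the exponent can be read off in `ℚ`. -/
theorem torusChar_injective [CharZero K] :
    Function.Injective (torusChar K : (Fin m → ℤ) → ((Fin m → Kˣ) →* K)) := by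
  intro ν μ h
  funext j
  have h2 : (2 : K) ≠ 0 := two_ne_zero
  have key : ∀ ν : Fin m → ℤ,
      torusChar K ν (Function.update 1 j (Units.mk0 2 h2)) = (2 : K) ^ ν j := by
    intro ν
    rw [torusChar_apply, Finset.prod_eq_single j]
    · simp
    · intro k _ hk
      simp [hk]
    · simp
  have h3 : (2 : K) ^ ν j = (2 : K) ^ μ j := by rw [← key, ← key, h]
  have h4 : ((2 : ℚ) ^ ν j : ℚ) = (2 : ℚ) ^ μ j := by
    have : (((2 : ℚ) ^ ν j : ℚ) : K) = (((2 : ℚ) ^ μ j : ℚ) : K) := by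
      push_cast
      exact h3
    exact_mod_cast this
  exact zpow_right_injective₀ (by norm_num) (by norm_num) h4

/-- Distinct characters of the torus are linearly independent, with coefficients in a module. -/
theorem torusChar_independent [CharZero K] {V : Type*} [AddCommGroup V] [Module K V]
    (A : Finset (Fin m → ℤ)) (c : (Fin m → ℤ) → V)
    (h : ∀ x : Fin m → Kˣ, ∑ ν ∈ A, torusChar K ν x • c ν = 0) : ∀ ν ∈ A, c ν = 0 := by
  have hli : LinearIndependent K (fun ν : Fin m → ℤ => (torusChar K ν : (Fin m → Kˣ) → K)) :=
    (linearIndependent_monoidHom (Fin m → Kˣ) K).comp _ torusChar_injective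
  intro ν hν
  rw [← Module.forall_dual_apply_eq_zero_iff K]
  intro ψ
  refine linearIndependent_iff'.mp hli A (fun ν => ψ (c ν)) ?_ ν hν
  funext x
  have := congrArg ψ (h x)
  simpa [mul_comm] using this

end Characters

/-! ### Weight spaces of rational representations. -/

section Weights

variable {K : Type*} [Field K] [CharZero K] {m : ℕ} {V : Type*} [AddCommGroup V] [Module K V]
  {i : K} {hi : i ^ 2 = -1}

theorem torusElement_val (x : Fin m → Kˣ) :
    ((torusElement i hi x : SO m K) : Matrix (Fin (2 * m)) (Fin (2 * m)) K) = torusMatrix i x := rfl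

/-- The space of vectors of weight `ν`, together with zero. -/
def weightSpace (i : K) (hi : i ^ 2 = -1) (ρ : Representation K (SO m K) V) (ν : Fin m → ℤ) :
    Submodule K V where
  carrier := {v | ∀ x, ρ (torusElement i hi x) v = torusChar K ν x • v}
  add_mem' {v w} hv hw x := by simp [hv x, hw x]
  zero_mem' x := by simp
  smul_mem' c v hv x := by simp [hv x, smul_comm c]

theorem isWeight_iff {ρ : Representation K (SO m K) V} {ν : Fin m → ℤ} :
    IsWeight i hi ρ ν ↔ ∃ v ∈ weightSpace i hi ρ ν, v ≠ 0 := by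
  constructor
  · rintro ⟨v, h0, h⟩
    exact ⟨v, h, h0⟩
  · rintro ⟨v, h, h0⟩
    exact ⟨v, h0, h⟩

theorem eq_zero_of_not_isWeight {ρ : Representation K (SO m K) V} {ν : Fin m → ℤ} {v : V}
    (hv : v ∈ weightSpace i hi ρ ν) (h : ¬ IsWeight i hi ρ ν) : v = 0 := by
  by_contra h0
  exact h (isWeight_iff.mpr ⟨v, hv, h0⟩)

/-- Laurent polynomials are encoded as elements of the group algebra of the weight lattice,
evaluated at `x` by `AddMonoidAlgebra.lift`. Polynomials in matrix entries can then be expanded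
formally into characters. -/
theorem torusMatrix_entry_laurent (k l : Fin (2 * m)) :
    ∃ q : AddMonoidAlgebra K (Fin m → ℤ), ∀ x : Fin m → Kˣ, torusMatrix i x k l =
      AddMonoidAlgebra.lift K K (Fin m → ℤ)
        { toFun := fun ν => torusChar K ν.toAdd x
          map_one' := torusChar_zero x
          map_mul' := fun _ _ => torusChar_add _ _ x } q := by
  obtain ⟨⟨j, a⟩, rfl⟩ := pairIdx.surjective k
  obtain ⟨⟨j', b⟩, rfl⟩ := pairIdx.surjective l
  by_cases hj : j = j'
  · subst hj
    have h : ∀ c d : K, ∃ q : AddMonoidAlgebra K (Fin m → ℤ), ∀ x : Fin m → Kˣ,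
        c * (x j : K) + d * (x j : K)⁻¹ = AddMonoidAlgebra.lift K K (Fin m → ℤ)
        { toFun := fun ν => torusChar K ν.toAdd x
          map_one' := torusChar_zero x
          map_mul' := fun ν μ => torusChar_add _ _ x } q := by
      intro c d
      refine ⟨AddMonoidAlgebra.single (Pi.single j 1) c + AddMonoidAlgebra.single (Pi.single j (-1)) d,
        fun x => ?_⟩
      simp [AddMonoidAlgebra.lift_single, torusChar_single]
    have hent : ∀ x : Fin m → Kˣ, torusMatrix i x (pairIdx (j, a)) (pairIdx (j, b)) =
        torusBlock i (x j) a b := by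
      intro x
      simp [torusMatrix, Matrix.blockDiagonal_apply]
    simp only [hent]
    fin_cases a <;> fin_cases b
    · obtain ⟨q, hq⟩ := h (1 / 2) (1 / 2)
      exact ⟨q, fun x => by rw [← hq]; simp [torusBlock]; ring⟩
    · obtain ⟨q, hq⟩ := h (i / 2) (-i / 2)
      exact ⟨q, fun x => by rw [← hq]; simp [torusBlock]; ring⟩
    · obtain ⟨q, hq⟩ := h (-i / 2) (i / 2)
      exact ⟨q, fun x => by rw [← hq]; simp [torusBlock]; ring⟩
    · obtain ⟨q, hq⟩ := h (1 / 2) (1 / 2)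
      exact ⟨q, fun x => by rw [← hq]; simp [torusBlock]; ring⟩
  · refine ⟨0, fun x => ?_⟩
    simp [torusMatrix, Matrix.blockDiagonal_apply, hj]

theorem torus_expansion [FiniteDimensional K V] {ρ : Representation K (SO m K) V}
    (hρ : IsRational ρ) (v : V) : ∃ (A : Finset (Fin m → ℤ)) (c : (Fin m → ℤ) → V),
      ∀ x : Fin m → Kˣ, ρ (torusElement i hi x) v = ∑ ν ∈ A, torusChar K ν x • c ν := by
  classical
  set b := Module.finBasis K V
  choose p hp using fun a => hρ (b.coord a) v
  choose q hq using fun kl : Fin (2 * m) × Fin (2 * m) =>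
    torusMatrix_entry_laurent (K := K) (i := i) kl.1 kl.2
  set r : _ → AddMonoidAlgebra K (Fin m → ℤ) := fun a => MvPolynomial.aeval q (p a)
  have hr : ∀ a x, b.coord a (ρ (torusElement i hi x) v) =
      ∑ ν ∈ (r a).coeff.support, torusChar K ν x * (r a).coeff ν := by
    intro a x
    rw [hp, torusElement_val]
    simp only [hq]
    trans AddMonoidAlgebra.lift K K (Fin m → ℤ)
        { toFun := fun ν => torusChar K ν.toAdd x
          map_one' := torusChar_zero x
          map_mul' := fun ν μ => torusChar_add _ _ x } (r a)
    · rw [← MvPolynomial.coe_aeval_eq_eval, ← MvPolynomial.comp_aeval]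
      rfl
    · rw [AddMonoidAlgebra.lift_apply, Finsupp.sum]
      simp [mul_comm]
  refine ⟨Finset.univ.biUnion fun a => (r a).coeff.support, fun ν => ∑ a, (r a).coeff ν • b a, fun x => ?_⟩
  rw [← b.sum_repr (ρ (torusElement i hi x) v)]
  simp only [Finset.smul_sum]
  rw [Finset.sum_comm]
  refine Finset.sum_congr rfl fun a _ => ?_
  simp only [smul_smul, ← Finset.sum_smul]
  congr 1
  rw [← Module.Basis.coord_apply, hr]
  refine Finset.sum_subset (Finset.subset_biUnion_of_mem (fun a => (r a).coeff.support)
    (Finset.mem_univ a)) fun ν _ hν => ?_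
  simp [Finsupp.notMem_support_iff.mp hν]

theorem torusElement_mul (x y : Fin m → Kˣ) :
    torusElement i hi (x * y) = torusElement i hi x * torusElement i hi y := by
  apply Subtype.ext
  have hb : ∀ x y : Kˣ, torusBlock i (x * y) = torusBlock i x * torusBlock i y := by
    intro x y
    have hx : (x : K) ≠ 0 := x.ne_zero
    have hy : (y : K) ≠ 0 := y.ne_zero
    ext a b
    fin_cases a <;> fin_cases b <;> simp [torusBlock, Matrix.mul_apply, Fin.sum_univ_two] <;>
      field_simp <;> ring_nf <;> simp only [hi] <;> ring
  simp only [Submonoid.coe_mul, torusElement_val, torusMatrix, Matrix.reindex_apply,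
    Matrix.submatrix_mul_equiv, ← Matrix.blockDiagonal_mul, Pi.mul_apply, hb]

theorem torusElement_one : torusElement i hi (1 : Fin m → Kˣ) = 1 := by
  apply Subtype.ext
  have hb : torusBlock i (1 : Kˣ) = 1 := by
    ext a b
    fin_cases a <;> fin_cases b <;> simp [torusBlock]
  simp only [torusElement_val, torusMatrix, Pi.one_apply, hb]
  rw [show (fun _ : Fin m => (1 : Matrix (Fin 2) (Fin 2) K)) = 1 from rfl,
      Matrix.blockDiagonal_one]
  simp only [Matrix.reindex_apply, Matrix.submatrix_one_equiv, Submonoid.coe_one]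

/-- The coefficients of the torus expansion of `v` are weight vectors: expand `ρ (y x) v` as a
function of `x` in two ways and use the independence of characters. At the identity they add up to
`v`. -/
theorem iSup_weightSpace_eq_top [FiniteDimensional K V] {ρ : Representation K (SO m K) V}
    (hρ : IsRational ρ) : ⨆ ν, weightSpace i hi ρ ν = ⊤ := by
  classical
  rw [eq_top_iff]
  intro v _
  obtain ⟨A, c, hc⟩ := torus_expansion (i := i) (hi := hi) hρ v
  have hv : v = ∑ ν ∈ A, c ν := by
    have := hc 1
    simpa [torusElement_one] using this
  rw [hv]
  refine Submodule.sum_mem _ fun ν hν => Submodule.mem_iSup_of_mem ν ?_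
  intro y
  have := torusChar_independent (K := K) A (fun ν => ρ (torusElement i hi y) (c ν) - torusChar K ν y • c ν)
    (fun x => ?_) ν hν
  · exact sub_eq_zero.mp this
  · have h1 : ρ (torusElement i hi (y * x)) v = ∑ ν ∈ A, torusChar K ν x •
        ρ (torusElement i hi y) (c ν) := by
      rw [torusElement_mul, map_mul, Module.End.mul_apply, hc]
      simp
    rw [hc] at h1
    simp only [smul_sub, Finset.sum_sub_distrib, ← h1, map_mul, smul_smul, sub_eq_zero]
    exact Finset.sum_congr rfl fun ν _ => by rw [mul_comm]

/-- Sums of weight vectors have a torus expansion into their weights. -/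
theorem exists_expansion_of_mem_iSup {ρ : Representation K (SO m K) V} {B : Set (Fin m → ℤ)} {u : V}
    (hu : u ∈ ⨆ ν ∈ B, weightSpace i hi ρ ν) : ∃ A : Finset (Fin m → ℤ), ↑A ⊆ B ∧
      ∃ c : (Fin m → ℤ) → V, (∀ ν, c ν ∈ weightSpace i hi ρ ν) ∧ ∑ ν ∈ A, c ν = u := by
  classical
  induction hu using Submodule.iSup_induction' with
  | mem ν u hu =>
    by_cases hν : ν ∈ B
    · refine ⟨{ν}, by simpa using hν, fun μ => if μ = ν then u else 0, fun μ => ?_, by simp⟩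
      dsimp only
      split_ifs with h
      · subst h
        simpa [hν] using hu
      · exact Submodule.zero_mem _
    · refine ⟨∅, by simp, fun _ => 0, fun _ => Submodule.zero_mem _, ?_⟩
      simpa [hν, eq_comm] using hu
  | zero => exact ⟨∅, by simp, fun _ => 0, fun _ => Submodule.zero_mem _, by simp⟩
  | add u w _ _ hu hw =>
    obtain ⟨A, hA, c, hc, rfl⟩ := hu
    obtain ⟨A', hA', c', hc', rfl⟩ := hw
    refine ⟨A ∪ A', by simp [hA, hA'], fun ν => (if ν ∈ A then c ν else 0) +
      (if ν ∈ A' then c' ν else 0), fun ν => Submodule.add_mem _ ?_ ?_, ?_⟩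
    · split_ifs
      exacts [hc ν, Submodule.zero_mem _]
    · split_ifs
      exacts [hc' ν, Submodule.zero_mem _]
    · rw [Finset.sum_add_distrib, Finset.sum_ite_mem, Finset.sum_ite_mem]
      simp [Finset.union_inter_cancel_left, Finset.union_inter_cancel_right]

theorem weightSpace_disjoint {ρ : Representation K (SO m K) V} {B : Set (Fin m → ℤ)}
    {lam : Fin m → ℤ} (hB : lam ∉ B) {v : V} (hv : v ∈ weightSpace i hi ρ lam)
    (hv' : v ∈ ⨆ ν ∈ B, weightSpace i hi ρ ν) : v = 0 := by
  classical
  obtain ⟨A, hA, c, hc, hsum⟩ := exists_expansion_of_mem_iSup hv'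
  have hlam : lam ∉ A := fun h => hB (hA h)
  have := torusChar_independent (K := K) (insert lam A) (fun ν => if ν = lam then v else -c ν)
    (fun x => ?_) lam (by simp)
  · simpa using this
  · rw [Finset.sum_insert hlam]
    have h1 : ∀ ν ∈ A, torusChar K ν x • (if ν = lam then v else -c ν) =
        -(ρ (torusElement i hi x) (c ν)) := by
      intro ν hν
      rw [if_neg (fun h : ν = lam => hlam (h ▸ hν)), hc ν x, smul_neg]
    rw [Finset.sum_congr rfl h1, Finset.sum_neg_distrib, ← map_sum, hsum, hv x]
    simp

/-- Along a polynomial curve in the group, a rational representation is polynomial. -/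
theorem curve_expansion [FiniteDimensional K V] {ρ : Representation K (SO m K) V}
    (hρ : IsRational ρ) (γ : K → SO m K)
    (hγ : ∀ k l, ∃ q : Polynomial K, ∀ s,
      (γ s : Matrix (Fin (2 * m)) (Fin (2 * m)) K) k l = q.eval s) (v : V) :
    ∃ (N : ℕ) (c : ℕ → V), ∀ s, ρ (γ s) v = ∑ k ∈ Finset.range N, s ^ k • c k := by
  classical
  set b := Module.finBasis K V
  choose p hp using fun a => hρ (b.coord a) v
  choose q hq using hγ
  set r : _ → Polynomial K := fun a => MvPolynomial.aeval (fun kl => q kl.1 kl.2) (p a)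
  have hr : ∀ a s, b.coord a (ρ (γ s) v) = (r a).eval s := by
    intro a s
    rw [hp]
    simp only [hq]
    have := MvPolynomial.comp_aeval_apply (fun kl : Fin (2 * m) × Fin (2 * m) => q kl.1 kl.2)
      (Polynomial.aeval s) (p a)
    rw [Polynomial.coe_aeval_eq_eval] at this
    rw [this, ← MvPolynomial.coe_aeval_eq_eval]
    rfl
  refine ⟨Finset.univ.sup (fun a => (r a).natDegree) + 1, fun k => ∑ a, (r a).coeff k • b a,
    fun s => ?_⟩
  rw [← b.sum_repr (ρ (γ s) v)]
  simp only [Finset.smul_sum]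
  rw [Finset.sum_comm]
  refine Finset.sum_congr rfl fun a _ => ?_
  simp only [smul_smul, ← Finset.sum_smul]
  congr 1
  rw [← Module.Basis.coord_apply, hr, Polynomial.eval_eq_sum_range' (Nat.lt_succ_of_le
    (Finset.le_sup (f := fun a => (r a).natDegree) (Finset.mem_univ a)))]
  exact Finset.sum_congr rfl fun k _ => mul_comm _ _

theorem eq_zero_of_sum_pow_smul_eq_zero [Infinite K] (N : ℕ) (c : ℕ → V)
    (h : ∀ s : K, ∑ k ∈ Finset.range N, s ^ k • c k = 0) : ∀ k < N, c k = 0 := by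
  intro k hk
  rw [← Module.forall_dual_apply_eq_zero_iff K]
  intro ψ
  set P : Polynomial K := ∑ k ∈ Finset.range N, Polynomial.C (ψ (c k)) * Polynomial.X ^ k with hP
  have h0 : P = 0 := by
    refine Polynomial.funext fun s => ?_
    have := congrArg ψ (h s)
    simpa [hP, Polynomial.eval_finsetSum, mul_comm (ψ _)] using this
  have := congrArg (fun P => Polynomial.coeff P k) h0
  simpa [hP, Polynomial.finsetSum_coeff, Polynomial.coeff_C_mul, Polynomial.coeff_X_pow, hk]
    using this

/-- A one-parameter subgroup normalized by the torus with character `α` raises weights by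
multiples of `α`. -/
theorem root_expansion [FiniteDimensional K V] {ρ : Representation K (SO m K) V}
    (hρ : IsRational ρ) (γ : K → SO m K)
    (hγ : ∀ k l, ∃ q : Polynomial K, ∀ s,
      (γ s : Matrix (Fin (2 * m)) (Fin (2 * m)) K) k l = q.eval s)
    (hγ0 : γ 0 = 1) (α : Fin m → ℤ)
    (hα : ∀ x s, torusElement i hi x * γ s = γ (torusChar K α x * s) * torusElement i hi x)
    {μ : Fin m → ℤ} {v : V} (hv : v ∈ weightSpace i hi ρ μ) :
    ∃ (N : ℕ) (c : ℕ → V), (∀ k < N, c k ∈ weightSpace i hi ρ (μ + (k + 1) • α)) ∧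
      ∀ s, ρ (γ s) v = v + ∑ k ∈ Finset.range N, s ^ (k + 1) • c k := by
  obtain ⟨N, c, hc⟩ := curve_expansion hρ γ hγ v
  -- A zero term is appended so that the constant term can be split off even if `N = 0`.
  set d : ℕ → V := fun k => if k < N then c k else 0 with hd
  have hd' : ∀ s, ρ (γ s) v = ∑ k ∈ Finset.range (N + 1), s ^ k • d k := by
    intro s
    rw [hc, Finset.sum_range_succ]
    simp only [hd, lt_irrefl, if_false, smul_zero, add_zero]
    refine Finset.sum_congr rfl fun k hk => ?_
    rw [if_pos (Finset.mem_range.mp hk)]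
  have h0 : d 0 = v := by
    have := hd' 0
    rw [hγ0, map_one, Module.End.one_apply, Finset.sum_range_succ'] at this
    simpa using this.symm
  refine ⟨N, fun k => d (k + 1), fun k hk x => ?_, fun s => ?_⟩
  -- Compare the coefficients of `s ^ (k + 1)` in the two expressions for `t γ(s) v = γ(α(t) s) t
  -- v`, where `t` is the torus element.
  · have := eq_zero_of_sum_pow_smul_eq_zero (K := K) (N + 1)
      (fun k => ρ (torusElement i hi x) (d k) - torusChar K (μ + k • α) x • d k) (fun s => ?_)
      (k + 1) (by omega)
    · exact sub_eq_zero.mp this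
    · have h1 : ρ (torusElement i hi x * γ s) v =
          ∑ k ∈ Finset.range (N + 1), s ^ k • ρ (torusElement i hi x) (d k) := by
        rw [map_mul, Module.End.mul_apply, hd']
        simp
      rw [hα, map_mul, Module.End.mul_apply, hv x, map_smul, hd', Finset.smul_sum] at h1
      simp only [smul_sub, Finset.sum_sub_distrib, ← h1, torusChar_add, torusChar_nsmul, smul_smul,
        mul_pow, sub_eq_zero]
      refine Finset.sum_congr rfl fun k _ => ?_
      congr 1
      ring
  · rw [hd', Finset.sum_range_succ', h0, pow_zero, one_smul, add_comm]

end Weights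

/-! ### Siegel transformations. -/

section Siegel

variable {K : Type*} [Field K] {n : Type*} [Fintype n] [DecidableEq n]

open Matrix

theorem matrix_ext_mulVec {A B : Matrix n n K} (h : ∀ x, A *ᵥ x = B *ᵥ x) : A = B :=
  Matrix.toLin'.injective (LinearMap.ext fun x => by simpa using h x)

/-- The Siegel transformation attached to an isotropic vector `e` and a vector `w` orthogonal
to it. -/
def siegelMatrix (e w : n → K) : Matrix n n K :=
  1 + vecMulVec w e - vecMulVec e w - ((w ⬝ᵥ w) / 2) • vecMulVec e e

theorem siegelMatrix_mulVec (e w x : n → K) : siegelMatrix e w *ᵥ x =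
    x + (e ⬝ᵥ x) • w - (w ⬝ᵥ x) • e - ((w ⬝ᵥ w) / 2 * (e ⬝ᵥ x)) • e := by
  simp [siegelMatrix, Matrix.sub_mulVec, Matrix.add_mulVec, Matrix.smul_mulVec,
    Matrix.vecMulVec_mulVec, smul_smul]

theorem siegelMatrix_zero (e : n → K) : siegelMatrix e 0 = 1 := by
  simp [siegelMatrix]

theorem siegelMatrix_mul [CharZero K] {e w w' : n → K} (he : e ⬝ᵥ e = 0) (hw : e ⬝ᵥ w = 0)
    (hw' : e ⬝ᵥ w' = 0) : siegelMatrix e w * siegelMatrix e w' = siegelMatrix e (w + w') := by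
  refine matrix_ext_mulVec fun x => ?_
  have hwe : w ⬝ᵥ e = 0 := by rw [dotProduct_comm, hw]
  rw [← Matrix.mulVec_mulVec]
  simp only [siegelMatrix_mulVec, dotProduct_add, dotProduct_sub, dotProduct_smul, add_dotProduct,
    smul_eq_mul, he, hw', hwe, dotProduct_comm w' w]
  module

theorem siegelMatrix_transpose (e w : n → K) : (siegelMatrix e w)ᵀ = siegelMatrix e (-w) := by
  simp only [siegelMatrix, transpose_sub, transpose_add, transpose_one, transpose_smul,
    transpose_vecMulVec, neg_dotProduct, dotProduct_neg, neg_neg, vecMulVec_neg, neg_vecMulVec]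
  abel

theorem siegelMatrix_mul_transpose [CharZero K] {e w : n → K} (he : e ⬝ᵥ e = 0)
    (hw : e ⬝ᵥ w = 0) : siegelMatrix e w * (siegelMatrix e w)ᵀ = 1 := by
  rw [siegelMatrix_transpose, siegelMatrix_mul he hw (by simp [hw]), add_neg_cancel,
    siegelMatrix_zero]

/-- The transformation is the square of the one with vector `w / 2`, which is orthogonal and so has
determinant of square `1`. -/
theorem siegelMatrix_det [CharZero K] {e w : n → K} (he : e ⬝ᵥ e = 0) (hw : e ⬝ᵥ w = 0) :
    (siegelMatrix e w).det = 1 := by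
  have h2 : e ⬝ᵥ ((1 / 2 : K) • w) = 0 := by simp [hw]
  have h : siegelMatrix e w = siegelMatrix e ((1 / 2 : K) • w) * siegelMatrix e ((1 / 2 : K) • w) := by
    rw [siegelMatrix_mul he h2 h2, ← add_smul]
    norm_num
  have h3 := congrArg Matrix.det (siegelMatrix_mul_transpose he h2)
  rw [h, Matrix.det_mul]
  rwa [Matrix.det_mul, Matrix.det_transpose, Matrix.det_one] at h3

theorem siegelMatrix_conj {g : Matrix n n K} (hg : gᵀ * g = 1) (e w : n → K) :
    g * siegelMatrix e w = siegelMatrix (g *ᵥ e) (g *ᵥ w) * g := by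
  refine matrix_ext_mulVec fun x => ?_
  have hdot : ∀ x y, (g *ᵥ x) ⬝ᵥ (g *ᵥ y) = x ⬝ᵥ y := by
    intro x y
    rw [Matrix.dotProduct_mulVec, Matrix.vecMul_mulVec, ← Matrix.dotProduct_mulVec, hg,
      Matrix.one_mulVec]
  rw [← Matrix.mulVec_mulVec, ← Matrix.mulVec_mulVec]
  simp only [siegelMatrix_mulVec, hdot, Matrix.mulVec_sub, Matrix.mulVec_add, Matrix.mulVec_smul]

/-- The quadratic term vanishes for isotropic `w`. With `siegelMatrix_conj` this turns conjugation
by the torus into a rescaling of the parameter of a root subgroup. -/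
theorem siegelMatrix_smul_left {e w : n → K} (hw : w ⬝ᵥ w = 0) (a : K) :
    siegelMatrix (a • e) w = siegelMatrix e (a • w) := by
  simp [siegelMatrix, hw, vecMulVec_smul, smul_vecMulVec]

theorem siegelMatrix_mulVec_of_orthogonal {e w x : n → K} (h : e ⬝ᵥ x = 0) (h' : w ⬝ᵥ x = 0) :
    siegelMatrix e w *ᵥ x = x := by
  simp [siegelMatrix_mulVec, h, h']

/-- Siegel transformations act transitively on the isotropic vectors in general position. -/
theorem siegelMatrix_transport [CharZero K] {e f x : n → K} (he : e ⬝ᵥ e = 0) (hf : f ⬝ᵥ f = 0)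
    (hef : e ⬝ᵥ f = 2) (hx : x ⬝ᵥ x = 0) {a : K} (ha : a ≠ 0) (hfx : f ⬝ᵥ x = 2 * a) :
    siegelMatrix f ((1 / (2 * a)) • (x - a • e - ((e ⬝ᵥ x) / 2) • f)) *ᵥ (a • e) = x := by
  have hfe : f ⬝ᵥ e = 2 := by rw [dotProduct_comm, hef]
  have hxf : x ⬝ᵥ f = 2 * a := by rw [dotProduct_comm, hfx]
  -- Write `x = a • e + w₀ + (b / 2) • f` with `w₀` orthogonal to `e` and `f`. The vector `w₀ / (2
  -- a)` makes the linear term equal to `w₀`, and the isotropy of `x` makes the quadratic term equal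
  -- to `(b / 2) • f`.
  set b := e ⬝ᵥ x with hb
  have hxe : x ⬝ᵥ e = b := by rw [dotProduct_comm]
  rw [siegelMatrix_mulVec]
  simp only [dotProduct_smul, smul_dotProduct, sub_dotProduct, dotProduct_sub, smul_eq_mul,
    he, hf, hef, hx, hfe, hxf, hxe, hfx, ← hb]
  ext p
  simp only [Pi.add_apply, Pi.sub_apply, Pi.smul_apply, smul_eq_mul]
  field_simp
  ring

theorem siegelMatrix_curve (e w : n → K) (g : Matrix n n K) (k l : n) :
    ∃ q : Polynomial K, ∀ s, (siegelMatrix e (s • w) * g) k l = q.eval s := by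
  refine ⟨Polynomial.C (g k l) + Polynomial.C ((vecMulVec w e * g) k l
    - (vecMulVec e w * g) k l) * Polynomial.X
    - Polynomial.C ((w ⬝ᵥ w) / 2 * (vecMulVec e e * g) k l) * Polynomial.X ^ 2, fun s => ?_⟩
  simp only [siegelMatrix, Matrix.sub_mul, Matrix.add_mul, Matrix.one_mul, Matrix.smul_mul,
    smul_vecMulVec, vecMulVec_smul, Matrix.sub_apply, Matrix.add_apply, Matrix.smul_apply,
    smul_eq_mul, dotProduct_smul, smul_dotProduct, Polynomial.eval_sub, Polynomial.eval_add,
    Polynomial.eval_mul, Polynomial.eval_C, Polynomial.eval_X, Polynomial.eval_pow]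
  ring

end Siegel

/-! ### Isotropic torus eigenvectors and root subgroups. -/

section Isotropic

open Matrix

variable {K : Type*} [Field K] {m : ℕ}

/-- The isotropic vectors of weights `±L_j`. -/
def isoVec (i : K) (j : Fin m) (δ : ℤˣ) : Fin (2 * m) → K := fun p =>
  if (pairIdx.symm p).1 = j then
    (if (pairIdx.symm p).2 = 0 then 1 else -(((δ : ℤ) : K) * i)) else 0

theorem isoVec_pairIdx (i : K) (j k : Fin m) (δ : ℤˣ) (a : Fin 2) :
    isoVec i j δ (pairIdx (k, a)) =
      if k = j then (if a = 0 then 1 else -(((δ : ℤ) : K) * i)) else 0 := by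
  simp [isoVec]

theorem isoVec_dot (i : K) (j : Fin m) (δ : ℤˣ) (x : Fin (2 * m) → K) :
    isoVec i j δ ⬝ᵥ x = x (pairIdx (j, 0)) - ((δ : ℤ) : K) * i * x (pairIdx (j, 1)) := by
  rw [dotProduct, sum_pairIdx, Finset.sum_eq_single j]
  · simp [isoVec_pairIdx, sub_eq_add_neg]
  · intro k _ hk
    simp [isoVec_pairIdx, hk]
  · simp

theorem units_cast_mul_self (δ : ℤˣ) : ((δ : ℤ) : K) * ((δ : ℤ) : K) = 1 := by
  rcases Int.units_eq_one_or δ with rfl | rfl <;> simp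

theorem isoVec_dot_isoVec_of_ne (i : K) {j k : Fin m} (h : j ≠ k) (δ δ' : ℤˣ) :
    isoVec i j δ ⬝ᵥ isoVec i k δ' = 0 := by
  simp [isoVec_dot, isoVec_pairIdx, h]

theorem isoVec_dot_self {i : K} (hi : i ^ 2 = -1) (j : Fin m) (δ : ℤˣ) :
    isoVec i j δ ⬝ᵥ isoVec i j δ = 0 := by
  simp only [isoVec_dot, isoVec_pairIdx, if_true, one_ne_zero, if_false]
  linear_combination (i ^ 2) * units_cast_mul_self (K := K) δ + hi

theorem isoVec_dot_neg {i : K} (hi : i ^ 2 = -1) (j : Fin m) (δ : ℤˣ) :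
    isoVec i j δ ⬝ᵥ isoVec i j (-δ) = 2 := by
  simp only [isoVec_dot, isoVec_pairIdx, if_true, one_ne_zero, if_false, Units.val_neg, Int.cast_neg]
  linear_combination - (i ^ 2) * units_cast_mul_self (K := K) δ - hi

/-- Opposite isotropic vectors of a plane pair to `2` and all other pairs are orthogonal, so
coefficients are half the pairings with the opposite vector. -/
theorem isoVec_expansion [CharZero K] {i : K} (hi : i ^ 2 = -1) (x : Fin (2 * m) → K) :
    x = ∑ j : Fin m, (((isoVec i j (-1) ⬝ᵥ x) / 2) • isoVec i j 1
      + ((isoVec i j 1 ⬝ᵥ x) / 2) • isoVec i j (-1)) := by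
  refine pairIdx_ext fun k a => ?_
  rw [Finset.sum_apply, Finset.sum_eq_single k]
  · fin_cases a
    · simp [isoVec_dot, isoVec_pairIdx]
      ring
    · simp [isoVec_dot, isoVec_pairIdx]
      linear_combination (x (pairIdx (k, 1))) * hi
  · intro j _ hj
    simp [isoVec_pairIdx, hj.symm]
  · simp

theorem matrix_ext_isoVec [CharZero K] {i : K} (hi : i ^ 2 = -1)
    {A B : Matrix (Fin (2 * m)) (Fin (2 * m)) K}
    (h : ∀ j δ, A *ᵥ isoVec i j δ = B *ᵥ isoVec i j δ) : A = B := by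
  refine matrix_ext_mulVec fun x => ?_
  rw [isoVec_expansion hi x]
  simp only [Matrix.mulVec_sum, Matrix.mulVec_add, Matrix.mulVec_smul, h]

theorem torusMatrix_mulVec_isoVec [CharZero K] {i : K} (hi : i ^ 2 = -1) (x : Fin m → Kˣ)
    (j : Fin m) (δ : ℤˣ) :
    torusMatrix i x *ᵥ isoVec i j δ = torusChar K (Pi.single j (δ : ℤ)) x • isoVec i j δ := by
  rw [torusChar_single]
  have hx : (x j : K) ≠ 0 := (x j).ne_zero
  have hent : ∀ k l a b, torusMatrix i x (pairIdx (k, a)) (pairIdx (l, b)) =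
        if k = l then torusBlock i (x k) a b else 0 := by
    intro k l a b
    simp [torusMatrix, Matrix.blockDiagonal_apply]
  refine pairIdx_ext fun k a => ?_
  rw [Matrix.mulVec, dotProduct_comm, isoVec_dot]
  simp only [hent, Pi.smul_apply, isoVec_pairIdx]
  by_cases hk : k = j
  · subst hk
    rcases Int.units_eq_one_or δ with rfl | rfl <;> fin_cases a <;> simp [torusBlock] <;>
      field_simp <;> ring_nf <;> simp only [hi] <;> ring
  · simp [hk]

theorem mem_SO_iff {A : Matrix (Fin (2 * m)) (Fin (2 * m)) K} :
    A ∈ SO m K ↔ A * Aᵀ = 1 ∧ A.det = 1 := by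
  rw [Matrix.mem_specialOrthogonalGroup_iff, Matrix.mem_orthogonalGroup_iff]

theorem so_mul_transpose (g : SO m K) : g.1 * g.1ᵀ = 1 := (mem_SO_iff.mp g.2).1

theorem so_transpose_mul (g : SO m K) : g.1ᵀ * g.1 = 1 := mul_eq_one_comm.mp (so_mul_transpose g)

theorem so_dot_mulVec (g : SO m K) (x y : Fin (2 * m) → K) :
    (g.1 *ᵥ x) ⬝ᵥ (g.1 *ᵥ y) = x ⬝ᵥ y := by
  rw [Matrix.dotProduct_mulVec, Matrix.vecMul_mulVec, ← Matrix.dotProduct_mulVec, so_transpose_mul g,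
      Matrix.one_mulVec]

variable [CharZero K]

/-- The Siegel transformation as an element of the special orthogonal group. -/
def siegelElement {e w : Fin (2 * m) → K} (he : e ⬝ᵥ e = 0) (hw : e ⬝ᵥ w = 0) : SO m K :=
  ⟨siegelMatrix e w, mem_SO_iff.mpr ⟨siegelMatrix_mul_transpose he hw, siegelMatrix_det he hw⟩⟩

/-- The root subgroup with root `δ L_j + δ' L_k`. -/
def rootElement {i : K} (hi : i ^ 2 = -1) {j k : Fin m} (h : j ≠ k) (δ δ' : ℤˣ) (s : K) : SO m K :=
  siegelElement (e := isoVec i j δ) (w := s • isoVec i k δ') (isoVec_dot_self hi j δ)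
    (by simp [isoVec_dot_isoVec_of_ne i h])

theorem rootElement_val {i : K} (hi : i ^ 2 = -1) {j k : Fin m} (h : j ≠ k) (δ δ' : ℤˣ) (s : K) :
    (rootElement hi h δ δ' s).1 = siegelMatrix (isoVec i j δ) (s • isoVec i k δ') := rfl

theorem rootElement_zero {i : K} (hi : i ^ 2 = -1) {j k : Fin m} (h : j ≠ k) (δ δ' : ℤˣ) :
    rootElement hi h δ δ' 0 = 1 := by
  apply Subtype.ext
  simp [rootElement_val, siegelMatrix_zero]

theorem rootElement_curve {i : K} (hi : i ^ 2 = -1) {j k : Fin m} (h : j ≠ k) (δ δ' : ℤˣ)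
    (p q : Fin (2 * m)) :
    ∃ P : Polynomial K, ∀ s, (rootElement hi h δ δ' s).1 p q = P.eval s := by
  obtain ⟨P, hP⟩ := siegelMatrix_curve (isoVec i j δ) (isoVec i k δ') 1 p q
  exact ⟨P, fun s => by rw [← hP, Matrix.mul_one, rootElement_val]⟩

theorem torusElement_mul_rootElement {i : K} (hi : i ^ 2 = -1) {j k : Fin m} (h : j ≠ k)
    (δ δ' : ℤˣ) (x : Fin m → Kˣ) (s : K) :
    torusElement i hi x * rootElement hi h δ δ' s =
      rootElement hi h δ δ' (torusChar K (Pi.single j (δ : ℤ) + Pi.single k (δ' : ℤ)) x * s) *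
        torusElement i hi x := by
  apply Subtype.ext
  simp only [Submonoid.coe_mul, rootElement_val]
  rw [siegelMatrix_conj (so_transpose_mul (torusElement i hi x)), Matrix.mulVec_smul, torusElement_val,
    torusMatrix_mulVec_isoVec hi, torusMatrix_mulVec_isoVec hi, siegelMatrix_smul_left, smul_smul,
    smul_smul, torusChar_add]
  · congr 3
    ring
  · simp [isoVec_dot_self hi]

end Isotropic

/-! ### Zariski closed sets and stabilizers of hyperbolic planes. -/

section BigCell

open Matrix

variable {K : Type*} [Field K] [CharZero K] {m : ℕ}

/-- A subset of the special orthogonal group which is closed in the Zariski topology. -/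
def IsZariskiClosed (S : Set (SO m K)) : Prop :=
  ∀ g ∉ S, ∃ p : MvPolynomial (Fin (2 * m) × Fin (2 * m)) K,
    (∀ h ∈ S, MvPolynomial.eval (fun kl => (h : Matrix (Fin (2 * m)) (Fin (2 * m)) K) kl.1 kl.2) p
      = 0) ∧
    MvPolynomial.eval (fun kl => (g : Matrix (Fin (2 * m)) (Fin (2 * m)) K) kl.1 kl.2) p ≠ 0

/-- An equation of `S` pulled back to the curve vanishes wherever `r` does not. Its product with `r`
is thus zero, and `r ≠ 0` forces the pulled back equation to vanish identically. -/
theorem IsZariskiClosed.mem_of_curve {S : Set (SO m K)} (hS : IsZariskiClosed S) (γ : K → SO m K)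
    (hγ : ∀ k l, ∃ q : Polynomial K, ∀ s,
      (γ s : Matrix (Fin (2 * m)) (Fin (2 * m)) K) k l = q.eval s)
    {r : Polynomial K} (hr : r ≠ 0) (h : ∀ s, r.eval s ≠ 0 → γ s ∈ S) (s₀ : K) : γ s₀ ∈ S := by
  by_contra hs₀
  obtain ⟨p, hp, hp₀⟩ := hS _ hs₀
  choose q hq using hγ
  have heval : ∀ s, MvPolynomial.eval
      (fun kl => (γ s : Matrix (Fin (2 * m)) (Fin (2 * m)) K) kl.1 kl.2) p =
      (MvPolynomial.aeval (fun kl : Fin (2 * m) × Fin (2 * m) => q kl.1 kl.2) p).eval s := by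
    intro s
    simp only [hq]
    have := MvPolynomial.comp_aeval_apply (fun kl : Fin (2 * m) × Fin (2 * m) => q kl.1 kl.2)
      (Polynomial.aeval s) p
    rw [Polynomial.coe_aeval_eq_eval] at this
    rw [this, ← MvPolynomial.coe_aeval_eq_eval]
    rfl
  have hzero : MvPolynomial.aeval (fun kl : Fin (2 * m) × Fin (2 * m) => q kl.1 kl.2) p * r = 0 := by
    refine Polynomial.funext fun s => ?_
    rw [Polynomial.eval_mul, Polynomial.eval_zero, ← heval]
    by_cases hs : r.eval s = 0
    · rw [hs, mul_zero]
    · rw [hp _ (h s hs), zero_mul]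
  rcases mul_eq_zero.mp hzero with h0 | h0
  · rw [heval, h0, Polynomial.eval_zero] at hp₀
    exact hp₀ rfl
  · exact hr h0

theorem siegelElement_val {e w : Fin (2 * m) → K} (he : e ⬝ᵥ e = 0) (hw : e ⬝ᵥ w = 0) :
    (siegelElement he hw).1 = siegelMatrix e w := rfl

theorem siegelElement_mul {e w w' : Fin (2 * m) → K} (he : e ⬝ᵥ e = 0) (hw : e ⬝ᵥ w = 0)
    (hw' : e ⬝ᵥ w' = 0) : siegelElement he hw * siegelElement he hw' =
      siegelElement (w := w + w') he (by rw [dotProduct_add, hw, hw', add_zero]) :=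
  Subtype.ext (siegelMatrix_mul he hw hw')

theorem siegelElement_neg_mul {e w : Fin (2 * m) → K} (he : e ⬝ᵥ e = 0) (hw : e ⬝ᵥ w = 0)
    (hw' : e ⬝ᵥ (-w) = 0) : siegelElement he hw' * siegelElement he hw = 1 := by
  apply Subtype.ext
  simp only [Submonoid.coe_mul, siegelElement_val, siegelMatrix_mul he hw' hw, neg_add_cancel,
    siegelMatrix_zero, Submonoid.coe_one]

theorem siegelElement_mul_neg {e w : Fin (2 * m) → K} (he : e ⬝ᵥ e = 0) (hw : e ⬝ᵥ w = 0)
    (hw' : e ⬝ᵥ (-w) = 0) : siegelElement he hw * siegelElement he hw' = 1 := by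
  apply Subtype.ext
  simp only [Submonoid.coe_mul, siegelElement_val, siegelMatrix_mul he hw hw', add_neg_cancel,
    siegelMatrix_zero, Submonoid.coe_one]

variable {i : K}

/-- A submonoid containing the root elements `δ L_j ± L_k` with `j < k` contains the Siegel
transformations along `isoVec i j δ`. -/
theorem siegelElement_mem (hi : i ^ 2 = -1) (M : Submonoid (SO m K)) (j : Fin m) (δ : ℤˣ)
    (hM : ∀ k (h : j < k) δ' s, rootElement hi h.ne δ δ' s ∈ M)
    {w : Fin (2 * m) → K} (hw : isoVec i j δ ⬝ᵥ w = 0)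
    (hw' : ∀ k ≤ j, ∀ δ', isoVec i k δ' ⬝ᵥ w = 0) :
    siegelElement (isoVec_dot_self hi j δ) hw ∈ M := by
  -- Orthogonality is part of the induction over the expansion of `w`, since each partial sum needs
  -- it to define a Siegel element.
  have key : isoVec i j δ ⬝ᵥ w = 0 ∧
      ∀ h : isoVec i j δ ⬝ᵥ w = 0, siegelElement (isoVec_dot_self hi j δ) h ∈ M := by
    rw [isoVec_expansion hi w]
    have hadd : ∀ u v : Fin (2 * m) → K, (isoVec i j δ ⬝ᵥ u = 0 ∧
        ∀ h : isoVec i j δ ⬝ᵥ u = 0, siegelElement (isoVec_dot_self hi j δ) h ∈ M) →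
        (isoVec i j δ ⬝ᵥ v = 0 ∧
        ∀ h : isoVec i j δ ⬝ᵥ v = 0, siegelElement (isoVec_dot_self hi j δ) h ∈ M) →
        (isoVec i j δ ⬝ᵥ (u + v) = 0 ∧
        ∀ h : isoVec i j δ ⬝ᵥ (u + v) = 0, siegelElement (isoVec_dot_self hi j δ) h ∈ M) := by
      intro u v hu hv
      refine ⟨by rw [dotProduct_add, hu.1, hv.1, add_zero], fun h => ?_⟩
      rw [← siegelElement_mul _ hu.1 hv.1]
      exact M.mul_mem (hu.2 _) (hv.2 _)
    have hzero : (isoVec i j δ ⬝ᵥ (0 : Fin (2 * m) → K) = 0 ∧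
        ∀ h : isoVec i j δ ⬝ᵥ (0 : Fin (2 * m) → K) = 0,
          siegelElement (isoVec_dot_self hi j δ) h ∈ M) := by
      refine ⟨dotProduct_zero _, fun h => ?_⟩
      have : siegelElement (isoVec_dot_self hi j δ) h = 1 :=
        Subtype.ext (siegelMatrix_zero _)
      rw [this]
      exact M.one_mem
    refine Finset.sum_induction _ (fun u => isoVec i j δ ⬝ᵥ u = 0 ∧
      ∀ h : isoVec i j δ ⬝ᵥ u = 0, siegelElement (isoVec_dot_self hi j δ) h ∈ M) hadd hzero ?_
    intro k _
    by_cases hk : k ≤ j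
    · rw [hw' k hk, hw' k hk]
      simpa using hzero
    · have hjk : j < k := not_le.mp hk
      have hs : ∀ (c : K) δ', (isoVec i j δ ⬝ᵥ (c • isoVec i k δ') = 0 ∧
        ∀ h : isoVec i j δ ⬝ᵥ (c • isoVec i k δ') = 0,
          siegelElement (isoVec_dot_self hi j δ) h ∈ M) := fun c δ' =>
        ⟨by simp [isoVec_dot_isoVec_of_ne i hjk.ne], fun _ => hM k hjk δ' c⟩
      exact hadd _ _ (hs _ _) (hs _ _)
  exact key.2 hw

theorem torusElement_mul_inv (hi : i ^ 2 = -1) (x : Fin m → Kˣ) :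
    torusElement i hi x * torusElement i hi x⁻¹ = 1 := by
  rw [← torusElement_mul, mul_inv_cancel, torusElement_one]

theorem mulVec_torusElement_update (hi : i ^ 2 = -1) (k j : Fin m) (δ : ℤˣ) (a : Kˣ) :
    (torusElement i hi (Function.update 1 k a)).1 *ᵥ isoVec i j δ =
      (if j = k then (a : K) ^ (δ : ℤ) else 1) • isoVec i j δ := by
  rw [torusElement_val, torusMatrix_mulVec_isoVec hi, torusChar_single]
  split_ifs with h
  · subst h; simp
  · simp [h]

/-- The pointwise stabilizer of the first `k` hyperbolic planes, as a predicate. -/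
def FixesBelow (i : K) (k : ℕ) (g : SO m K) : Prop :=
  ∀ j : Fin m, (j : ℕ) < k → ∀ δ, g.1 *ᵥ isoVec i j δ = isoVec i j δ

theorem FixesBelow.mul {k : ℕ} {g h : SO m K} (hg : FixesBelow i k g) (hh : FixesBelow i k h) :
    FixesBelow i k (g * h) := by
  intro j hj δ
  rw [Submonoid.coe_mul, ← Matrix.mulVec_mulVec, hh j hj, hg j hj]

theorem fixesBelow_siegel (hi : i ^ 2 = -1) (k : Fin m) (δ : ℤˣ) {w : Fin (2 * m) → K}
    (hw : isoVec i k δ ⬝ᵥ w = 0) (hw' : ∀ j < k, ∀ δ', isoVec i j δ' ⬝ᵥ w = 0) :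
    FixesBelow i k (siegelElement (isoVec_dot_self hi k δ) hw) := by
  intro j hj δ'
  refine siegelMatrix_mulVec_of_orthogonal (isoVec_dot_isoVec_of_ne i (Fin.ne_of_gt hj) _ _) ?_
  rw [dotProduct_comm]
  exact hw' j hj δ'

theorem fixesBelow_torus (hi : i ^ 2 = -1) (k : Fin m) (a : Kˣ) :
    FixesBelow i k (torusElement i hi (Function.update 1 k a)) := by
  intro j hj δ
  rw [mulVec_torusElement_update, if_neg (Fin.ne_of_lt hj), one_smul]

theorem FixesBelow.dot_eq_zero {k : Fin m} {g : SO m K} (hg : FixesBelow i k g)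
    {j : Fin m} (hj : j < k) (δ δ' : ℤˣ) : isoVec i j δ ⬝ᵥ (g.1 *ᵥ isoVec i k δ') = 0 := by
  rw [← hg j hj, so_dot_mulVec, isoVec_dot_isoVec_of_ne i hj.ne]

theorem units_eq_or_eq_neg (δ ε : ℤˣ) : δ = ε ∨ δ = -ε := by
  rcases Int.units_eq_one_or δ with rfl | rfl <;> rcases Int.units_eq_one_or ε with rfl | rfl <;>
    decide

/-- The vector for which the Siegel transformation along `isoVec i k (-δ)` moves a multiple of
`isoVec i k δ` to `x`. -/
theorem exists_siegel_transport (hi : i ^ 2 = -1) (k : Fin m) (δ : ℤˣ) {x : Fin (2 * m) → K}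
    (hx : x ⬝ᵥ x = 0) (hxk : ∀ j < k, ∀ δ', isoVec i j δ' ⬝ᵥ x = 0) {a : K} (ha : a ≠ 0)
    (hax : isoVec i k (-δ) ⬝ᵥ x = 2 * a) :
    ∃ w, (∀ j ≤ k, ∀ δ', isoVec i j δ' ⬝ᵥ w = 0) ∧
      siegelMatrix (isoVec i k (-δ)) w *ᵥ (a • isoVec i k δ) = x := by
  have hef := isoVec_dot_neg hi k δ
  have hfe : isoVec i k (-δ) ⬝ᵥ isoVec i k δ = 2 := by rw [dotProduct_comm, hef]
  refine ⟨_, fun j hj δ' => ?_, siegelMatrix_transport (isoVec_dot_self hi k δ)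
    (isoVec_dot_self hi k (-δ)) hef hx ha hax⟩
  rcases hj.lt_or_eq with hj | rfl
  · simp [dotProduct_sub, hxk j hj, isoVec_dot_isoVec_of_ne i hj.ne]
  · rcases units_eq_or_eq_neg δ' δ with rfl | rfl
    · simp [dotProduct_sub, isoVec_dot_self hi, hef]
    · simp [dotProduct_sub, isoVec_dot_self hi, hax, hfe, mul_comm]

/-- An orthogonal matrix which stabilizes all but the last hyperbolic plane pointwise and does not
preserve the orientation of the last one has determinant `-1`. -/
theorem dot_ne_zero_of_last (hi : i ^ 2 = -1) {k : Fin m} (hk : (k : ℕ) + 1 = m) {g : SO m K}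
    (hg : FixesBelow i k g) : isoVec i k (-1) ⬝ᵥ (g.1 *ᵥ isoVec i k 1) ≠ 0 := by
  intro h0
  set e := isoVec i k 1 with he
  set f := isoVec i k (-1) with hf
  have hef : e ⬝ᵥ f = 2 := isoVec_dot_neg hi k 1
  have hfe : f ⬝ᵥ e = 2 := by rw [dotProduct_comm, hef]
  have hee : e ⬝ᵥ e = 0 := isoVec_dot_self hi k 1
  have hff : f ⬝ᵥ f = 0 := isoVec_dot_self hi k (-1)
  have hle : ∀ j : Fin m, j ≠ k → j < k := fun j hj => by
    have : (j : ℕ) ≠ k := fun h => hj (Fin.ext h)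
    rw [Fin.lt_def]
    omega
  have hexp : ∀ δ, g.1 *ᵥ isoVec i k δ = ((f ⬝ᵥ (g.1 *ᵥ isoVec i k δ)) / 2) • e +
      ((e ⬝ᵥ (g.1 *ᵥ isoVec i k δ)) / 2) • f := by
    intro δ
    conv_lhs => rw [isoVec_expansion hi (g.1 *ᵥ isoVec i k δ)]
    rw [Finset.sum_eq_single k]
    · intro j _ hj
      simp [hg.dot_eq_zero (hle j hj)]
    · simp
  set c := (e ⬝ᵥ (g.1 *ᵥ e)) / 2 with hc
  have hge : g.1 *ᵥ e = c • f := by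
    have := hexp 1
    rwa [← he, h0, zero_div, zero_smul, zero_add] at this
  have hgf := hexp (-1)
  rw [← hf] at hgf
  set a := (f ⬝ᵥ (g.1 *ᵥ f)) / 2
  set b := (e ⬝ᵥ (g.1 *ᵥ f)) / 2
  have h1 : c * a = 1 := by
    have := so_dot_mulVec g e f
    rw [hge, hgf] at this
    simp only [smul_dotProduct, dotProduct_add, dotProduct_smul, hfe, hff, hef, smul_eq_mul] at this
    linear_combination this / 2
  have hc0 : c ≠ 0 := left_ne_zero_of_mul_eq_one h1
  have ha0 : a ≠ 0 := right_ne_zero_of_mul_eq_one h1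
  have h2 : b = 0 := by
    have := so_dot_mulVec g f f
    rw [hgf] at this
    simp only [smul_dotProduct, add_dotProduct, dotProduct_add, dotProduct_smul, hfe, hff, hef, hee,
      smul_eq_mul] at this
    have h3 : a * b = 0 := by linear_combination this / 4
    exact (mul_eq_zero.mp h3).resolve_left ha0
  rw [h2, zero_smul, add_zero] at hgf
  -- `g` exchanges the lines of `e` and `f` and fixes the other planes, so it is the reflection in
  -- `v = g e - e`. Since `v ⬝ᵥ v = -4 c`, this is the rank one perturbation below, and its
  -- determinant is `-1`.
  set v := c • f - e with hv
  have hdet : (1 + vecMulVec ((1 / (2 * c)) • v) v).det = -1 := by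
    rw [Matrix.vecMulVec_eq Unit, Matrix.det_one_add_replicateCol_mul_replicateRow]
    simp only [hv, smul_dotProduct, sub_dotProduct, dotProduct_sub, dotProduct_smul, hfe, hff, hef,
      hee, smul_eq_mul]
    field_simp
    ring
  have hgR : g.1 = 1 + vecMulVec ((1 / (2 * c)) • v) v := by
    refine matrix_ext_isoVec hi fun j δ => ?_
    rw [Matrix.add_mulVec, Matrix.one_mulVec, Matrix.vecMulVec_mulVec]
    by_cases hj : j = k
    · subst hj
      rcases Int.units_eq_one_or δ with rfl | rfl
      · rw [← he, hge, hv]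
        simp only [sub_dotProduct, smul_dotProduct, hfe, hee, smul_eq_mul]
        ext p
        simp
        field_simp
        ring
      · rw [← hf, hgf, hv]
        simp only [sub_dotProduct, smul_dotProduct, hef, hff, smul_eq_mul]
        have : a = 1 / c := by field_simp; linear_combination h1
        ext p
        simp [this]
        field_simp
        ring
    · have hdot : ∀ δ', isoVec i k δ' ⬝ᵥ isoVec i j δ = 0 := fun δ' =>
        isoVec_dot_isoVec_of_ne i (Ne.symm hj) _ _
      rw [hg j (hle j hj), hv]
      simp [sub_dotProduct, he, hf, hdot]
  have := (mem_SO_iff.mp g.2).2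
  rw [hgR, hdet] at this
  norm_num at this

end BigCell

/-! ### Density of the big cell. -/

section BigCellDensity

open Matrix

variable {K : Type*} [Field K] [CharZero K] {m : ℕ} {i : K}

/-- The elements whose left translation preserves `S`. -/
def leftStabilizer (S : Set (SO m K)) : Submonoid (SO m K) where
  carrier := {u | ∀ g ∈ S, u * g ∈ S}
  mul_mem' {u v} hu hv g hg := by
    rw [mul_assoc]
    exact hu _ (hv _ hg)
  one_mem' g hg := by rwa [one_mul]

/-- The elements whose right translation preserves `S`. -/
def rightStabilizer (S : Set (SO m K)) : Submonoid (SO m K) where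
  carrier := {u | ∀ g ∈ S, g * u ∈ S}
  mul_mem' {u v} hu hv g hg := by
    rw [← mul_assoc]
    exact hv _ (hu _ hg)
  one_mem' g hg := by rwa [mul_one]

theorem FixesBelow.succ {k : Fin m} {g : SO m K} (hg : FixesBelow i k g)
    (h : ∀ δ, g.1 *ᵥ isoVec i k δ = isoVec i k δ) : FixesBelow i (k + 1) g := by
  intro j hj δ
  rcases (Nat.lt_succ_iff_lt_or_eq.mp hj) with hj | hj
  · exact hg j hj δ
  · rw [Fin.ext hj]
    exact h δ

/-- The elements of the stabilizer of the first `k` hyperbolic planes in general position factor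
through the stabilizer of the first `k + 1`. -/
theorem mem_of_dot_ne_zero (hi : i ^ 2 = -1) {S : Set (SO m K)} {k : Fin m}
    (hT : ∀ x, torusElement i hi x ∈ leftStabilizer S)
    (hneg : ∀ l (h : k < l) δ s, rootElement hi h.ne (-1) δ s ∈ leftStabilizer S)
    (hpos : ∀ l (h : k < l) δ s, rootElement hi h.ne 1 δ s ∈ rightStabilizer S)
    (hk : ∀ h : SO m K, FixesBelow i (k + 1) h → h ∈ S) {g : SO m K} (hg : FixesBelow i k g)
    (ha : isoVec i k (-1) ⬝ᵥ (g.1 *ᵥ isoVec i k 1) ≠ 0) : g ∈ S := by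
  set e := isoVec i k 1 with he
  set f := isoVec i k (-1) with hf
  have hfe : f ⬝ᵥ e = 2 := by rw [dotProduct_comm]; exact isoVec_dot_neg hi k 1
  have hee : e ⬝ᵥ e = 0 := isoVec_dot_self hi k 1
  have hff : f ⬝ᵥ f = 0 := isoVec_dot_self hi k (-1)
  set a := (f ⬝ᵥ (g.1 *ᵥ e)) / 2 with ha'
  have ha0 : a ≠ 0 := div_ne_zero ha two_ne_zero
  -- The Siegel element `u` built from `w` carries `a • e` to `g e`, and the torus element `t`
  -- carries `e` to `a • e`. Hence `g' = t⁻¹ u⁻¹ g` fixes `e`.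
  obtain ⟨w, hw, hwx⟩ := exists_siegel_transport hi k 1 (x := g.1 *ᵥ e)
    (by rw [so_dot_mulVec, hee]) (fun j hj δ' => hg.dot_eq_zero hj δ' 1) ha0
    (by rw [ha']; field_simp; rfl)
  have hfw : f ⬝ᵥ w = 0 := hw k le_rfl _
  have hfw' : f ⬝ᵥ (-w) = 0 := by simp [hfw]
  set u := siegelElement (isoVec_dot_self hi k (-1)) hfw
  set u' := siegelElement (isoVec_dot_self hi k (-1)) hfw'
  set t := torusElement i hi (Function.update 1 k (Units.mk0 a ha0)) with ht
  set t' := torusElement i hi (Function.update 1 k (Units.mk0 a ha0))⁻¹ with ht'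
  have htt : t' = torusElement i hi (Function.update 1 k (Units.mk0 a ha0)⁻¹) := by
    rw [ht']
    congr 1
    rw [← inv_one, Function.update_inv]
    simp
  have hu : u ∈ leftStabilizer S := siegelElement_mem hi _ k (-1) hneg hfw hw
  set g' := t' * (u' * g) with hg'
  have hgg' : g = u * (t * g') := by
    have h1 : t * t' = 1 := torusElement_mul_inv hi _
    have h2 : u * u' = 1 := siegelElement_mul_neg _ _ _
    rw [hg', ← mul_assoc t, h1, one_mul, ← mul_assoc, h2, one_mul]
  have hge : g'.1 *ᵥ e = e := by
    have h2 : u' * u = 1 := siegelElement_neg_mul _ _ _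
    have h3 : u'.1 * u.1 = 1 := congrArg Subtype.val h2
    rw [hg']
    simp only [Submonoid.coe_mul]
    rw [← Matrix.mulVec_mulVec, ← Matrix.mulVec_mulVec, ← hwx]
    change t'.1 *ᵥ (u'.1 *ᵥ (u.1 *ᵥ (a • e))) = e
    rw [Matrix.mulVec_mulVec _ u'.1, h3, Matrix.one_mulVec, Matrix.mulVec_smul, htt,
      mulVec_torusElement_update, if_pos rfl, smul_smul]
    simp [ha0, he]
  have hfix' : FixesBelow i k g' := by
    refine FixesBelow.mul ?_ (FixesBelow.mul ?_ hg)
    · rw [htt]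
      exact fixesBelow_torus hi k _
    · exact fixesBelow_siegel hi k _ _ fun j hj δ' => by simp [hw j hj.le]
  -- `y` is the preimage of `f` under `g'`. As `g'` fixes `e`, the pairing of `e` with `y` is `2`,
  -- so a Siegel transformation `v` along `e` takes `f` to `y` while fixing `e`. Then `g' v` fixes
  -- both.
  set y := g'.1ᵀ *ᵥ f with hy
  have hgy : g'.1 *ᵥ y = f := by
    rw [hy, Matrix.mulVec_mulVec, so_mul_transpose, Matrix.one_mulVec]
  have hdoty : ∀ x, x ⬝ᵥ y = (g'.1 *ᵥ x) ⬝ᵥ f := by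
    intro x
    rw [← so_dot_mulVec g' x y, hgy]
  obtain ⟨w', hw', hwy⟩ := exists_siegel_transport hi k (-1) (x := y)
    (by rw [hdoty, hgy, hff]) (fun j hj δ' => by
      rw [hdoty, hfix' j hj, isoVec_dot_isoVec_of_ne i hj.ne]) one_ne_zero
    (by rw [neg_neg, hdoty, ← he, hge, dotProduct_comm, hfe, mul_one])
  rw [one_smul, neg_neg] at hwy
  have hew : e ⬝ᵥ w' = 0 := hw' k le_rfl _
  have hew' : e ⬝ᵥ (-w') = 0 := by simp [hew]
  set v := siegelElement (isoVec_dot_self hi k 1) hew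
  set v' := siegelElement (isoVec_dot_self hi k 1) hew'
  have hv' : v' ∈ rightStabilizer S :=
    siegelElement_mem hi _ k 1 hpos hew' fun j hj δ' => by simp [hw' j hj]
  have hgv : g' = (g' * v) * v' := by
    have h2 : v * v' = 1 := siegelElement_mul_neg _ _ _
    rw [mul_assoc, h2, mul_one]
  have hmem : g' * v ∈ S := by
    refine hk _ (FixesBelow.succ (hfix'.mul
      (fixesBelow_siegel hi k _ _ fun j hj δ' => hw' j hj.le δ')) fun δ => ?_)
    rw [Submonoid.coe_mul, ← Matrix.mulVec_mulVec]
    rcases Int.units_eq_one_or δ with rfl | rfl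
    · rw [← he]
      have : v.1 *ᵥ e = e :=
        siegelMatrix_mulVec_of_orthogonal hee (by rw [dotProduct_comm]; exact hew)
      rw [this, hge]
    · have : v.1 *ᵥ f = y := hwy
      rw [← hf, this, hgy]
  rw [hgg']
  refine hu _ (hT _ _ ?_)
  rw [hgv]
  exact hv' _ hmem

theorem mulVec_isoVec_ne_zero (hi : i ^ 2 = -1) (k : Fin m) (g : SO m K) :
    g.1 *ᵥ isoVec i k 1 ≠ 0 := by
  intro h
  have := so_dot_mulVec g (isoVec i k 1) (isoVec i k (-1))
  rw [h, zero_dotProduct, isoVec_dot_neg hi] at this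
  exact two_ne_zero this.symm

/-- A vector whose associated curve of Siegel transformations moves an element of the stabilizer
of the first `k` hyperbolic planes into general position. -/
theorem exists_generic_direction (hi : i ^ 2 = -1) {k : Fin m} {g : SO m K}
    (hg : FixesBelow i k g) (h0 : isoVec i k (-1) ⬝ᵥ (g.1 *ᵥ isoVec i k 1) = 0) :
    ∃ w, (∀ j ≤ k, ∀ δ', isoVec i j δ' ⬝ᵥ w = 0) ∧ (w ⬝ᵥ (g.1 *ᵥ isoVec i k 1) ≠ 0 ∨
      (w ⬝ᵥ w) * (isoVec i k 1 ⬝ᵥ (g.1 *ᵥ isoVec i k 1)) ≠ 0) := by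
  by_contra hcon
  push Not at hcon
  set x := g.1 *ᵥ isoVec i k 1 with hx
  -- If no direction works, `x` is orthogonal to all later planes and hence a nonzero multiple of
  -- `isoVec i k (-1)`.
  have horth : ∀ l, k < l → ∀ δ, isoVec i l δ ⬝ᵥ x = 0 := fun l hl δ =>
    (hcon (isoVec i l δ) fun j hj δ' =>
      isoVec_dot_isoVec_of_ne i (lt_of_le_of_lt hj hl).ne _ _).1
  have hexp : x = ((isoVec i k 1 ⬝ᵥ x) / 2) • isoVec i k (-1) := by
    conv_lhs => rw [isoVec_expansion hi x]
    rw [Finset.sum_eq_single k]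
    · simp [h0]
    · intro j _ hj
      rcases lt_or_gt_of_ne hj with hj | hj
      · simp [hx, hg.dot_eq_zero hj]
      · simp [horth j hj]
    · simp
  have hne : isoVec i k 1 ⬝ᵥ x ≠ 0 := by
    intro h
    rw [h, zero_div, zero_smul] at hexp
    exact mulVec_isoVec_ne_zero hi k g hexp
  -- In the last plane only `w = 0` is available and the determinant gives the contradiction;
  -- otherwise the next plane contains an anisotropic `w`.
  by_cases hk : (k : ℕ) + 1 = m
  · exact dot_ne_zero_of_last hi hk hg h0
  · have hlt : (k : ℕ) + 1 < m := by omega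
    set l : Fin m := ⟨k + 1, hlt⟩ with hl
    have hkl : k < l := by rw [Fin.lt_def]; simp [hl]
    have := (hcon (isoVec i l 1 + isoVec i l (-1)) fun j hj δ' => by
      rw [dotProduct_add, isoVec_dot_isoVec_of_ne i (lt_of_le_of_lt hj hkl).ne,
        isoVec_dot_isoVec_of_ne i (lt_of_le_of_lt hj hkl).ne, add_zero]).2
    have h2 : isoVec i l 1 ⬝ᵥ isoVec i l (-1) = 2 := isoVec_dot_neg hi l 1
    have h3 : isoVec i l (-1) ⬝ᵥ isoVec i l 1 = 2 := by rw [dotProduct_comm, h2]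
    simp only [dotProduct_add, add_dotProduct, isoVec_dot_self hi, h2, h3] at this
    rcases mul_eq_zero.mp this with h4 | h4
    · norm_num at h4
    · exact hne h4

/-- A Zariski closed set containing the identity and stable under the torus and the negative root
subgroups on the left and the positive root subgroups on the right is the whole group. -/
theorem zariskiClosed_eq_univ (hi : i ^ 2 = -1) {S : Set (SO m K)} (hS : IsZariskiClosed S)
    (h1 : 1 ∈ S) (hT : ∀ x, ∀ g ∈ S, torusElement i hi x * g ∈ S)
    (hneg : ∀ j l (h : j < l) δ s, ∀ g ∈ S, rootElement hi h.ne (-1) δ s * g ∈ S)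
    (hpos : ∀ j l (h : j < l) δ s, ∀ g ∈ S, g * rootElement hi h.ne 1 δ s ∈ S) (g : SO m K) :
    g ∈ S := by
  -- Induction on the number `d` of planes that are not yet fixed.
  have main : ∀ d k : ℕ, k + d = m → ∀ g : SO m K, FixesBelow i k g → g ∈ S := by
    intro d
    induction d with
    | zero =>
      intro k hk g hg
      have : g = 1 := by
        refine Subtype.ext (matrix_ext_isoVec hi fun j δ => ?_)
        rw [hg j (by omega), Submonoid.coe_one, Matrix.one_mulVec]
      rwa [this]
    | succ d ih =>
      intro k hk g hg
      set k' : Fin m := ⟨k, by omega⟩ with hk'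
      have hgood : ∀ h : SO m K, FixesBelow i k' h →
          isoVec i k' (-1) ⬝ᵥ (h.1 *ᵥ isoVec i k' 1) ≠ 0 → h ∈ S := fun h hh hne =>
        mem_of_dot_ne_zero hi hT (fun l h δ s => hneg _ l h δ s) (fun l h δ s => hpos _ l h δ s)
          (ih (k + 1) (by omega)) hh hne
      by_cases h0 : isoVec i k' (-1) ⬝ᵥ (g.1 *ᵥ isoVec i k' 1) = 0
      · obtain ⟨w, hw, hne⟩ := exists_generic_direction hi hg h0
        have hsw : ∀ s : K, isoVec i k' 1 ⬝ᵥ (s • w) = 0 := fun s => by simp [hw k' le_rfl]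
        set γ : K → SO m K := fun s => siegelElement (isoVec_dot_self hi k' 1) (hsw s) * g with hγ
        have hγ0 : γ 0 = g := by
          apply Subtype.ext
          simp [hγ, siegelElement_val, siegelMatrix_zero]
        rw [← hγ0]
        set x := g.1 *ᵥ isoVec i k' 1 with hx
        -- `r` is the pairing of `isoVec i k' (-1)` with the image of `isoVec i k' 1` under `γ s`,
        -- as a polynomial in `s`; its constant term vanishes by `h0`. Where `r` is nonzero, `γ s`
        -- is in general position.
        refine hS.mem_of_curve γ (fun p q => siegelMatrix_curve _ w g.1 p q)
          (r := Polynomial.C (-2 * (w ⬝ᵥ x)) * Polynomial.X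
            + Polynomial.C (-((w ⬝ᵥ w) * (isoVec i k' 1 ⬝ᵥ x))) * Polynomial.X ^ 2) ?_ ?_ 0
        · intro hr
          rcases hne with hne | hne
          · have := congrArg (fun P => Polynomial.coeff P 1) hr
            simp only [Polynomial.coeff_add, Polynomial.coeff_C_mul, Polynomial.coeff_X_pow,
              Polynomial.coeff_X, Polynomial.coeff_zero] at this
            norm_num at this
            exact hne this
          · have := congrArg (fun P => Polynomial.coeff P 2) hr
            simp only [Polynomial.coeff_add, Polynomial.coeff_C_mul, Polynomial.coeff_X_pow,
              Polynomial.coeff_X, Polynomial.coeff_zero] at this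
            norm_num at this
            rcases this with h | h
            · exact hne (by rw [h, zero_mul])
            · exact hne (by rw [h, mul_zero])
        · intro s hs
          refine hgood _ ((fixesBelow_siegel hi k' 1 (hsw s) fun j hj δ' => by
            simp [hw j hj.le]).mul hg) ?_
          have h2 : isoVec i k' (-1) ⬝ᵥ isoVec i k' 1 = 2 := by
            rw [dotProduct_comm]; exact isoVec_dot_neg hi k' 1
          have : isoVec i k' (-1) ⬝ᵥ ((γ s).1 *ᵥ isoVec i k' 1) =
              (Polynomial.C (-2 * (w ⬝ᵥ x)) * Polynomial.X
            + Polynomial.C (-((w ⬝ᵥ w) * (isoVec i k' 1 ⬝ᵥ x))) * Polynomial.X ^ 2).eval s := by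
            simp only [hγ, Submonoid.coe_mul, siegelElement_val, ← Matrix.mulVec_mulVec, ← hx,
              siegelMatrix_mulVec, dotProduct_add, dotProduct_sub, dotProduct_smul, smul_dotProduct,
              h0, hw k' le_rfl, h2, smul_eq_mul, Polynomial.eval_add, Polynomial.eval_mul,
              Polynomial.eval_C, Polynomial.eval_X, Polynomial.eval_pow]
            ring
          rwa [this]
      · exact hgood g hg h0
  exact main m 0 (by omega) g fun j hj => absurd hj (Nat.not_lt_zero _)

end BigCellDensity

/-! ### Irreducible representations and their matrix coefficients. -/

section Irreducible

variable {K G V : Type*} [Field K] [Monoid G] [AddCommGroup V] [Module K V]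
  {ρ : Representation K G V}

theorem isIrreducible_iff : ρ.IsIrreducible ↔ Nontrivial V ∧
    ∀ N : Submodule K V, (∀ g, ∀ v ∈ N, ρ g v ∈ N) → N = ⊥ ∨ N = ⊤ := by
  constructor
  · intro h
    refine ⟨?_, fun N hN => ?_⟩
    · by_contra hV
      rw [not_nontrivial_iff_subsingleton] at hV
      have : (⊥ : Subrepresentation ρ) = ⊤ :=
        Subrepresentation.toSubmodule_injective (Subsingleton.elim _ _)
      exact bot_ne_top this
    · rcases eq_bot_or_eq_top (⟨N, hN⟩ : Subrepresentation ρ) with h | h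
      · left; exact congrArg Subrepresentation.toSubmodule h
      · right; exact congrArg Subrepresentation.toSubmodule h
  · rintro ⟨hV, h⟩
    refine { exists_pair_ne := ⟨⊥, ⊤, fun h => ?_⟩, eq_bot_or_eq_top := fun N => ?_ }
    · have : (⊥ : Submodule K V) = ⊤ := congrArg Subrepresentation.toSubmodule h
      exact bot_ne_top this
    · rcases h N.toSubmodule N.apply_mem_toSubmodule with h | h
      · left; exact Subrepresentation.toSubmodule_injective h
      · right; exact Subrepresentation.toSubmodule_injective h

theorem span_orbit_eq_top (h : ρ.IsIrreducible) {v : V} (hv : v ≠ 0) :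
    Submodule.span K (Set.range fun g => ρ g v) = ⊤ := by
  refine ((isIrreducible_iff.mp h).2 _ fun g w hw => ?_).resolve_left fun hbot => hv ?_
  · induction hw using Submodule.span_induction with
    | mem w hw =>
      obtain ⟨h, rfl⟩ := hw
      refine Submodule.subset_span ⟨g * h, ?_⟩
      simp
    | zero => simp
    | add x y _ _ hx hy =>
      rw [map_add]
      exact Submodule.add_mem _ hx hy
    | smul c x _ hx =>
      rw [map_smul]
      exact Submodule.smul_mem _ c hx
  · have : ρ 1 v ∈ Submodule.span K (Set.range fun g => ρ g v) := Submodule.subset_span ⟨1, rfl⟩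
    rw [hbot] at this
    simpa using this

/-- The map sending `v` to its matrix coefficients against `ψ`. -/
def matrixCoeff (ρ : Representation K G V) (ψ : Module.Dual K V) : V →ₗ[K] (G → K) where
  toFun v g := ψ (ρ g v)
  map_add' v w := by ext g; simp
  map_smul' c v := by ext g; simp

theorem matrixCoeff_apply (ψ : Module.Dual K V) (v : V) (g : G) :
    matrixCoeff ρ ψ v g = ψ (ρ g v) := rfl

theorem matrixCoeff_injective (h : ρ.IsIrreducible) {ψ : Module.Dual K V} (hψ : ψ ≠ 0) :
    Function.Injective (matrixCoeff ρ ψ) := by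
  rw [← LinearMap.ker_eq_bot]
  refine ((isIrreducible_iff.mp h).2 _ fun g w hw => ?_).resolve_right fun htop => hψ ?_
  · rw [LinearMap.mem_ker] at hw ⊢
    funext g'
    have := congrFun hw (g' * g)
    simpa [matrixCoeff_apply] using this
  · ext v
    have hv : v ∈ LinearMap.ker (matrixCoeff ρ ψ) := by rw [htop]; trivial
    have := congrFun (LinearMap.mem_ker.mp hv) 1
    simpa [matrixCoeff_apply] using this

/-- The orbit of `v` spans, so the range is spanned by the right translates of the single function
`g ↦ ψ (ρ g v)`. -/
theorem range_matrixCoeff (h : ρ.IsIrreducible) (ψ : Module.Dual K V) {v : V} (hv : v ≠ 0) :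
    LinearMap.range (matrixCoeff ρ ψ) =
      Submodule.span K (Set.range fun h : G => fun g => ψ (ρ (g * h) v)) := by
  rw [LinearMap.range_eq_map, ← span_orbit_eq_top h hv, Submodule.map_span, ← Set.range_comp]
  congr 1
  refine congrArg Set.range ?_
  funext h g
  simp [matrixCoeff_apply]

/-- Irreducible representations sharing a nonzero matrix coefficient have the same character. -/
theorem trace_eq_of_matrixCoeff_eq {W : Type*} [AddCommGroup W] [Module K W]
    {ρ' : Representation K G W} (h : ρ.IsIrreducible) (h' : ρ'.IsIrreducible)
    {ψ : Module.Dual K V} {ψ' : Module.Dual K W} {v : V} {w : W} (hv : ψ v ≠ 0) (hw : ψ' w ≠ 0)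
    (heq : ∀ g, ψ (ρ g v) = ψ' (ρ' g w)) (g : G) :
    LinearMap.trace K V (ρ g) = LinearMap.trace K W (ρ' g) := by
  have hψ : ψ ≠ 0 := by rintro rfl; simp at hv
  have hψ' : ψ' ≠ 0 := by rintro rfl; simp at hw
  have hv0 : v ≠ 0 := by rintro rfl; simp at hv
  have hw0 : w ≠ 0 := by rintro rfl; simp at hw
  have hinj := matrixCoeff_injective h hψ
  have hinj' := matrixCoeff_injective h' hψ'
  have hrange : LinearMap.range (matrixCoeff ρ ψ) = LinearMap.range (matrixCoeff ρ' ψ') := by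
    rw [range_matrixCoeff h ψ hv0, range_matrixCoeff h' ψ' hw0]
    simp only [heq]
  -- Both spaces embed with the same image into the functions on `G`, where `G` acts by right
  -- translation; the resulting isomorphism is therefore equivariant.
  set e : V ≃ₗ[K] W := (LinearEquiv.ofInjective _ hinj).trans
    ((LinearEquiv.ofEq _ _ hrange).trans (LinearEquiv.ofInjective _ hinj').symm) with he
  have hcoeff : ∀ u, matrixCoeff ρ' ψ' (e u) = matrixCoeff ρ ψ u := by
    intro u
    have : LinearEquiv.ofInjective _ hinj' (e u) =
        LinearEquiv.ofEq _ _ hrange (LinearEquiv.ofInjective _ hinj u) := by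
      simp [he]
    have := congrArg Subtype.val this
    simpa using this
  have hequiv : ∀ u, e (ρ g u) = ρ' g (e u) := by
    intro u
    apply hinj'
    rw [hcoeff]
    funext g'
    have := congrFun (hcoeff u) (g' * g)
    simpa [matrixCoeff_apply] using this.symm
  have hconj : ρ' g = e.conj (ρ g) := by
    ext u
    rw [LinearEquiv.conj_apply_apply, hequiv, LinearEquiv.apply_symm_apply]
  rw [hconj, LinearMap.trace_conj']

end Irreducible

/-! ### Highest weights determine characters. -/

section HighestWeight

variable {K : Type*} [Field K] [CharZero K] {m : ℕ} {V : Type*} [AddCommGroup V] [Module K V]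
  {i : K} {hi : i ^ 2 = -1} {ρ : Representation K (SO m K) V}

theorem root_mem_positiveRoots {j k : Fin m} (h : j < k) (δ : ℤˣ) :
    (Pi.single j 1 + Pi.single k (δ : ℤ) : Fin m → ℤ) ∈ positiveRoots m := by
  refine ⟨j, k, h, ?_⟩
  rcases Int.units_eq_one_or δ with rfl | rfl
  · right; simp
  · left
    simp [sub_eq_add_neg, Pi.single_neg]

/-- No weight of `ρ` is obtained from `lam` by adding a multiple of a positive root. -/
def IsMaximalWeight (i : K) (hi : i ^ 2 = -1) (ρ : Representation K (SO m K) V)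
    (lam : Fin m → ℤ) : Prop :=
  ∀ α ∈ positiveRoots m, ∀ k : ℕ, ¬ IsWeight i hi ρ (lam + (k + 1) • α)

/-- A linear form positive on the positive roots. -/
def rootHeight (m : ℕ) : (Fin m → ℤ) →+ ℤ where
  toFun ν := ∑ j : Fin m, ((m : ℤ) - j) * ν j
  map_zero' := by simp
  map_add' ν μ := by simp [mul_add, Finset.sum_add_distrib]

theorem rootHeight_single (j : Fin m) (a : ℤ) :
    rootHeight m (Pi.single j a) = ((m : ℤ) - j) * a := by
  simp [rootHeight, Pi.single_apply]

theorem rootHeight_pos {α : Fin m → ℤ} (h : α ∈ positiveRoots m) : 0 < rootHeight m α := by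
  obtain ⟨j, k, hjk, rfl | rfl⟩ := h
  · rw [map_sub, rootHeight_single, rootHeight_single]
    have := Fin.lt_def.mp hjk
    omega
  · rw [map_add, rootHeight_single, rootHeight_single]
    have := j.2
    have := k.2
    omega

theorem rootHeight_nonneg {β : Fin m → ℤ} (h : β ∈ AddSubmonoid.closure (positiveRoots m)) :
    0 ≤ rootHeight m β := by
  induction h using AddSubmonoid.closure_induction with
  | mem α h => exact (rootHeight_pos h).le
  | zero => simp
  | add x y _ _ hx hy => rw [map_add]; exact add_nonneg hx hy

/-- A weight `lam + (k + 1) • α` would put `-(k + 1) • α` into the cone of positive roots, where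
heights are nonnegative. -/
theorem IsHighestWeight.isMaximalWeight {lam : Fin m → ℤ} (h : IsHighestWeight i hi ρ lam) :
    IsMaximalWeight i hi ρ lam := by
  intro α hα k hw
  have h1 := rootHeight_nonneg (h.2 _ hw)
  rw [sub_add_cancel_left, map_neg, map_nsmul, nsmul_eq_mul] at h1
  have h2 := rootHeight_pos hα
  push_cast at h1
  nlinarith

theorem neg_root {j k : Fin m} (δ : ℤˣ) : (Pi.single j ((-1 : ℤˣ) : ℤ) + Pi.single k (δ : ℤ) :
    Fin m → ℤ) = -(Pi.single j 1 + Pi.single k ((-δ : ℤˣ) : ℤ)) := by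
  simp [Pi.single_neg, add_comm]

variable [FiniteDimensional K V]

theorem rootElement_expansion (hρ : IsRational ρ) {j k : Fin m} (h : j ≠ k) (δ δ' : ℤˣ)
    {μ : Fin m → ℤ} {v : V} (hv : v ∈ weightSpace i hi ρ μ) (s : K) :
    ∃ (N : ℕ) (c : ℕ → V), (∀ l < N, c l ∈ weightSpace i hi ρ
        (μ + (l + 1) • (Pi.single j (δ : ℤ) + Pi.single k (δ' : ℤ)))) ∧
      ρ (rootElement hi h δ δ' s) v = v + ∑ l ∈ Finset.range N, s ^ (l + 1) • c l := by
  obtain ⟨N, c, hc, hs⟩ := root_expansion hρ (rootElement hi h δ δ') (rootElement_curve hi h δ δ')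
    (rootElement_zero hi h δ δ') _ (torusElement_mul_rootElement hi h δ δ') hv
  exact ⟨N, c, hc, hs s⟩

/-- All further terms of the root expansion have weights excluded by maximality. -/
theorem IsMaximalWeight.rootElement_apply {lam : Fin m → ℤ} (h : IsMaximalWeight i hi ρ lam)
    (hρ : IsRational ρ) {v : V} (hv : v ∈ weightSpace i hi ρ lam) {j k : Fin m} (hjk : j < k)
    (δ : ℤˣ) (s : K) : ρ (rootElement hi hjk.ne 1 δ s) v = v := by
  obtain ⟨N, c, hc, hs⟩ := rootElement_expansion hρ hjk.ne 1 δ hv s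
  rw [hs, Finset.sum_eq_zero, add_zero]
  intro l hl
  rw [eq_zero_of_not_isWeight (hc l (Finset.mem_range.mp hl))
    (h _ (root_mem_positiveRoots hjk δ) l), smul_zero]

theorem weight_induction (hρ : IsRational ρ) {P : V → Prop}
    (h : ∀ ν, ∀ v ∈ weightSpace i hi ρ ν, P v) (hadd : ∀ v w, P v → P w → P (v + w)) (v : V) :
    P v := by
  have hv : v ∈ ⨆ ν, weightSpace i hi ρ ν := by
    rw [iSup_weightSpace_eq_top hρ]
    trivial
  exact Submodule.iSup_induction _ (motive := P) hv h (h 0 0 (Submodule.zero_mem _)) hadd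

/-- A linear form of weight `lam` which is invariant under the negative root subgroups. -/
theorem IsMaximalWeight.exists_dual {lam : Fin m → ℤ} (h : IsMaximalWeight i hi ρ lam)
    (hρ : IsRational ρ) {v : V} (hv : v ∈ weightSpace i hi ρ lam) (hv0 : v ≠ 0) :
    ∃ ψ : Module.Dual K V, ψ v = 1 ∧
      (∀ x w, ψ (ρ (torusElement i hi x) w) = torusChar K lam x * ψ w) ∧
      ∀ j k (hjk : j < k) δ s w, ψ (ρ (rootElement hi hjk.ne (-1) δ s) w) = ψ w := by
  have hnot : v ∉ ⨆ ν ∈ ({lam}ᶜ : Set (Fin m → ℤ)), weightSpace i hi ρ ν := fun hmem =>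
    hv0 (weightSpace_disjoint (by simp) hv hmem)
  -- `ψ₀` kills every weight space except that of `lam` and does not kill `v`.
  obtain ⟨ψ₀, hψ₀, hker⟩ := Submodule.exists_le_ker_of_notMem hnot
  have hzero : ∀ ν ≠ lam, ∀ w ∈ weightSpace i hi ρ ν, ψ₀ w = 0 := by
    intro ν hν w hw
    have : w ∈ ⨆ ν ∈ ({lam}ᶜ : Set (Fin m → ℤ)), weightSpace i hi ρ ν :=
      Submodule.mem_iSup_of_mem ν (Submodule.mem_iSup_of_mem (by simpa using hν) hw)
    exact hker this
  refine ⟨(ψ₀ v)⁻¹ • ψ₀, by simp [hψ₀], fun x w => ?_, fun j k hjk δ s w => ?_⟩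
  · refine weight_induction (i := i) (hi := hi) hρ (P := fun w =>
      ((ψ₀ v)⁻¹ • ψ₀) (ρ (torusElement i hi x) w) = torusChar K lam x * ((ψ₀ v)⁻¹ • ψ₀) w) ?_ ?_ w
    · intro ν w hw
      rw [hw x]
      by_cases hν : ν = lam
      · subst hν
        simp
      · simp [hzero ν hν w hw]
    · intro u w hu hw
      rw [map_add, map_add, map_add, hu, hw, mul_add]
  · refine weight_induction (i := i) (hi := hi) hρ (P := fun w =>
      ((ψ₀ v)⁻¹ • ψ₀) (ρ (rootElement hi hjk.ne (-1) δ s) w) = ((ψ₀ v)⁻¹ • ψ₀) w) ?_ ?_ w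
    · intro ν w hw
      by_cases hw0 : w = 0
      · simp [hw0]
      obtain ⟨N, c, hc, hs⟩ := rootElement_expansion hρ hjk.ne (-1) δ hw s
      have hsum : ψ₀ (∑ l ∈ Finset.range N, s ^ (l + 1) • c l) = 0 := by
        rw [map_sum]
        refine Finset.sum_eq_zero fun l hl => ?_
        rw [map_smul, hzero _ ?_ _ (hc l (Finset.mem_range.mp hl)), smul_zero]
        -- A term of weight `lam` would make the weight of `w` equal to `lam` plus a positive
        -- multiple of a positive root, against maximality.
        intro heq
        refine h _ (root_mem_positiveRoots hjk (-δ)) l (isWeight_iff.mpr ⟨w, ?_, hw0⟩)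
        rw [← heq, neg_root, smul_neg, neg_add_cancel_right]
        exact hw
      rw [hs, map_add, LinearMap.smul_apply _ _ (∑ l ∈ Finset.range N, s ^ (l + 1) • c l), hsum,
        smul_zero, add_zero]
    · intro u w hu hw
      rw [map_add, map_add, map_add, hu, hw]

/-- Irreducible rational representations with the same maximal weight have the same character. -/
theorem trace_eq_of_isMaximalWeight {W : Type*} [AddCommGroup W] [Module K W]
    [FiniteDimensional K W] {ρ' : Representation K (SO m K) W} (hρ : IsRational ρ)
    (hρ' : IsRational ρ') (hirr : ρ.IsIrreducible) (hirr' : ρ'.IsIrreducible) {lam : Fin m → ℤ}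
    (h : IsMaximalWeight i hi ρ lam) (h' : IsMaximalWeight i hi ρ' lam)
    (hw : IsWeight i hi ρ lam) (hw' : IsWeight i hi ρ' lam) (g : SO m K) :
    LinearMap.trace K V (ρ g) = LinearMap.trace K W (ρ' g) := by
  obtain ⟨v, hv, hv0⟩ := isWeight_iff.mp hw
  obtain ⟨w, hw, hw0⟩ := isWeight_iff.mp hw'
  obtain ⟨ψ, hψv, hψT, hψU⟩ := h.exists_dual hρ hv hv0
  obtain ⟨ψ', hψv', hψT', hψU'⟩ := h'.exists_dual hρ' hw hw0
  refine trace_eq_of_matrixCoeff_eq hirr hirr' (ψ := ψ) (ψ' := ψ') (v := v) (w := w)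
    (by simp [hψv]) (by simp [hψv']) (fun g => ?_) g
  -- Negative root groups are absorbed by `ψ` and `ψ'`, positive ones by `v` and `w`, and the torus
  -- scales both coefficients by the same character.
  refine zariskiClosed_eq_univ hi (S := {g | ψ (ρ g v) = ψ' (ρ' g w)}) ?_ ?_ ?_ ?_ ?_ g
  · intro g hg
    obtain ⟨p, hp⟩ := hρ ψ v
    obtain ⟨p', hp'⟩ := hρ' ψ' w
    refine ⟨p - p', fun h hh => ?_, ?_⟩
    · rw [map_sub, ← hp, ← hp', sub_eq_zero]
      exact hh
    · rw [map_sub, ← hp, ← hp', sub_ne_zero]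
      exact hg
  · simp [hψv, hψv']
  · intro x g hg
    simp only [Set.mem_ofPred_eq, map_mul, Module.End.mul_apply, hψT, hψT'] at hg ⊢
    rw [hg]
  · intro j l hjl δ s g hg
    simp only [Set.mem_ofPred_eq, map_mul, Module.End.mul_apply] at hg ⊢
    rw [hψU j l hjl, hψU' j l hjl, hg]
  · intro j l hjl δ s g hg
    simp only [Set.mem_ofPred_eq, map_mul, Module.End.mul_apply] at hg ⊢
    rw [h.rootElement_apply hρ hv hjl, h'.rootElement_apply hρ' hw hjl, hg]

/-- In an irreducible rational representation, the weight of a vector fixed by the positive root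
subgroups is the highest weight. -/
theorem isHighestWeight_of_fixed (hρ : IsRational ρ) (hirr : ρ.IsIrreducible) {lam : Fin m → ℤ}
    {v : V} (hv : v ∈ weightSpace i hi ρ lam) (hv0 : v ≠ 0)
    (hfix : ∀ j k (hjk : j < k) δ s, ρ (rootElement hi hjk.ne 1 δ s) v = v) :
    IsHighestWeight i hi ρ lam := by
  refine ⟨isWeight_iff.mpr ⟨v, hv, hv0⟩, fun ν hν => ?_⟩
  set B : Set (Fin m → ℤ) := {ν | lam - ν ∈ AddSubmonoid.closure (positiveRoots m)} with hB
  set N : Submodule K V := ⨆ ν ∈ B, weightSpace i hi ρ ν with hN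
  have hmem : ∀ ν ∈ B, ∀ w ∈ weightSpace i hi ρ ν, w ∈ N := fun ν hν w hw =>
    Submodule.mem_iSup_of_mem ν (Submodule.mem_iSup_of_mem hν hw)
  have hind : ∀ L : V →ₗ[K] V, (∀ ν ∈ B, ∀ w ∈ weightSpace i hi ρ ν, L w ∈ N) →
      ∀ w ∈ N, L w ∈ N := by
    intro L hL
    have : N ≤ N.comap L := iSup₂_le fun ν hν w hw => hL ν hν w hw
    exact this
  -- The condition is closed. The torus preserves `N`, negative root groups only lower weights, and
  -- positive ones fix `v`. Irreducibility then makes `N` the whole space.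
  have hall : ∀ g, ρ g v ∈ N := by
    refine zariskiClosed_eq_univ hi (S := {g | ρ g v ∈ N}) ?_ ?_ ?_ ?_ ?_
    · intro g hg
      obtain ⟨ψ, hψ, hker⟩ := Submodule.exists_le_ker_of_notMem (p := N) (v := ρ g v) hg
      obtain ⟨p, hp⟩ := hρ ψ v
      refine ⟨p, fun h hh => ?_, ?_⟩
      · rw [← hp]
        exact hker hh
      · rw [← hp]
        exact hψ
    · simp only [Set.mem_ofPred_eq, map_one, Module.End.one_apply]
      refine hmem lam ?_ v hv
      simp [hB]
    · intro x g hg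
      simp only [Set.mem_ofPred_eq, map_mul, Module.End.mul_apply] at hg ⊢
      refine hind _ (fun ν hν w hw => ?_) _ hg
      rw [hw x]
      exact Submodule.smul_mem _ _ (hmem ν hν w hw)
    · intro j l hjl δ s g hg
      simp only [Set.mem_ofPred_eq, map_mul, Module.End.mul_apply] at hg ⊢
      refine hind _ (fun ν hν w hw => ?_) _ hg
      obtain ⟨n, c, hc, hs⟩ := rootElement_expansion hρ hjl.ne (-1) δ hw s
      rw [hs]
      refine Submodule.add_mem _ (hmem ν hν w hw) (Submodule.sum_mem _ fun k hk =>
        Submodule.smul_mem _ _ (hmem _ ?_ _ (hc k (Finset.mem_range.mp hk))))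
      simp only [hB, Set.mem_ofPred_eq] at hν ⊢
      rw [neg_root, smul_neg, ← sub_eq_add_neg, ← sub_add]
      exact add_mem hν (nsmul_mem (AddSubmonoid.subset_closure
        (root_mem_positiveRoots hjl (-δ))) _)
    · intro j l hjl δ s g hg
      simp only [Set.mem_ofPred_eq, map_mul, Module.End.mul_apply] at hg ⊢
      rwa [hfix j l hjl]
  have htop : N = ⊤ := by
    rw [eq_top_iff, ← span_orbit_eq_top hirr hv0, Submodule.span_le]
    rintro _ ⟨g, rfl⟩
    exact hall g
  by_contra hνB
  obtain ⟨w, hw, hw0⟩ := isWeight_iff.mp hν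
  exact hw0 (weightSpace_disjoint (B := B) hνB hw (by rw [← hN, htop]; trivial))

end HighestWeight

/-! ### The Levi-Civita symbol. -/

section LeviCivita

variable {K : Type*} [Field K] {ι : Type*} [Fintype ι] [DecidableEq ι]

/-- The Levi-Civita symbol of a self-map of `ι`. -/
def levi (K : Type*) [Field K] {ι : Type*} [Fintype ι] [DecidableEq ι] (f : ι → ι) : K :=
  ((1 : Matrix ι ι K).submatrix f id).det

theorem levi_eq_zero {f : ι → ι} (hf : ¬ Function.Injective f) : levi K f = 0 := by
  simp only [Function.Injective, not_forall] at hf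
  obtain ⟨p, q, hpq, hne⟩ := hf
  refine Matrix.det_zero_of_row_eq hne ?_
  ext r
  rw [Matrix.submatrix_apply, Matrix.submatrix_apply, hpq]

theorem levi_comp_perm (f : ι → ι) (σ : Equiv.Perm ι) :
    levi K (f ∘ σ) = ((Equiv.Perm.sign σ : ℤ) : K) * levi K f := by
  rw [levi, levi, ← Matrix.det_permute, Matrix.submatrix_submatrix]
  rfl

theorem levi_perm (σ : Equiv.Perm ι) : levi K σ = ((Equiv.Perm.sign σ : ℤ) : K) := by
  rw [levi, Matrix.det_permute, Matrix.det_one, mul_one]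

theorem levi_mul_self {f : ι → ι} (hf : Function.Injective f) : levi K f * levi K f = 1 := by
  obtain ⟨σ, rfl⟩ : ∃ σ : Equiv.Perm ι, (σ : ι → ι) = f :=
    ⟨Equiv.ofBijective f (Finite.injective_iff_bijective.mp hf), rfl⟩
  rw [levi_perm]
  exact units_cast_mul_self _

theorem sum_levi_mul (F : (ι → ι) → K) :
    ∑ f : ι → ι, levi K f * F f =
      ∑ σ : Equiv.Perm ι, ((Equiv.Perm.sign σ : ℤ) : K) * F σ := by
  rw [← sum_perm_eq_sum_fun (fun f : ι → ι => levi K f * F f)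
    fun f hf => by rw [levi_eq_zero hf, zero_mul]]
  simp only [levi_perm]

/-- Both sides are the determinant of the matrix whose row `p` is row `f p` of `A`. -/
theorem sum_levi_mul_prod (A : Matrix ι ι K) (f : ι → ι) :
    ∑ h : ι → ι, levi K h * ∏ p, A (f p) (h p) = levi K f * A.det := by
  rw [sum_levi_mul (fun h => ∏ p, A (f p) (h p)), levi, ← Matrix.det_mul,
    ← Matrix.det_transpose, Matrix.det_apply']
  refine Finset.sum_congr rfl fun σ _ => ?_
  congr 1
  refine Finset.prod_congr rfl fun p _ => ?_
  simp [Matrix.mul_apply, Matrix.one_apply]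

end LeviCivita

/-! ### Interleaved multi-indices and complements. -/

section Interleave

variable {m : ℕ} {α : Type*}

/-- The sequence `a₀, b₀, a₁, b₁, …`. -/
def interleave : (Fin m → α) × (Fin m → α) ≃ (Fin (2 * m) → α) where
  toFun ab p := if (pairIdx.symm p).2 = 0 then ab.1 (pairIdx.symm p).1 else ab.2 (pairIdx.symm p).1
  invFun f := (fun j => f (pairIdx (j, 0)), fun j => f (pairIdx (j, 1)))
  left_inv ab := by simp
  right_inv f := pairIdx_ext fun j a => by
    fin_cases a <;> simp

@[simp] theorem interleave_zero (a b : Fin m → α) (j : Fin m) :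
    interleave (a, b) (pairIdx (j, 0)) = a j := by simp [interleave]

@[simp] theorem interleave_one (a b : Fin m → α) (j : Fin m) :
    interleave (a, b) (pairIdx (j, 1)) = b j := by simp [interleave]

/-- The permutation of `Fin (2 * m)` acting by `π` on the first members of the pairs and by `π'`
on the second members. -/
def slotPerm (π π' : Equiv.Perm (Fin m)) : Equiv.Perm (Fin (2 * m)) :=
  pairIdx.permCongr (Equiv.prodCongrLeft ![π, π'])

theorem interleave_comp_perm (a b : Fin m → α) (π π' : Equiv.Perm (Fin m)) :
    interleave (a ∘ π, b ∘ π') = interleave (a, b) ∘ slotPerm π π' := by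
  refine pairIdx_ext fun j c => ?_
  fin_cases c <;> simp [slotPerm, Equiv.permCongr_apply]

theorem sign_slotPerm (π π' : Equiv.Perm (Fin m)) :
    Equiv.Perm.sign (slotPerm π π') = Equiv.Perm.sign π * Equiv.Perm.sign π' := by
  rw [slotPerm, Equiv.Perm.sign_permCongr, Equiv.Perm.sign_prodCongrLeft]
  simp [Fin.prod_univ_two]

theorem interleave_swap (a b : Fin m → α) :
    interleave (b, a) = interleave (a, b) ∘ withinPerm fun _ => Equiv.swap 0 1 := by
  refine pairIdx_ext fun j c => ?_
  fin_cases c <;> simp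

theorem interleave_injective_iff {a b : Fin m → α} : Function.Injective (interleave (a, b)) ↔
    Function.Injective a ∧ Function.Injective b ∧ ∀ j k, a j ≠ b k := by
  constructor
  · intro h
    refine ⟨fun j k hjk => ?_, fun j k hjk => ?_, fun j k hjk => ?_⟩
    · have := @h (pairIdx (j, 0)) (pairIdx (k, 0)) (by simpa using hjk)
      simpa using this
    · have := @h (pairIdx (j, 1)) (pairIdx (k, 1)) (by simpa using hjk)
      simpa using this
    · have := @h (pairIdx (j, 0)) (pairIdx (k, 1)) (by simpa using hjk)
      simp at this
  · rintro ⟨ha, hb, hab⟩ p q hpq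
    obtain ⟨⟨j, c⟩, rfl⟩ := pairIdx.surjective p
    obtain ⟨⟨k, d⟩, rfl⟩ := pairIdx.surjective q
    fin_cases c <;> fin_cases d <;> simp at hpq ⊢
    · exact ha hpq
    · exact hab _ _ hpq
    · exact hab _ _ hpq.symm
    · exact hb hpq

theorem interleave_injective_swap {a b : Fin m → α} :
    Function.Injective (interleave (a, b)) ↔ Function.Injective (interleave (b, a)) := by
  simp only [interleave_injective_iff, ne_comm (a := a _)]
  tauto

/-- Both `b` and `b'` enumerate the complement of the range of `a`. -/
theorem exists_perm_of_interleave {a b b' : Fin m → Fin (2 * m)}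
    (h : Function.Injective (interleave (a, b))) (h' : Function.Injective (interleave (a, b'))) :
    ∃ π : Equiv.Perm (Fin m), b' = b ∘ π := by
  have hs := Finite.injective_iff_surjective.mp h
  have key : ∀ j, ∃ k, b k = b' j := by
    intro j
    obtain ⟨p, hp⟩ := hs (b' j)
    obtain ⟨⟨k, c⟩, rfl⟩ := pairIdx.surjective p
    fin_cases c
    · simp at hp
      exact absurd hp ((interleave_injective_iff.mp h').2.2 k j)
    · exact ⟨k, by simpa using hp⟩
  choose π hπ using key
  have hinj : Function.Injective π := by
    intro j k hjk
    apply (interleave_injective_iff.mp h').2.1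
    rw [← hπ, ← hπ, hjk]
  refine ⟨Equiv.ofBijective π (Finite.injective_iff_bijective.mp hinj), ?_⟩
  funext j
  exact (hπ j).symm

/-- The bijection from the first members of the pairs to the range of `a` extends to a permutation;
its values on the second members enumerate the complement. -/
theorem exists_complement {a : Fin m → Fin (2 * m)} (ha : Function.Injective a) :
    ∃ b, Function.Injective (interleave (a, b)) := by
  classical
  set e : {p : Fin (2 * m) // p ∈ Set.range fun j : Fin m => pairIdx (j, (0 : Fin 2))} ≃
      {p : Fin (2 * m) // p ∈ Set.range a} :=
    (Equiv.ofInjective (fun j : Fin m => pairIdx (j, (0 : Fin 2))) (fun j k h => by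
      simpa using h)).symm.trans (Equiv.ofInjective a ha) with he
  refine ⟨fun j => e.extendSubtype (pairIdx (j, 1)), ?_⟩
  have : interleave (a, fun j => e.extendSubtype (pairIdx (j, 1))) = e.extendSubtype := by
    refine pairIdx_ext fun j c => ?_
    fin_cases c
    · simp only [Fin.zero_eta, interleave_zero]
      rw [Equiv.extendSubtype_apply_of_mem e _ ⟨j, rfl⟩]
      have : e ⟨pairIdx (j, 0), ⟨j, rfl⟩⟩ = Equiv.ofInjective a ha j := by
        rw [he, Equiv.trans_apply]
        congr 1
        rw [Equiv.symm_apply_eq]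
        rfl
      rw [this]
      rfl
    · simp
  rw [this]
  exact Equiv.injective _

variable {K : Type*} [Field K]

theorem levi_interleave_comp (a b : Fin m → Fin (2 * m)) (π π' : Equiv.Perm (Fin m)) :
    levi K (interleave (a ∘ π, b ∘ π')) = ((Equiv.Perm.sign π : ℤ) : K) *
      ((Equiv.Perm.sign π' : ℤ) : K) * levi K (interleave (a, b)) := by
  rw [interleave_comp_perm, levi_comp_perm, sign_slotPerm]
  push_cast
  rfl

theorem levi_interleave_swap (a b : Fin m → Fin (2 * m)) :
    levi K (interleave (b, a)) = (-1) ^ m * levi K (interleave (a, b)) := by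
  rw [interleave_swap, levi_comp_perm, sign_withinPerm]
  simp

end Interleave

/-! ### The Hodge star on tensors. -/

section Star

variable {K : Type*} [Field K] {m : ℕ}

open Matrix

/-- The action of a matrix on the tensors of degree `m`, in coordinates. -/
def tensorMatrix (g : Matrix (Fin (2 * m)) (Fin (2 * m)) K) :
    Matrix (Fin m → Fin (2 * m)) (Fin m → Fin (2 * m)) K :=
  Matrix.of fun a b => ∏ j, g (a j) (b j)

theorem tensorMatrix_apply (g : Matrix (Fin (2 * m)) (Fin (2 * m)) K) (a b : Fin m → Fin (2 * m)) :
    tensorMatrix g a b = ∏ j, g (a j) (b j) := rfl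

theorem tensorMatrix_one : tensorMatrix (1 : Matrix (Fin (2 * m)) (Fin (2 * m)) K) = 1 := by
  ext a b
  rw [tensorMatrix_apply, Matrix.one_apply]
  split_ifs with h
  · subst h; simp
  · obtain ⟨j, hj⟩ := Function.ne_iff.mp h
    exact Finset.prod_eq_zero (Finset.mem_univ j) (by simp [hj])

theorem tensorMatrix_mul (g h : Matrix (Fin (2 * m)) (Fin (2 * m)) K) :
    tensorMatrix (g * h) = tensorMatrix g * tensorMatrix h := by
  ext a b
  simp only [tensorMatrix_apply, Matrix.mul_apply, ← Finset.prod_mul_distrib,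
    Finset.prod_univ_sum, Fintype.piFinset_univ]

theorem tensorMatrix_transpose (g : Matrix (Fin (2 * m)) (Fin (2 * m)) K) :
    tensorMatrix gᵀ = (tensorMatrix g)ᵀ := rfl

/-- The Hodge star operator, extended by zero to all tensors of degree `m`. -/
def starMatrix (K : Type*) [Field K] (m : ℕ) :
    Matrix (Fin m → Fin (2 * m)) (Fin m → Fin (2 * m)) K :=
  Matrix.of fun a b => (m ! : K)⁻¹ * levi K (interleave (a, b))

theorem starMatrix_apply (a b : Fin m → Fin (2 * m)) :
    starMatrix K m a b = (m ! : K)⁻¹ * levi K (interleave (a, b)) := rfl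

theorem sum_interleave {M : Type*} [AddCommMonoid M] (F : (Fin (2 * m) → Fin (2 * m)) → M) :
    ∑ a : Fin m → Fin (2 * m), ∑ b : Fin m → Fin (2 * m), F (interleave (a, b)) = ∑ f, F f := by
  rw [← interleave.sum_comp, Fintype.sum_prod_type]

/-- The volume form is scaled by the determinant: entrywise this is `sum_levi_mul_prod` at the
interleaving of `a` and `b`. -/
theorem tensorMatrix_conj_starMatrix (g : Matrix (Fin (2 * m)) (Fin (2 * m)) K) :
    tensorMatrix g * starMatrix K m * (tensorMatrix g)ᵀ = g.det • starMatrix K m := by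
  ext a b
  have h := sum_levi_mul_prod g (interleave (a, b))
  rw [← sum_interleave] at h
  simp only [prod_pairIdx, interleave_zero, interleave_one] at h
  rw [Matrix.smul_apply, starMatrix_apply, smul_eq_mul, mul_left_comm, mul_comm g.det, ← h,
    Matrix.mul_assoc, Matrix.mul_apply, Finset.mul_sum]
  refine Finset.sum_congr rfl fun a' _ => ?_
  rw [Matrix.mul_apply, Finset.mul_sum, Finset.mul_sum]
  refine Finset.sum_congr rfl fun b' _ => ?_
  simp only [tensorMatrix_apply, Matrix.transpose_apply, starMatrix_apply, Finset.prod_mul_distrib]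
  ring

/-- For determinant `1` the conjugation formula has no factor, and for orthogonal `g` the transpose
on its right is the inverse. -/
theorem tensorMatrix_comm_starMatrix (g : SO m K) :
    tensorMatrix g.1 * starMatrix K m = starMatrix K m * tensorMatrix g.1 := by
  have h := tensorMatrix_conj_starMatrix g.1
  rw [(mem_SO_iff.mp g.2).2, one_smul] at h
  have h2 : (tensorMatrix g.1)ᵀ * tensorMatrix g.1 = 1 := by
    rw [← tensorMatrix_transpose, ← tensorMatrix_mul, so_transpose_mul, tensorMatrix_one]
  calc tensorMatrix g.1 * starMatrix K m
      = tensorMatrix g.1 * starMatrix K m * ((tensorMatrix g.1)ᵀ * tensorMatrix g.1) := by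
        rw [h2, Matrix.mul_one]
    _ = starMatrix K m * tensorMatrix g.1 := by rw [← Matrix.mul_assoc, h]

theorem starMatrix_eq_zero {a b : Fin m → Fin (2 * m)}
    (h : ¬ Function.Injective (interleave (a, b))) : starMatrix K m a b = 0 := by
  rw [starMatrix_apply, levi_eq_zero h, mul_zero]

theorem sum_complements (a b : Fin m → Fin (2 * m)) (h : Function.Injective (interleave (a, b)))
    (F : (Fin m → Fin (2 * m)) → K) :
    ∑ b', levi K (interleave (a, b')) * F b' = levi K (interleave (a, b)) *
      ∑ π : Equiv.Perm (Fin m), ((Equiv.Perm.sign π : ℤ) : K) * F (b ∘ π) := by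
  rw [Finset.mul_sum]
  symm
  refine Finset.sum_of_injOn (fun π : Equiv.Perm (Fin m) => b ∘ π) ?_ (by simp) ?_ ?_
  · intro π _ π' _ hπ
    ext j
    exact congrArg Fin.val ((interleave_injective_iff.mp h).2.1 (congrFun hπ j))
  · intro b' _ hb'
    rw [levi_eq_zero, zero_mul]
    intro hinj
    obtain ⟨π, rfl⟩ := exists_perm_of_interleave h hinj
    exact hb' ⟨π, by simp, rfl⟩
  · intro π _
    have := levi_interleave_comp (K := K) a b 1 π
    simp only [Equiv.Perm.coe_one, Function.comp_id, Equiv.Perm.sign_one, Units.val_one,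
      Int.cast_one, one_mul] at this
    rw [this]
    ring

variable [CharZero K]

/-- The `m!` arrangements of the complement of `a` contribute equally and cancel one factor `(m
!)⁻¹`. -/
theorem starMatrix_mul_starMatrix {a b : Fin m → Fin (2 * m)}
    (h : Function.Injective (interleave (a, b))) (c : Fin m → Fin (2 * m)) :
    (starMatrix K m * starMatrix K m) a c = levi K (interleave (a, b)) * starMatrix K m b c := by
  rw [Matrix.mul_apply]
  simp only [starMatrix_apply]
  have hm : (m ! : K) ≠ 0 := Nat.cast_ne_zero.mpr m.factorial_ne_zero
  trans (m ! : K)⁻¹ * (m ! : K)⁻¹ *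
    ∑ b', levi K (interleave (a, b')) * levi K (interleave (b', c))
  · rw [Finset.mul_sum]
    exact Finset.sum_congr rfl fun b' _ => by ring
  rw [sum_complements a b h fun b' => levi K (interleave (b', c))]
  have : ∀ π : Equiv.Perm (Fin m), ((Equiv.Perm.sign π : ℤ) : K) * levi K (interleave (b ∘ π, c)) =
      levi K (interleave (b, c)) := by
    intro π
    have := levi_interleave_comp (K := K) b c π 1
    simp only [Equiv.Perm.coe_one, Function.comp_id, Equiv.Perm.sign_one, Units.val_one,
      Int.cast_one, mul_one] at this
    rw [this, ← mul_assoc, units_cast_mul_self, one_mul]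
  simp only [this, Finset.sum_const, Finset.card_univ, Fintype.card_perm, Fintype.card_fin,
    nsmul_eq_mul]
  field_simp

theorem starMatrix_row_eq_zero {a : Fin m → Fin (2 * m)} (h : ¬ Function.Injective a)
    (b : Fin m → Fin (2 * m)) : starMatrix K m a b = 0 :=
  starMatrix_eq_zero fun hinj => h (interleave_injective_iff.mp hinj).1

theorem starMatrix_column_eq_zero {b : Fin m → Fin (2 * m)} (h : ¬ Function.Injective b)
    (a : Fin m → Fin (2 * m)) : starMatrix K m a b = 0 :=
  starMatrix_eq_zero fun hinj => h (interleave_injective_iff.mp hinj).2.1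

/-- The square of the star is `(-1) ^ m` only on alternating tensors, as the star vanishes on a
complement of them. The cube relation holds on all tensors. -/
theorem starMatrix_cube : starMatrix K m * starMatrix K m * starMatrix K m =
    ((-1) ^ m : K) • starMatrix K m := by
  ext a c
  by_cases ha : Function.Injective a
  · obtain ⟨b, hb⟩ := exists_complement ha
    rw [Matrix.mul_apply]
    simp only [starMatrix_mul_starMatrix hb, mul_assoc, ← Finset.mul_sum]
    rw [← Matrix.mul_apply, starMatrix_mul_starMatrix (interleave_injective_swap.mp hb),
      levi_interleave_swap a b, Matrix.smul_apply, smul_eq_mul]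
    linear_combination ((-1) ^ m * starMatrix K m a c) * levi_mul_self (K := K) hb
  · rw [Matrix.mul_assoc, Matrix.mul_apply, Matrix.smul_apply, starMatrix_row_eq_zero ha, smul_zero]
    exact Finset.sum_eq_zero fun b _ => by rw [starMatrix_row_eq_zero ha, zero_mul]

/-- The trace is a sum over pairs of multi-indices `a`, `b`, that is over self-maps of the index
set, weighted by the Levi-Civita symbol of `(b, a)`. Exchanging the two costs `(-1) ^ m` and leaves
the sum of `factorial_mul_Pf`. -/
theorem trace_tensorMatrix_mul_starMatrix (X : Matrix (Fin (2 * m)) (Fin (2 * m)) K) :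
    (tensorMatrix X * starMatrix K m).trace = (-1) ^ m * Pf (X - Xᵀ) := by
  have hm : (m ! : K) ≠ 0 := Nat.cast_ne_zero.mpr m.factorial_ne_zero
  have h := factorial_mul_Pf X
  rw [← sum_levi_mul fun f => ∏ j : Fin m, X (f (pairIdx (j, 0))) (f (pairIdx (j, 1))),
    ← sum_interleave] at h
  simp only [interleave_zero, interleave_one] at h
  have h2 : Pf (X - Xᵀ) = (m ! : K)⁻¹ * ((m ! : K) * Pf (X - Xᵀ)) := by field_simp
  rw [h2, h, Matrix.trace, Finset.mul_sum, Finset.mul_sum]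
  refine Finset.sum_congr rfl fun a _ => ?_
  rw [Matrix.diag_apply, Matrix.mul_apply, Finset.mul_sum, Finset.mul_sum]
  refine Finset.sum_congr rfl fun b _ => ?_
  rw [tensorMatrix_apply, starMatrix_apply, levi_interleave_swap]
  ring

end Star

/-! ### The eigenspaces of the Hodge star and their traces. -/

section HalfSpace

open Matrix

variable {K : Type*} [Field K] [CharZero K] {m : ℕ} {i : K}

/-- The eigenvalues `±(-i) ^ m` of the Hodge star operator on `m`-vectors. -/
def starEigenvalue (i : K) (m : ℕ) (ε : ℤˣ) : K := ((ε : ℤ) : K) * (-i) ^ m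

theorem starEigenvalue_sq (hi : i ^ 2 = -1) (ε : ℤˣ) :
    starEigenvalue i m ε * starEigenvalue i m ε = (-1) ^ m := by
  have h : (-i) ^ m * (-i) ^ m = (-1) ^ m := by
    rw [← mul_pow, neg_mul_neg, ← sq, hi]
  rw [starEigenvalue]
  linear_combination ((-i) ^ m * (-i) ^ m) * units_cast_mul_self (K := K) ε + h

theorem starEigenvalue_ne_zero (hi : i ^ 2 = -1) (ε : ℤˣ) : starEigenvalue i m ε ≠ 0 := by
  intro h
  have := starEigenvalue_sq (m := m) hi ε
  rw [h, mul_zero] at this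
  exact pow_ne_zero m (neg_ne_zero.mpr one_ne_zero) this.symm

/-- An eigenspace of the Hodge star operator on `m`-vectors. -/
def halfSpace (i : K) (m : ℕ) (ε : ℤˣ) : Submodule K ((Fin m → Fin (2 * m)) → K) where
  carrier := {t | starMatrix K m *ᵥ t = starEigenvalue i m ε • t}
  add_mem' {s t} hs ht := by
    rw [Set.mem_ofPred_eq] at *
    rw [Matrix.mulVec_add, hs, ht, smul_add]
  zero_mem' := by
    rw [Set.mem_ofPred_eq, Matrix.mulVec_zero, smul_zero]
  smul_mem' c t ht := by
    rw [Set.mem_ofPred_eq] at *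
    rw [Matrix.mulVec_smul, ht, smul_comm]

theorem mem_halfSpace {ε : ℤˣ} {t : (Fin m → Fin (2 * m)) → K} :
    t ∈ halfSpace i m ε ↔ starMatrix K m *ᵥ t = starEigenvalue i m ε • t := Iff.rfl

/-- The projection onto an eigenspace of the Hodge star operator. -/
def halfProjection (i : K) (m : ℕ) (ε : ℤˣ) :
    Matrix (Fin m → Fin (2 * m)) (Fin m → Fin (2 * m)) K :=
  (1 / 2 : K) • (((-1) ^ m : K) • (starMatrix K m * starMatrix K m) +
    (starEigenvalue i m ε)⁻¹ • starMatrix K m)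

theorem neg_one_pow_mul_self (m : ℕ) : ((-1) ^ m : K) * (-1) ^ m = 1 := by
  rw [← mul_pow]; simp

/-- The inverse eigenvalue is `(-1) ^ m` times the eigenvalue, and by the cube relation the star
exchanges the two summands of the projection up to the eigenvalue. -/
theorem starMatrix_mul_halfProjection (hi : i ^ 2 = -1) (ε : ℤˣ) :
    starMatrix K m * halfProjection i m ε = starEigenvalue i m ε • halfProjection i m ε := by
  have h0 := starEigenvalue_ne_zero (m := m) hi ε
  have h1 : starEigenvalue i m ε * (-1) ^ m = (starEigenvalue i m ε)⁻¹ := by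
    field_simp
    rw [← starEigenvalue_sq (m := m) hi ε]
    have := neg_one_pow_mul_self (K := K) m
    rw [← starEigenvalue_sq (m := m) hi ε] at this
    linear_combination this
  rw [halfProjection, Matrix.mul_smul, Matrix.mul_add, Matrix.mul_smul, Matrix.mul_smul,
    ← Matrix.mul_assoc, starMatrix_cube, smul_smul, neg_one_pow_mul_self,
    smul_comm (starEigenvalue i m ε) (1 / 2 : K), smul_add (starEigenvalue i m ε),
    smul_smul (starEigenvalue i m ε), h1, smul_smul (starEigenvalue i m ε), mul_inv_cancel₀ h0,
    add_comm]

theorem halfProjection_mulVec_mem (hi : i ^ 2 = -1) (ε : ℤˣ) (t : (Fin m → Fin (2 * m)) → K) :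
    halfProjection i m ε *ᵥ t ∈ halfSpace i m ε := by
  rw [mem_halfSpace, Matrix.mulVec_mulVec, starMatrix_mul_halfProjection hi, Matrix.smul_mulVec]

theorem halfProjection_mulVec (hi : i ^ 2 = -1) {ε : ℤˣ} {t : (Fin m → Fin (2 * m)) → K}
    (ht : t ∈ halfSpace i m ε) : halfProjection i m ε *ᵥ t = t := by
  have h0 := starEigenvalue_ne_zero (m := m) hi ε
  rw [mem_halfSpace] at ht
  rw [halfProjection, Matrix.smul_mulVec, Matrix.add_mulVec, Matrix.smul_mulVec,
    Matrix.smul_mulVec, ← Matrix.mulVec_mulVec, ht, Matrix.mulVec_smul, ht, smul_smul, smul_smul,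
    smul_smul, inv_mul_cancel₀ h0, mul_assoc, starEigenvalue_sq hi, neg_one_pow_mul_self, one_smul, ← two_smul K,
    smul_smul]
  norm_num

theorem tensorMatrix_comm_halfProjection (g : SO m K) (ε : ℤˣ) :
    tensorMatrix g.1 * halfProjection i m ε = halfProjection i m ε * tensorMatrix g.1 := by
  have h := tensorMatrix_comm_starMatrix g
  simp only [halfProjection, Matrix.mul_smul, Matrix.smul_mul, Matrix.mul_add, Matrix.add_mul, h]
  rw [← Matrix.mul_assoc, h, Matrix.mul_assoc, h, Matrix.mul_assoc]

theorem tensorMatrix_mulVec_mem (g : SO m K) {ε : ℤˣ} {t : (Fin m → Fin (2 * m)) → K}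
    (ht : t ∈ halfSpace i m ε) : tensorMatrix g.1 *ᵥ t ∈ halfSpace i m ε := by
  rw [mem_halfSpace] at *
  rw [Matrix.mulVec_mulVec, ← tensorMatrix_comm_starMatrix, ← Matrix.mulVec_mulVec, ht,
    Matrix.mulVec_smul]

/-- The representation on tensors of degree `m`. -/
def tensorRep (K : Type*) [Field K] (m : ℕ) :
    Representation K (SO m K) ((Fin m → Fin (2 * m)) → K) where
  toFun g := Matrix.mulVecLin (tensorMatrix g.1)
  map_one' := by
    rw [Submonoid.coe_one, tensorMatrix_one, Matrix.mulVecLin_one]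
    rfl
  map_mul' g h := by
    rw [Submonoid.coe_mul, tensorMatrix_mul, Matrix.mulVecLin_mul]
    rfl

/-- The representation on an eigenspace of the Hodge star operator. -/
def halfRep (i : K) (m : ℕ) (ε : ℤˣ) : Representation K (SO m K) (halfSpace i m ε) :=
  Subrepresentation.toRepresentation (ρ := tensorRep K m)
    ⟨halfSpace i m ε, fun g _ ht => tensorMatrix_mulVec_mem g ht⟩

theorem coe_halfRep_apply {ε : ℤˣ} (g : SO m K) (t : halfSpace i m ε) :
    (halfRep i m ε g t : (Fin m → Fin (2 * m)) → K) = tensorMatrix g.1 *ᵥ t.1 := rfl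

theorem halfRep_isRational (ε : ℤˣ) : IsRational (halfRep i m ε) := by
  classical
  intro f t
  obtain ⟨F, hF⟩ := LinearMap.exists_extend f
  refine ⟨∑ a : Fin m → Fin (2 * m), ∑ b : Fin m → Fin (2 * m),
    MvPolynomial.C (F (Pi.single a 1) * t.1 b) * ∏ j, MvPolynomial.X (a j, b j), fun g => ?_⟩
  have h1 : f (halfRep i m ε g t) = F (tensorMatrix g.1 *ᵥ t.1) := by
    rw [← hF]; rfl
  rw [h1]
  have hexp : tensorMatrix g.1 *ᵥ t.1 =
      ∑ a, (tensorMatrix g.1 *ᵥ t.1) a • (Pi.single a 1 : (Fin m → Fin (2 * m)) → K) := by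
    ext b
    simp [Finset.sum_apply, Pi.single_apply]
  rw [hexp]
  simp only [map_sum, map_smul, map_mul, map_prod, MvPolynomial.eval_C, MvPolynomial.eval_X]
  refine Finset.sum_congr rfl fun a _ => ?_
  rw [Matrix.mulVec, dotProduct, smul_eq_mul, Finset.sum_mul]
  refine Finset.sum_congr rfl fun b _ => ?_
  rw [tensorMatrix_apply]
  ring

/-- An endomorphism with image in a subspace has the trace of its restriction; composing with the
projection produces such an endomorphism. -/
theorem trace_halfRep (hi : i ^ 2 = -1) (ε : ℤˣ) (g : SO m K) :
    LinearMap.trace K _ (halfRep i m ε g) = (tensorMatrix g.1 * halfProjection i m ε).trace := by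
  have hmem : ∀ t, Matrix.toLin' (tensorMatrix g.1 * halfProjection i m ε) t ∈ halfSpace i m ε := by
    intro t
    rw [Matrix.toLin'_apply, ← Matrix.mulVec_mulVec]
    exact tensorMatrix_mulVec_mem g (halfProjection_mulVec_mem hi ε t)
  have h := LinearMap.trace_restrict_eq_of_forall_mem (halfSpace i m ε)
    (Matrix.toLin' (tensorMatrix g.1 * halfProjection i m ε)) hmem
  rw [Matrix.trace_toLin'_eq] at h
  rw [← h]
  congr 1
  ext t : 2
  rw [coe_halfRep_apply, LinearMap.coe_restrict_apply, Matrix.toLin'_apply, ← Matrix.mulVec_mulVec,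
    halfProjection_mulVec hi t.2]

/-- In the difference of the projections the squares of the star cancel. The factor `(-1) ^ m` of
the trace formula cancels that in `(-i) ^ m = (-1) ^ m * i ^ m`. -/
theorem trace_halfRep_sub (hi : i ^ 2 = -1) (g : SO m K) :
    i ^ m * (LinearMap.trace K _ (halfRep i m 1 g) - LinearMap.trace K _ (halfRep i m (-1) g)) =
      Pf (g.1 - g.1ᵀ) := by
  rw [trace_halfRep hi, trace_halfRep hi, ← Matrix.trace_sub, ← Matrix.mul_sub]
  have h0 := starEigenvalue_ne_zero (m := m) hi 1
  have h1 : halfProjection i m 1 - halfProjection i m (-1) =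
      (starEigenvalue i m 1)⁻¹ • starMatrix K m := by
    have : starEigenvalue i m (-1) = -starEigenvalue i m 1 := by simp [starEigenvalue]
    rw [halfProjection, halfProjection, this, inv_neg]
    module
  have h2 : starEigenvalue i m 1 = (-1) ^ m * i ^ m := by
    simp [starEigenvalue, ← mul_pow]
  have hi0 : i ^ m ≠ 0 := by
    rw [h2] at h0
    exact right_ne_zero_of_mul h0
  rw [h1, Matrix.mul_smul, Matrix.trace_smul, trace_tensorMatrix_mul_starMatrix, h2, smul_eq_mul]
  have h3 := neg_one_pow_ne_zero (R := K) (n := m)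
  field_simp

end HalfSpace

/-! ### Signed permutation matrices. -/

section SignedPermutations

open Matrix

variable {K : Type*} [Field K] [CharZero K] {m : ℕ} {i : K}

/-- A diagonal matrix of signs with product `1`. -/
def signElement (K : Type*) [Field K] {m : ℕ} (d : Fin (2 * m) → ℤˣ) (hd : ∏ p, d p = 1) :
    SO m K :=
  ⟨Matrix.diagonal fun p => ((d p : ℤ) : K), by
    rw [mem_SO_iff]
    constructor
    · rw [Matrix.diagonal_transpose, Matrix.diagonal_mul_diagonal]
      simp only [units_cast_mul_self, Matrix.diagonal_one]
    · rw [Matrix.det_diagonal]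
      have := congrArg (fun u : ℤˣ => ((u : ℤ) : K)) hd
      push_cast at this
      exact this⟩

theorem tensorMatrix_signElement_mulVec (d : Fin (2 * m) → ℤˣ) (hd : ∏ p, d p = 1)
    (t : (Fin m → Fin (2 * m)) → K) (a : Fin m → Fin (2 * m)) :
    (tensorMatrix (signElement K d hd).1 *ᵥ t) a = (((∏ j, d (a j) : ℤˣ) : ℤ) : K) * t a := by
  rw [Matrix.mulVec, dotProduct, Finset.sum_eq_single a]
  · congr 1
    simp [tensorMatrix_apply, signElement]
  · intro b _ hb
    obtain ⟨j, hj⟩ := Function.ne_iff.mp hb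
    rw [tensorMatrix_apply, Finset.prod_eq_zero (Finset.mem_univ j), zero_mul]
    simp [signElement, hj.symm]
  · simp

/-- The matrix of a permutation, with signs of total product the sign of the permutation. -/
def signedPermElement (K : Type*) [Field K] {m : ℕ} (σ : Equiv.Perm (Fin (2 * m)))
    (d : Fin (2 * m) → ℤˣ) (hd : ∏ p, d p = Equiv.Perm.sign σ) : SO m K :=
  ⟨(Matrix.diagonal fun p => ((d p : ℤ) : K)).submatrix id σ, by
    rw [mem_SO_iff]
    constructor
    · rw [Matrix.transpose_submatrix, Matrix.submatrix_mul_equiv, Matrix.diagonal_transpose,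
        Matrix.diagonal_mul_diagonal]
      simp only [units_cast_mul_self, Matrix.diagonal_one, Matrix.submatrix_id_id]
    · rw [Matrix.det_permute', Matrix.det_diagonal]
      have := congrArg (fun u : ℤˣ => ((u : ℤ) : K)) hd
      push_cast at this
      rw [this]
      exact units_cast_mul_self _⟩

theorem tensorMatrix_signedPermElement_mulVec (σ : Equiv.Perm (Fin (2 * m)))
    (d : Fin (2 * m) → ℤˣ) (hd : ∏ p, d p = Equiv.Perm.sign σ) (a : Fin m → Fin (2 * m)) :
    tensorMatrix (signedPermElement K σ d hd).1 *ᵥ Pi.single a 1 =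
      (((∏ j, d (σ (a j)) : ℤˣ) : ℤ) : K) • Pi.single (σ ∘ a) 1 := by
  ext b
  rw [Matrix.mulVec_single_one, Matrix.col_apply, tensorMatrix_apply, Pi.smul_apply, smul_eq_mul]
  by_cases hb : b = σ ∘ a
  · subst hb
    simp [signedPermElement]
  · rw [Pi.single_eq_of_ne hb, mul_zero]
    obtain ⟨j, hj⟩ := Function.ne_iff.mp hb
    refine Finset.prod_eq_zero (Finset.mem_univ j) ?_
    simp only [signedPermElement, Matrix.submatrix_apply, id]
    exact Matrix.diagonal_apply_ne _ hj

theorem exists_signs (hm : 1 ≤ m) (u : ℤˣ) : ∃ d : Fin (2 * m) → ℤˣ, ∏ p, d p = u :=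
  ⟨Pi.mulSingle ⟨0, by omega⟩ u, by rw [Finset.prod_pi_mulSingle']; simp⟩

end SignedPermutations

/-! ### Characters of the group of signs. -/

section SignCharacters

variable {m : ℕ}

/-- The diagonal sign matrices with determinant `1`. -/
abbrev SignVectors (m : ℕ) : Type := {d : Fin (2 * m) → ℤˣ // ∏ p, d p = 1}

/-- The character sum which detects whether the sign characters of `a` and `b` agree. -/
def signSum (K : Type*) [Field K] {m : ℕ} (a b : Fin m → Fin (2 * m)) : K :=
  ∑ d : SignVectors m, (((∏ j, d.1 (a j) * d.1 (b j) : ℤˣ) : ℤ) : K)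

variable {K : Type*} [Field K] [CharZero K]

theorem signSum_self_ne_zero (a : Fin m → Fin (2 * m)) : signSum K a a ≠ 0 := by
  have : Nonempty (SignVectors m) := ⟨⟨1, by simp⟩⟩
  simp only [signSum, Int.units_mul_self, Finset.prod_const_one, Units.val_one, Int.cast_one,
    Finset.sum_const, Finset.card_univ, nsmul_eq_mul, mul_one]
  exact Nat.cast_ne_zero.mpr Fintype.card_ne_zero

/-- Orthogonality of characters: if the product is `-1` at `d`, translation by `d` negates the sum.
-/
theorem sign_characters_agree {a b : Fin m → Fin (2 * m)} (h : signSum K a b ≠ 0)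
    (d : SignVectors m) : ∏ j, d.1 (a j) * d.1 (b j) = 1 := by
  by_contra hd
  have hd' : ∏ j, d.1 (a j) * d.1 (b j) = -1 := (Int.units_eq_one_or _).resolve_left hd
  refine h ?_
  set e : Equiv.Perm (SignVectors m) := Function.Involutive.toPerm
    (fun d' => ⟨d.1 * d'.1, by simp [Finset.prod_mul_distrib, d.2, d'.2]⟩) (fun d' => by
      apply Subtype.ext
      funext p
      simp [← mul_assoc, Int.units_mul_self]) with he
  have hneg : signSum K a b = -signSum K a b := by
    rw [signSum, ← Finset.sum_neg_distrib, ← Equiv.sum_comp e fun d' : SignVectors m =>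
      (((∏ j, d'.1 (a j) * d'.1 (b j) : ℤˣ) : ℤ) : K)]
    refine Finset.sum_congr rfl fun d' _ => ?_
    have : ∏ j, (e d').1 (a j) * (e d').1 (b j) = -∏ j, d'.1 (a j) * d'.1 (b j) := by
      rw [← neg_one_mul, ← hd', ← Finset.prod_mul_distrib]
      refine Finset.prod_congr rfl fun j _ => ?_
      exact mul_mul_mul_comm _ _ _ _
    rw [this]
    simp
  exact self_eq_neg.mp hneg

theorem prod_mulSingle_comp {a : Fin m → Fin (2 * m)} (ha : Function.Injective a)
    (p : Fin (2 * m)) : ∏ j, (Pi.mulSingle p (-1 : ℤˣ) : Fin (2 * m) → ℤˣ) (a j) =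
      if p ∈ Set.range a then -1 else 1 := by
  split_ifs with h
  · obtain ⟨k, rfl⟩ := h
    rw [Finset.prod_eq_single k]
    · simp
    · intro j _ hj
      exact Pi.mulSingle_eq_of_ne (fun h => hj (ha h)) _
    · simp
  · refine Finset.prod_eq_one fun j _ => Pi.mulSingle_eq_of_ne (fun h' => h ⟨j, h'⟩) _

/-- The multi-indices with the same sign character as `a` are the arrangements of the range of `a`
and of its complement. -/
theorem perm_or_complement {a b : Fin m → Fin (2 * m)} (ha : Function.Injective a)
    (hb : Function.Injective b) (h : signSum K a b ≠ 0) :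
    (∃ π : Equiv.Perm (Fin m), b = a ∘ π) ∨ Function.Injective (interleave (b, a)) := by
  by_cases hab : ∃ j k, b j = a k
  · left
    obtain ⟨j₀, k₀, h₀⟩ := hab
    have key : ∀ j, ∃ k, a k = b j := by
      intro j
      by_contra hj
      -- Flip the signs at `b j₀`, which lies in the range of `a`, and at `b j`, which does not. The
      -- character of `b` sees both flips and that of `a` only one.
      have hd := sign_characters_agree h ⟨Pi.mulSingle (b j₀) (-1) * Pi.mulSingle (b j) (-1), by
        simp only [Pi.mul_apply, Finset.prod_mul_distrib, Finset.prod_pi_mulSingle']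
        simp⟩
      simp only [Pi.mul_apply, Finset.prod_mul_distrib, prod_mulSingle_comp ha,
        prod_mulSingle_comp hb] at hd
      rw [if_pos ⟨k₀, h₀.symm⟩, if_neg (show b j ∉ Set.range a from hj), if_pos ⟨j₀, rfl⟩,
        if_pos ⟨j, rfl⟩] at hd
      revert hd
      decide
    choose π hπ using key
    have hinj : Function.Injective π := by
      intro j k hjk
      apply hb
      rw [← hπ, ← hπ, hjk]
    refine ⟨Equiv.ofBijective π (Finite.injective_iff_bijective.mp hinj), ?_⟩
    funext j
    exact (hπ j).symm
  · right
    push Not at hab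
    exact interleave_injective_iff.mpr ⟨hb, ha, hab⟩

end SignCharacters

/-! ### Irreducibility of the eigenspaces. -/

section HalfIrreducible

open Matrix

variable {K : Type*} [Field K] [CharZero K] {m : ℕ} {i : K}

theorem starMatrix_mulVec_comp_perm (t : (Fin m → Fin (2 * m)) → K) (a : Fin m → Fin (2 * m))
    (π : Equiv.Perm (Fin m)) : (starMatrix K m *ᵥ t) (a ∘ π) =
      ((Equiv.Perm.sign π : ℤ) : K) * (starMatrix K m *ᵥ t) a := by
  rw [Matrix.mulVec, Matrix.mulVec, dotProduct, dotProduct, Finset.mul_sum]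
  refine Finset.sum_congr rfl fun b _ => ?_
  have := levi_interleave_comp (K := K) a b π 1
  simp only [Equiv.Perm.coe_one, Function.comp_id, Equiv.Perm.sign_one, Units.val_one,
    Int.cast_one, mul_one] at this
  rw [starMatrix_apply, starMatrix_apply, this]
  ring

theorem starMatrix_sq_mulVec {a b : Fin m → Fin (2 * m)}
    (h : Function.Injective (interleave (a, b))) (t : (Fin m → Fin (2 * m)) → K) :
    (starMatrix K m *ᵥ (starMatrix K m *ᵥ t)) a =
      levi K (interleave (a, b)) * (starMatrix K m *ᵥ t) b := by
  rw [Matrix.mulVec_mulVec, Matrix.mulVec, Matrix.mulVec, dotProduct, dotProduct, Finset.mul_sum]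
  refine Finset.sum_congr rfl fun c _ => ?_
  rw [starMatrix_mul_starMatrix h, mul_assoc]

/-- The eigenvalue is nonzero, so members of the eigenspace are images of the star and hence
alternating. -/
theorem halfSpace_apply_comp_perm (hi : i ^ 2 = -1) {ε : ℤˣ} {t : (Fin m → Fin (2 * m)) → K}
    (ht : t ∈ halfSpace i m ε) (a : Fin m → Fin (2 * m)) (π : Equiv.Perm (Fin m)) :
    t (a ∘ π) = ((Equiv.Perm.sign π : ℤ) : K) * t a := by
  have h := starMatrix_mulVec_comp_perm t a π
  rw [mem_halfSpace.mp ht] at h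
  simp only [Pi.smul_apply, smul_eq_mul] at h
  refine mul_left_cancel₀ (starEigenvalue_ne_zero (m := m) hi ε) ?_
  rw [h]
  ring

theorem halfSpace_apply_eq_zero (hi : i ^ 2 = -1) {ε : ℤˣ} {t : (Fin m → Fin (2 * m)) → K}
    (ht : t ∈ halfSpace i m ε) {a : Fin m → Fin (2 * m)} (ha : ¬ Function.Injective a) :
    t a = 0 := by
  have h := congrFun (mem_halfSpace.mp ht) a
  rw [Matrix.mulVec, dotProduct, Finset.sum_eq_zero fun b _ => by
    rw [starMatrix_row_eq_zero ha, zero_mul]] at h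
  exact (mul_eq_zero.mp h.symm).resolve_left (starEigenvalue_ne_zero hi ε)

theorem halfSpace_apply_complement (hi : i ^ 2 = -1) {ε : ℤˣ} {t : (Fin m → Fin (2 * m)) → K}
    (ht : t ∈ halfSpace i m ε) {a b : Fin m → Fin (2 * m)}
    (h : Function.Injective (interleave (b, a))) :
    starEigenvalue i m ε * t b = levi K (interleave (b, a)) * t a := by
  have h2 := starMatrix_sq_mulVec h t
  rw [mem_halfSpace.mp ht, Matrix.mulVec_smul, mem_halfSpace.mp ht] at h2
  simp only [Pi.smul_apply, smul_eq_mul] at h2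
  refine mul_left_cancel₀ (starEigenvalue_ne_zero (m := m) hi ε) ?_
  rw [h2]
  ring

/-- Alternation and the eigenvalue equation express the coordinates at all arrangements of the range
of `a` and of its complement through `t a`. Vectors of the eigenspace with this support thus form at
most a line. -/
theorem halfSpace_eq_zero (hi : i ^ 2 = -1) {ε : ℤˣ} {t : (Fin m → Fin (2 * m)) → K}
    (ht : t ∈ halfSpace i m ε) {a : Fin m → Fin (2 * m)} (ha : t a = 0)
    (hsupp : ∀ b, t b ≠ 0 → (∃ π : Equiv.Perm (Fin m), b = a ∘ π) ∨
      Function.Injective (interleave (b, a))) : t = 0 := by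
  funext b
  by_contra hb
  rcases hsupp b hb with ⟨π, rfl⟩ | h
  · exact hb (by rw [halfSpace_apply_comp_perm hi ht, ha, mul_zero]; rfl)
  · have := halfSpace_apply_complement hi ht h
    rw [ha, mul_zero] at this
    exact hb ((mul_eq_zero.mp this).resolve_left (starEigenvalue_ne_zero hi ε))

theorem halfProjection_support {ε : ℤˣ} {a b : Fin m → Fin (2 * m)}
    (h : halfProjection i m ε b a ≠ 0) : (∃ π : Equiv.Perm (Fin m), b = a ∘ π) ∨
      Function.Injective (interleave (b, a)) := by
  by_cases hba : Function.Injective (interleave (b, a))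
  · exact Or.inr hba
  left
  have h2 : (starMatrix K m * starMatrix K m) b a ≠ 0 := by
    intro h2
    refine h ?_
    simp only [halfProjection, Matrix.smul_apply, Matrix.add_apply, h2, starMatrix_eq_zero hba,
      smul_zero, add_zero]
  rw [Matrix.mul_apply] at h2
  obtain ⟨d, -, hd⟩ := Finset.exists_ne_zero_of_sum_ne_zero h2
  have hbd : Function.Injective (interleave (b, d)) := by
    by_contra hn
    exact hd (by rw [starMatrix_eq_zero hn, zero_mul])
  have hda : Function.Injective (interleave (d, a)) := by
    by_contra hn
    exact hd (by rw [starMatrix_eq_zero hn, mul_zero])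
  exact exists_perm_of_interleave hda (interleave_injective_swap.mp hbd)

theorem halfProjection_diag_ne_zero (hm : 1 ≤ m) (ε : ℤˣ) {a : Fin m → Fin (2 * m)}
    (ha : Function.Injective a) : halfProjection i m ε a a ≠ 0 := by
  obtain ⟨b, hb⟩ := exists_complement ha
  have hfact : (m ! : K) ≠ 0 := Nat.cast_ne_zero.mpr m.factorial_ne_zero
  -- Only the square of the star contributes. This fails for `m = 0`, where the empty multi-index is
  -- its own complement.
  have h0 : starMatrix K m a a = 0 := starMatrix_eq_zero fun h =>
    (interleave_injective_iff.mp h).2.2 ⟨0, hm⟩ ⟨0, hm⟩ rfl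
  have hne : ∀ {f : Fin (2 * m) → Fin (2 * m)}, Function.Injective f → levi K f ≠ 0 := fun hf h => by
    have := levi_mul_self (K := K) hf
    rw [h, mul_zero] at this
    exact zero_ne_one this
  simp only [halfProjection, Matrix.smul_apply, Matrix.add_apply, h0, smul_eq_mul, mul_zero, add_zero,
    starMatrix_mul_starMatrix hb, starMatrix_apply b a]
  exact mul_ne_zero (by norm_num) (mul_ne_zero (pow_ne_zero _ (neg_ne_zero.mpr one_ne_zero))
    (mul_ne_zero (hne hb) (mul_ne_zero (inv_ne_zero hfact)
      (hne (interleave_injective_swap.mp hb)))))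

theorem exists_perm_comp_eq {a b : Fin m → Fin (2 * m)} (ha : Function.Injective a)
    (hb : Function.Injective b) : ∃ σ : Equiv.Perm (Fin (2 * m)), b = σ ∘ a := by
  obtain ⟨a', ha'⟩ := exists_complement ha
  obtain ⟨b', hb'⟩ := exists_complement hb
  set ea := Equiv.ofBijective _ (Finite.injective_iff_bijective.mp ha') with hea
  set eb := Equiv.ofBijective _ (Finite.injective_iff_bijective.mp hb') with heb
  refine ⟨ea.symm.trans eb, ?_⟩
  funext j
  have h1 : ea (pairIdx (j, 0)) = a j := by simp [hea]
  have h2 : eb (pairIdx (j, 0)) = b j := by simp [heb]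
  rw [Function.comp_apply, Equiv.trans_apply, ← h1, Equiv.symm_apply_apply, h2]

/-- The eigenspaces of the Hodge star operator have no invariant subspaces, because already the
signed permutation matrices of determinant `1` act irreducibly. -/
theorem halfSpace_le_of_stable (hi : i ^ 2 = -1) (hm : 1 ≤ m) {ε : ℤˣ}
    {W : Submodule K ((Fin m → Fin (2 * m)) → K)} (hW : W ≤ halfSpace i m ε)
    (hstable : ∀ g : SO m K, ∀ t ∈ W, tensorMatrix g.1 *ᵥ t ∈ W) (hne : W ≠ ⊥) :
    halfSpace i m ε ≤ W := by
  obtain ⟨t, htW, ht0⟩ := (Submodule.ne_bot_iff _).mp hne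
  obtain ⟨a, hta⟩ := Function.ne_iff.mp ht0
  have hinj : ∀ b, t b ≠ 0 → Function.Injective b := fun b hb => by
    by_contra hn
    exact hb (halfSpace_apply_eq_zero hi (hW htW) hn)
  have ha := hinj a hta
  -- Averaging over the sign matrices against the character of `a` keeps only the coordinates at
  -- arrangements of the range of `a` or of its complement.
  set t' : (Fin m → Fin (2 * m)) → K := fun b => signSum K a b * t b with ht'
  have ht'W : t' ∈ W := by
    have : t' = ∑ d : SignVectors m, (((∏ j, d.1 (a j) : ℤˣ) : ℤ) : K) •
        (tensorMatrix (signElement K d.1 d.2).1 *ᵥ t) := by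
      funext b
      rw [Finset.sum_apply]
      simp only [Pi.smul_apply, tensorMatrix_signElement_mulVec, smul_eq_mul, ht', signSum,
        Finset.sum_mul, Finset.prod_mul_distrib, Units.val_mul, Int.cast_mul, mul_assoc]
    rw [this]
    exact Submodule.sum_mem _ fun d _ => Submodule.smul_mem _ _ (hstable _ _ htW)
  have hsupp : ∀ b, t' b ≠ 0 → (∃ π : Equiv.Perm (Fin m), b = a ∘ π) ∨
      Function.Injective (interleave (b, a)) := fun b hb =>
    perm_or_complement (K := K) ha (hinj b (right_ne_zero_of_mul hb)) (left_ne_zero_of_mul hb)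
  have ht'a : t' a ≠ 0 := mul_ne_zero (signSum_self_ne_zero a) hta
  set p := halfProjection i m ε with hp
  have hcol : ∀ c b, (p *ᵥ Pi.single c 1) b = p b c := fun c b => by
    rw [Matrix.mulVec_single_one, Matrix.col_apply]
  have hpa : p a a ≠ 0 := halfProjection_diag_ne_zero hm ε ha
  have hwa : p *ᵥ Pi.single a 1 ∈ W := by
    -- Both vectors lie on the line singled out by `halfSpace_eq_zero`, and the scalar matches their
    -- coordinates at `a`.
    have hzero : t' - (t' a / p a a) • (p *ᵥ Pi.single a 1) = 0 := by
      refine halfSpace_eq_zero hi (ε := ε) (a := a) (Submodule.sub_mem _ (hW ht'W)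
        (Submodule.smul_mem _ _ (halfProjection_mulVec_mem hi ε _))) ?_ ?_
      · simp only [Pi.sub_apply, Pi.smul_apply, hcol, smul_eq_mul]
        field_simp
        ring
      · intro b hb
        by_cases htb : t' b = 0
        · refine halfProjection_support (i := i) (ε := ε) fun hpb => hb ?_
          rw [← hp] at hpb
          simp only [Pi.sub_apply, Pi.smul_apply, hcol, hpb, htb, smul_zero, sub_zero]
        · exact hsupp b htb
    have hc : t' a / p a a ≠ 0 := div_ne_zero ht'a hpa
    rw [sub_eq_zero] at hzero
    have h1 := Submodule.smul_mem W (t' a / p a a)⁻¹ ht'W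
    set c := t' a / p a a
    rwa [hzero, smul_smul, inv_mul_cancel₀ hc, one_smul] at h1
  -- Signed permutations commute with `p` and move `a` to any injective `b`; for other `b` the
  -- projection vanishes.
  have hall : ∀ b, p *ᵥ Pi.single b 1 ∈ W := by
    intro b
    by_cases hb : Function.Injective b
    · obtain ⟨σ, rfl⟩ := exists_perm_comp_eq ha hb
      obtain ⟨d, hd⟩ := exists_signs hm (Equiv.Perm.sign σ)
      have h1 := hstable (signedPermElement K σ d hd) _ hwa
      rw [Matrix.mulVec_mulVec, hp, tensorMatrix_comm_halfProjection, ← Matrix.mulVec_mulVec,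
        tensorMatrix_signedPermElement_mulVec, Matrix.mulVec_smul] at h1
      have h2 := Submodule.smul_mem W (((∏ j, d (σ (a j)) : ℤˣ) : ℤ) : K) h1
      rwa [smul_smul, units_cast_mul_self, one_smul] at h2
    · have : p *ᵥ Pi.single b 1 = 0 := by
        funext c
        rw [hcol, hp, halfProjection, Matrix.smul_apply, Matrix.add_apply, Matrix.smul_apply,
          Matrix.smul_apply, starMatrix_column_eq_zero hb, Matrix.mul_apply,
          Finset.sum_eq_zero fun d _ => by rw [starMatrix_column_eq_zero hb, mul_zero]]
        simp
      rw [this]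
      exact Submodule.zero_mem _
  intro u hu
  have hexp : u = ∑ b, u b • (Pi.single b 1 : (Fin m → Fin (2 * m)) → K) := by
    ext b
    simp [Finset.sum_apply, Pi.single_apply]
  rw [← halfProjection_mulVec hi hu, hexp, Matrix.mulVec_sum]
  refine Submodule.sum_mem _ fun b _ => ?_
  rw [Matrix.mulVec_smul]
  exact Submodule.smul_mem _ _ (hall b)

theorem halfSpace_nontrivial (hi : i ^ 2 = -1) (hm : 1 ≤ m) (ε : ℤˣ) :
    Nontrivial (halfSpace i m ε) := by
  set a : Fin m → Fin (2 * m) := fun j => pairIdx (j, 0) with ha'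
  have ha : Function.Injective a := fun j k h => by simpa [ha'] using h
  refine ⟨⟨⟨_, halfProjection_mulVec_mem hi ε (Pi.single a 1)⟩, 0, fun h => ?_⟩⟩
  have : (halfProjection i m ε *ᵥ Pi.single a 1) a = 0 := congrFun (congrArg Subtype.val h) a
  rw [Matrix.mulVec_single_one, Matrix.col_apply] at this
  exact halfProjection_diag_ne_zero hm ε ha this

theorem halfRep_isIrreducible (hi : i ^ 2 = -1) (hm : 1 ≤ m) (ε : ℤˣ) :
    (halfRep i m ε).IsIrreducible := by
  refine isIrreducible_iff.mpr ⟨halfSpace_nontrivial hi hm ε, fun N hN => ?_⟩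
  by_cases hbot : N = ⊥
  · exact Or.inl hbot
  right
  have hle := halfSpace_le_of_stable hi hm (ε := ε) (W := N.map (halfSpace i m ε).subtype)
    (Submodule.map_subtype_le _ _) (fun g t ht => by
      obtain ⟨u, hu, rfl⟩ := ht
      exact ⟨halfRep i m ε g u, hN g u hu, rfl⟩)
    (fun h => hbot (Submodule.map_injective_of_injective
      (Submodule.subtype_injective _) (h.trans (Submodule.map_bot _).symm)))
  rw [eq_top_iff]
  intro u _
  obtain ⟨v, hv, hvu⟩ := hle u.2
  rwa [← Subtype.ext hvu]

end HalfIrreducible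

/-! ### The highest weight vector. -/

section HighestWeightVector

open Matrix

variable {K : Type*} [Field K] [CharZero K] {m : ℕ} {i : K}

/-- The elementary tensor of a family of vectors. -/
def elemTensor (x : Fin m → Fin (2 * m) → K) : (Fin m → Fin (2 * m)) → K :=
  fun b => ∏ j, x j (b j)

theorem tensorMatrix_mulVec_elemTensor (g : Matrix (Fin (2 * m)) (Fin (2 * m)) K)
    (x : Fin m → Fin (2 * m) → K) :
    tensorMatrix g *ᵥ elemTensor x = elemTensor fun j => g *ᵥ x j := by
  ext a
  simp only [Matrix.mulVec, dotProduct, elemTensor, tensorMatrix_apply, ← Finset.prod_mul_distrib,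
    Finset.prod_univ_sum, Fintype.piFinset_univ]

/-- The Hodge star of the exterior product of a family of vectors, up to a scalar. -/
def starWedge (x : Fin m → Fin (2 * m) → K) : (Fin m → Fin (2 * m)) → K :=
  starMatrix K m *ᵥ elemTensor x

theorem tensorMatrix_mulVec_starWedge (g : SO m K) (x : Fin m → Fin (2 * m) → K) :
    tensorMatrix g.1 *ᵥ starWedge x = starWedge fun j => g.1 *ᵥ x j := by
  rw [starWedge, starWedge, Matrix.mulVec_mulVec, tensorMatrix_comm_starMatrix,
    ← Matrix.mulVec_mulVec, tensorMatrix_mulVec_elemTensor]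

theorem starWedge_smul (c : Fin m → K) (x : Fin m → Fin (2 * m) → K) :
    starWedge (fun j => c j • x j) = (∏ j, c j) • starWedge x := by
  rw [starWedge, starWedge, ← Matrix.mulVec_smul]
  congr 1
  ext b
  simp [elemTensor, Finset.prod_mul_distrib]

/-- This expresses every coordinate as a determinant with the `x j` among its rows, so that row
operations apply to the family `x`. -/
theorem starWedge_eq_det (x : Fin m → Fin (2 * m) → K) (a : Fin m → Fin (2 * m)) :
    starWedge x a = (m ! : K)⁻¹ * (Matrix.of (interleave
      (fun j => (Pi.single (a j) 1 : Fin (2 * m) → K), x))).det := by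
  have h := sum_levi_mul_prod (Matrix.of (interleave
      (fun j => (Pi.single (a j) 1 : Fin (2 * m) → K), x))) id
  have hid : levi K (id : Fin (2 * m) → Fin (2 * m)) = 1 := by
    simpa using levi_perm (K := K) (1 : Equiv.Perm (Fin (2 * m)))
  rw [hid, one_mul] at h
  rw [← h, ← sum_interleave, Finset.sum_eq_single a]
  · rw [starWedge, Matrix.mulVec, dotProduct, Finset.mul_sum]
    refine Finset.sum_congr rfl fun b _ => ?_
    simp only [prod_pairIdx, id, Matrix.of_apply, interleave_zero, interleave_one, Pi.single_eq_same,
      one_mul, starMatrix_apply, elemTensor]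
    ring
  · intro a' _ ha'
    obtain ⟨j, hj⟩ := Function.ne_iff.mp ha'
    refine Finset.sum_eq_zero fun b _ => ?_
    rw [prod_pairIdx, Finset.prod_eq_zero (Finset.mem_univ j), mul_zero]
    simp [hj]
  · simp

theorem starWedge_update_add_smul (x : Fin m → Fin (2 * m) → K) {j k : Fin m} (h : k ≠ j) (c : K) :
    starWedge (Function.update x k (x k + c • x j)) = starWedge x := by
  ext a
  rw [starWedge_eq_det, starWedge_eq_det]
  congr 1
  have hne : (pairIdx (k, (1 : Fin 2)) : Fin (2 * m)) ≠ pairIdx (j, 1) := by simpa using h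
  rw [← Matrix.det_updateRow_add_smul_self (Matrix.of (interleave
      (fun j => (Pi.single (a j) 1 : Fin (2 * m) → K), x))) hne c]
  congr 1
  refine pairIdx_ext fun l b => ?_
  fin_cases b
  · have : (pairIdx (l, (0 : Fin 2)) : Fin (2 * m)) ≠ pairIdx (k, 1) := by simp
    simp only [Fin.zero_eta]
    rw [Matrix.updateRow_ne this]
    ext q
    simp only [Matrix.of_apply, interleave_zero]
  · by_cases hl : l = k
    · subst hl
      simp only [Fin.mk_one]
      rw [Matrix.updateRow_self]
      ext q
      simp [Matrix.of_apply]
    · have : (pairIdx (l, (1 : Fin 2)) : Fin (2 * m)) ≠ pairIdx (k, 1) := by simpa using hl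
      simp only [Fin.mk_one]
      rw [Matrix.updateRow_ne this]
      ext q
      simp [Matrix.of_apply, hl]

/-- The signs in the highest weight `L_1 + ⋯ + L_{m-1} ± L_m`. -/
def highestSign (m : ℕ) (ε : ℤˣ) (j : Fin m) : ℤˣ := if (j : ℕ) + 1 = m then ε else 1

/-- The highest weight vector of `halfRep`. -/
def highestVector (i : K) (m : ℕ) (ε : ℤˣ) : (Fin m → Fin (2 * m)) → K :=
  starWedge fun j => isoVec i j (highestSign m ε j)

theorem prod_highestSign (hm : 1 ≤ m) (ε : ℤˣ) : ∏ j, highestSign m ε j = ε := by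
  rw [Finset.prod_eq_single ⟨m - 1, by omega⟩]
  · rw [highestSign, if_pos]
    simp only
    omega
  · intro j _ hj
    rw [highestSign, if_neg]
    intro h
    apply hj
    apply Fin.ext
    simp only
    omega
  · simp

theorem highestVector_weight (hi : i ^ 2 = -1) (ε : ℤˣ) (x : Fin m → Kˣ) :
    tensorMatrix (torusElement i hi x).1 *ᵥ highestVector i m ε =
      torusChar K (fun j => (highestSign m ε j : ℤ)) x • highestVector i m ε := by
  rw [highestVector, tensorMatrix_mulVec_starWedge]
  simp only [torusElement_val, torusMatrix_mulVec_isoVec hi, starWedge_smul, torusChar_single]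
  congr 1
  rw [torusChar_apply]
  push_cast
  rfl

theorem highestVector_fixed (hi : i ^ 2 = -1) (ε : ℤˣ) {j k : Fin m} (hjk : j < k) (δ : ℤˣ)
    (s : K) : tensorMatrix (rootElement hi hjk.ne 1 δ s).1 *ᵥ highestVector i m ε =
      highestVector i m ε := by
  have hj : highestSign m ε j = 1 := by
    rw [highestSign, if_neg]
    have := k.2
    have := Fin.lt_def.mp hjk
    omega
  set x : Fin m → Fin (2 * m) → K := fun l => isoVec i l (highestSign m ε l) with hx
  have horth : ∀ l, isoVec i j 1 ⬝ᵥ x l = 0 := by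
    intro l
    by_cases hl : j = l
    · subst hl
      rw [hx]
      simp only [hj]
      exact isoVec_dot_self hi j 1
    · exact isoVec_dot_isoVec_of_ne i hl _ _
  -- Every `x l` is orthogonal to `isoVec i j 1`, which is `x j` because `j < k` is not the last
  -- index. So only `x k` can change, by a multiple of `x j`.
  have hupd : (fun l => (rootElement hi hjk.ne 1 δ s).1 *ᵥ x l) =
      Function.update x k (x k + (-(s * (isoVec i k δ ⬝ᵥ x k))) • x j) := by
    funext l
    rw [rootElement_val, siegelMatrix_mulVec, horth, mul_zero, zero_smul, zero_smul, add_zero,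
      sub_zero, smul_dotProduct, smul_eq_mul]
    have hxj : x j = isoVec i j 1 := by rw [hx]; simp only [hj]
    by_cases hl : l = k
    · subst hl
      rw [Function.update_self, hxj, neg_smul, sub_eq_add_neg]
    · rw [Function.update_of_ne hl, isoVec_dot_isoVec_of_ne i (Ne.symm hl), mul_zero, zero_smul,
        sub_zero]
  rw [highestVector, tensorMatrix_mulVec_starWedge, hupd, starWedge_update_add_smul x hjk.ne']

/-- The multi-index selecting one member of each pair. -/
def transversal {m : ℕ} (α : Fin m → Fin 2) (j : Fin m) : Fin (2 * m) := pairIdx (j, α j)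

theorem elemTensor_isoVec_transversal (δ : Fin m → ℤˣ) (α : Fin m → Fin 2) :
    elemTensor (fun j => isoVec i j (δ j)) (transversal α) =
      ∏ j, (if α j = 0 then 1 else -(((δ j : ℤ) : K) * i)) := by
  simp [elemTensor, transversal, isoVec_pairIdx]

theorem eq_transversal_of_elemTensor_ne_zero {δ : Fin m → ℤˣ} {b : Fin m → Fin (2 * m)}
    (h : elemTensor (fun j => isoVec i j (δ j)) b ≠ 0) : ∃ α, b = transversal α := by
  refine ⟨fun j => (pairIdx.symm (b j)).2, funext fun j => ?_⟩
  have hj := Finset.prod_ne_zero_iff.mp h j (Finset.mem_univ j)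
  have h1 : (pairIdx.symm (b j)).1 = j := by
    by_contra hn
    exact hj (if_neg hn)
  rw [transversal, ← Equiv.symm_apply_eq]
  exact Prod.ext h1 rfl

/-- The transversal selecting the other member of each pair. -/
def otherSide {m : ℕ} (α : Fin m → Fin 2) (j : Fin m) : Fin 2 := Equiv.swap 0 1 (α j)

theorem interleave_transversal (α : Fin m → Fin 2) :
    interleave (transversal α, transversal (otherSide α)) =
      withinPerm fun j => if α j = 0 then 1 else Equiv.swap 0 1 := by
  have hα : ∀ c : Fin 2, c ≠ 0 → c = 1 := by decide
  refine pairIdx_ext fun j c => ?_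
  by_cases h : α j = 0
  · fin_cases c <;> simp [transversal, otherSide, h]
  · fin_cases c <;> simp [transversal, otherSide, hα _ h]

theorem interleave_transversal_injective (α : Fin m → Fin 2) :
    Function.Injective (interleave (transversal α, transversal (otherSide α))) := by
  rw [interleave_transversal]
  exact Equiv.injective _

theorem levi_transversal (α : Fin m → Fin 2) :
    levi K (interleave (transversal α, transversal (otherSide α))) =
      ∏ j, (if α j = 0 then 1 else -1) := by
  rw [interleave_transversal, levi_perm, sign_withinPerm]
  push_cast
  refine Finset.prod_congr rfl fun j _ => ?_
  split_ifs <;> simp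

theorem otherSide_otherSide (α : Fin m → Fin 2) : otherSide (otherSide α) = α := by
  funext j
  simp [otherSide]

/-- The elementary tensor lives on transversals, and the only one disjoint from a given transversal
selects the other member of every pair. -/
theorem starWedge_transversal (δ : Fin m → ℤˣ) (α : Fin m → Fin 2) :
    starWedge (fun j => isoVec i j (δ j)) (transversal α) =
      (m ! : K)⁻¹ * levi K (interleave (transversal α, transversal (otherSide α))) *
        elemTensor (fun j => isoVec i j (δ j)) (transversal (otherSide α)) := by
  rw [starWedge, Matrix.mulVec, dotProduct, Finset.sum_eq_single (transversal (otherSide α))]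
  · rw [starMatrix_apply]
  · intro b _ hb
    by_contra hne
    obtain ⟨β, rfl⟩ := eq_transversal_of_elemTensor_ne_zero (right_ne_zero_of_mul hne)
    refine hb (congrArg transversal (funext fun j => ?_))
    have hinj : Function.Injective (interleave (transversal α, transversal β)) := by
      by_contra hn
      exact hne (by rw [starMatrix_eq_zero hn, zero_mul])
    have hj := (interleave_injective_iff.mp hinj).2.2 j j
    have hj' : α j ≠ β j := fun h => hj (by rw [transversal, transversal, h])
    have key : ∀ c d : Fin 2, c ≠ d → d = Equiv.swap 0 1 c := by decide
    exact key _ _ hj'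
  · simp

theorem eq_transversal_of_starWedge_ne_zero {δ : Fin m → ℤˣ} {a : Fin m → Fin (2 * m)}
    (h : starWedge (fun j => isoVec i j (δ j)) a ≠ 0) :
    ∃ (α : Fin m → Fin 2) (π : Equiv.Perm (Fin m)), a = transversal α ∘ π := by
  obtain ⟨b, -, hb⟩ := Finset.exists_ne_zero_of_sum_ne_zero h
  obtain ⟨β, rfl⟩ := eq_transversal_of_elemTensor_ne_zero (right_ne_zero_of_mul hb)
  have hinj : Function.Injective (interleave (transversal β, a)) := by
    rw [interleave_injective_swap]
    by_contra hn
    exact hb (mul_eq_zero_of_left (starMatrix_eq_zero hn) _)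
  exact ⟨otherSide β, exists_perm_of_interleave (interleave_transversal_injective β) hinj⟩

/-- The identity factors over the pairs; the `j`-th plane contributes the eigenvalue `δ j * -i`. -/
theorem star_starWedge_transversal (hi : i ^ 2 = -1) (δ : Fin m → ℤˣ) (α : Fin m → Fin 2) :
    (starMatrix K m *ᵥ starWedge (fun j => isoVec i j (δ j))) (transversal α) =
      (∏ j, (((δ j : ℤ) : K) * -i)) * starWedge (fun j => isoVec i j (δ j)) (transversal α) := by
  rw [starWedge, starMatrix_sq_mulVec (interleave_transversal_injective α), ← starWedge,
    starWedge_transversal, starWedge_transversal, otherSide_otherSide]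
  have key : levi K (interleave (transversal (otherSide α), transversal α)) *
      elemTensor (fun j => isoVec i j (δ j)) (transversal α) = (∏ j, (((δ j : ℤ) : K) * -i)) *
      elemTensor (fun j => isoVec i j (δ j)) (transversal (otherSide α)) := by
    have := levi_transversal (K := K) (otherSide α)
    rw [otherSide_otherSide] at this
    rw [this, elemTensor_isoVec_transversal, elemTensor_isoVec_transversal,
      ← Finset.prod_mul_distrib, ← Finset.prod_mul_distrib]
    refine Finset.prod_congr rfl fun j _ => ?_
    have hα : ∀ c : Fin 2, c ≠ 0 → c = 1 := by decide
    by_cases h : α j = 0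
    · simp only [otherSide, h, Equiv.swap_apply_left, one_ne_zero, if_false, if_true]
      linear_combination -(i ^ 2) * units_cast_mul_self (K := K) (δ j) - hi
    · simp only [otherSide, hα _ h, Equiv.swap_apply_right, one_ne_zero, if_false, if_true]
      ring
  linear_combination ((m ! : K)⁻¹ * levi K (interleave (transversal α, transversal (otherSide α)))) *
    key

/-- The eigenvalue equation passes from transversals to their rearrangements because both sides are
alternating; at all other multi-indices both sides vanish. -/
theorem starWedge_mem (hi : i ^ 2 = -1) (δ : Fin m → ℤˣ) :
    starMatrix K m *ᵥ starWedge (fun j => isoVec i j (δ j)) =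
      (∏ j, (((δ j : ℤ) : K) * -i)) • starWedge (fun j => isoVec i j (δ j)) := by
  have htrans : ∀ (α : Fin m → Fin 2) (π : Equiv.Perm (Fin m)),
      (starMatrix K m *ᵥ starWedge (fun j => isoVec i j (δ j))) (transversal α ∘ π) =
      ((∏ j, (((δ j : ℤ) : K) * -i)) • starWedge (fun j => isoVec i j (δ j)))
        (transversal α ∘ π) := by
    intro α π
    rw [starMatrix_mulVec_comp_perm, star_starWedge_transversal hi, Pi.smul_apply, smul_eq_mul,
      starWedge, starMatrix_mulVec_comp_perm]
    ring
  ext a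
  by_cases h : starWedge (fun j => isoVec i j (δ j)) a = 0
  · rw [Pi.smul_apply, h, smul_zero]
    by_cases ha : Function.Injective a
    · obtain ⟨b, hb⟩ := exists_complement ha
      by_cases hb0 : starWedge (fun j => isoVec i j (δ j)) b = 0
      · rw [starWedge, starMatrix_sq_mulVec hb, ← starWedge, hb0, mul_zero]
      · obtain ⟨α, π, rfl⟩ := eq_transversal_of_starWedge_ne_zero hb0
        have hinj : Function.Injective
            (interleave (transversal α ∘ π, transversal (otherSide α) ∘ π)) := by
          rw [interleave_comp_perm]
          exact (interleave_transversal_injective α).comp (Equiv.injective _)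
        obtain ⟨π', rfl⟩ := exists_perm_of_interleave hinj (interleave_injective_swap.mp hb)
        refine (htrans (otherSide α) (π * π')).trans ?_
        rw [Pi.smul_apply]
        exact smul_eq_zero_of_right _ h
    · rw [Matrix.mulVec, dotProduct]
      exact Finset.sum_eq_zero fun b _ => by rw [starMatrix_row_eq_zero ha, zero_mul]
  · obtain ⟨α, π, rfl⟩ := eq_transversal_of_starWedge_ne_zero h
    exact htrans α π

theorem highestVector_mem (hi : i ^ 2 = -1) (hm : 1 ≤ m) (ε : ℤˣ) :
    highestVector i m ε ∈ halfSpace i m ε := by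
  rw [mem_halfSpace, highestVector, starWedge_mem hi, Finset.prod_mul_distrib, starEigenvalue]
  congr 2
  · have := congrArg (fun u : ℤˣ => ((u : ℤ) : K)) (prod_highestSign hm ε)
    push_cast at this
    exact this
  · simp

theorem highestVector_ne_zero (hi : i ^ 2 = -1) (ε : ℤˣ) : highestVector i m ε ≠ 0 := by
  intro h
  -- The complementary transversal selects the first members of the pairs, where the isotropic
  -- vectors have entry `1`.
  have h1 := congrFun h (transversal fun _ => 1)
  have hi0 : i ≠ 0 := by
    rintro rfl
    norm_num at hi
  have hl := levi_mul_self (K := K) (interleave_transversal_injective fun _ : Fin m => 1)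
  rw [highestVector, starWedge_transversal, elemTensor_isoVec_transversal, Pi.zero_apply] at h1
  refine mul_ne_zero (mul_ne_zero (inv_ne_zero (Nat.cast_ne_zero.mpr m.factorial_ne_zero))
    (left_ne_zero_of_mul_eq_one hl)) (Finset.prod_ne_zero_iff.mpr fun j _ => ?_) h1
  simp [otherSide]

end HighestWeightVector

/-! ### Existence of the representations and uniqueness of their characters. -/

section Conclusion

variable {K : Type*} [Field K] [CharZero K] {m : ℕ} {i : K}

theorem highestSign_eq_halfSpinWeight (ε : ℤˣ) (j : Fin m) :
    (((highestSign m ε j : ℤˣ) : ℤ) : ℚ) = 2 * halfSpinWeight m ε j := by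
  rw [highestSign, halfSpinWeight]
  split_ifs
  · ring
  · norm_num

theorem isD_halfRep (hi : i ^ 2 = -1) (hm : 1 ≤ m) (ε : ℤˣ) : IsD i hi ε (halfRep i m ε) where
  finite := inferInstance
  rational := halfRep_isRational ε
  irreducible := halfRep_isIrreducible hi hm ε
  highest := by
    refine ⟨fun j => (highestSign m ε j : ℤ), highestSign_eq_halfSpinWeight ε, ?_⟩
    refine isHighestWeight_of_fixed (v := ⟨_, highestVector_mem hi hm ε⟩) (halfRep_isRational ε)
      (halfRep_isIrreducible hi hm ε) (fun x => ?_) (fun h => ?_) (fun j k hjk δ s => ?_)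
    · exact Subtype.ext (highestVector_weight hi ε x)
    · exact highestVector_ne_zero hi ε (congrArg Subtype.val h)
    · exact Subtype.ext (highestVector_fixed hi ε hjk δ s)

/-- The representation obtained by transport along a linear equivalence. -/
def transportRep {G V W : Type*} [Monoid G] [AddCommGroup V] [Module K V] [AddCommGroup W]
    [Module K W] (e : V ≃ₗ[K] W) (ρ : Representation K G V) : Representation K G W where
  toFun g := e.conj (ρ g)
  map_one' := by ext; simp
  map_mul' g h := by ext; simp

theorem transportRep_apply {G V W : Type*} [Monoid G] [AddCommGroup V] [Module K V]
    [AddCommGroup W] [Module K W] (e : V ≃ₗ[K] W) (ρ : Representation K G V) (g : G) (w : W) :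
    transportRep e ρ g w = e (ρ g (e.symm w)) := by
  simp [transportRep]

/-- This moves the model from an eigenspace of the star to a coordinate space `Fin d → K`, as the
existence claim requires. -/
theorem IsD.transport {V W : Type*} [AddCommGroup V] [Module K V] [AddCommGroup W] [Module K W]
    {hi : i ^ 2 = -1} {ε : ℤˣ} {ρ : Representation K (SO m K) V} (h : IsD i hi ε ρ)
    (e : V ≃ₗ[K] W) : IsD i hi ε (transportRep e ρ) where
  finite := by
    have := h.finite
    exact Module.Finite.equiv e
  rational f w := by
    obtain ⟨p, hp⟩ := h.rational (f ∘ₗ e.toLinearMap) (e.symm w)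
    refine ⟨p, fun g => ?_⟩
    rw [← hp, transportRep_apply]
    rfl
  irreducible := by
    obtain ⟨hV, hN⟩ := isIrreducible_iff.mp h.irreducible
    refine isIrreducible_iff.mpr ⟨e.symm.toEquiv.nontrivial, fun N hstable => ?_⟩
    have hmap : (N.comap e.toLinearMap).map e.toLinearMap = N :=
      Submodule.map_comap_eq_of_surjective e.surjective N
    rcases hN (N.comap e.toLinearMap) (fun g v hv => by
      have := hstable g _ (Submodule.mem_comap.mp hv)
      rw [transportRep_apply] at this
      simpa using this) with h0 | h0
    · left
      rw [← hmap, h0, Submodule.map_bot]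
    · right
      rw [← hmap, h0, Submodule.map_top, LinearMap.range_eq_top]
      exact e.surjective
  highest := by
    obtain ⟨μ, hμ, ⟨v, hv0, hv⟩, hmax⟩ := h.highest
    refine ⟨μ, hμ, ⟨e v, by simpa using hv0, fun x => ?_⟩, fun ν hν => hmax ν ?_⟩
    · rw [transportRep_apply, e.symm_apply_apply, hv, map_smul]
    · obtain ⟨w, hw0, hw⟩ := hν
      refine ⟨e.symm w, by simpa using hw0, fun x => ?_⟩
      have := hw x
      rw [transportRep_apply] at this
      rw [← map_smul, ← this, e.symm_apply_apply]

/-- The two integral highest weights coincide, being equal to the same rational vector; a common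
maximal weight determines the character. -/
theorem IsD.trace_eq {V W : Type*} [AddCommGroup V] [Module K V] [AddCommGroup W] [Module K W]
    {hi : i ^ 2 = -1} {ε : ℤˣ} {ρ : Representation K (SO m K) V}
    {ρ' : Representation K (SO m K) W} (h : IsD i hi ε ρ) (h' : IsD i hi ε ρ') (g : SO m K) :
    LinearMap.trace K V (ρ g) = LinearMap.trace K W (ρ' g) := by
  have := h.finite
  have := h'.finite
  obtain ⟨μ, hμ, hμw⟩ := h.highest
  obtain ⟨μ', hμ', hμw'⟩ := h'.highest
  have heq : μ' = μ := by
    funext j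
    have := (hμ' j).trans (hμ j).symm
    exact_mod_cast this
  subst heq
  exact trace_eq_of_isMaximalWeight h.rational h'.rational h.irreducible h'.irreducible
    hμw.isMaximalWeight hμw'.isMaximalWeight hμw.1 hμw'.1 g

end Conclusion

end SOEven

theorem proposition2p7 {K : Type*} [Field K] [IsAlgClosed K] [CharZero K] (m : ℕ) :
    -- multilinearity, symmetry and the values on the diagonal
    SOEven.IsPfPolarization (SOEven.Q : (Fin m → Matrix (Fin (2 * m)) (Fin (2 * m)) K) → K) ∧
    -- uniqueness
    (∀ F : (Fin m → Matrix (Fin (2 * m)) (Fin (2 * m)) K) → K,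
      SOEven.IsPfPolarization F → F = SOEven.Q) ∧
    -- the full polarization: `m! * Q A` is the coefficient of `α_1 ⋯ α_m`
    (∀ A : Fin m → Matrix (Fin (2 * m)) (Fin (2 * m)) K,
      (m.factorial : K) * SOEven.Q A =
        MvPolynomial.coeff (Finsupp.equivFunOnFinite.symm fun _ : Fin m => 1)
          (2 ^ m * (m.factorial : MvPolynomial (Fin m) K) *
            SOEven.Pf (SOEven.genericSum A - (SOEven.genericSum A).transpose))) ∧
    -- the two representations exist, and the Pfaffian is the difference of their characters
    (1 ≤ m → ∀ (i : K) (hi : i ^ 2 = -1),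
      (∀ ε : ℤˣ, ∃ (d : ℕ) (ρ : Representation K (SOEven.SO m K) (Fin d → K)),
        SOEven.IsD i hi ε ρ) ∧
      ∀ (V : Type*) [AddCommGroup V] [Module K V] (W : Type*) [AddCommGroup W] [Module K W]
        (Dplus : Representation K (SOEven.SO m K) V) (Dminus : Representation K (SOEven.SO m K) W),
        SOEven.IsD i hi 1 Dplus → SOEven.IsD i hi (-1) Dminus →
        ∀ X : SOEven.SO m K,
          SOEven.Pf ((X : Matrix (Fin (2 * m)) (Fin (2 * m)) K)
              - (X : Matrix (Fin (2 * m)) (Fin (2 * m)) K).transpose) =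
            i ^ m * (LinearMap.trace K V (Dplus X) - LinearMap.trace K W (Dminus X))) := by
  refine ⟨SOEven.isPfPolarization_Q, fun F hF => SOEven.isPfPolarization_unique hF,
    SOEven.factorial_mul_Q_eq_coeff, fun hm i hi => ⟨fun ε => ?_, ?_⟩⟩
  · exact ⟨_, _, (SOEven.isD_halfRep hi hm ε).transport (Module.finBasis K _).equivFun⟩
  · intro V _ _ W _ _ Dplus Dminus hplus hminus X
    rw [hplus.trace_eq (SOEven.isD_halfRep hi hm 1), hminus.trace_eq (SOEven.isD_halfRep hi hm (-1)),
      SOEven.trace_halfRep_sub hi]
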